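/- Let $\Omega\subset\mathbb R^3$ be a bounded, connected, simply connected open set with smooth boundary, let $a,b,c,L>0$, and let $\bar S$ be the space of symmetric traceless real $3\times3$ matrices. For $Q\in\bar S$ put $$f_B(Q)=-\tfrac{a^2}{2}\operatorname{tr}Q^2-\tfrac{b^2}{3}\operatorname{tr}Q^3+\tfrac{c^2}{4}(\operatorname{tr}Q^2)^2+C,$$ where the constant $C$ is such that $f_B\ge 0$ on $\bar S$, and let $s_+=\frac{b^2+\sqrt{b^4+24a^2c^2}}{4c^2}$. Let $n_b\in W^{1,2}(\Omega;S^2)$, $Q_b=s_+(n_b\otimes n_b-\frac13 I)$, and let $\mathcal A_Q$ be the set of all $Q\in W^{1,2}(\Omega;\bar S)$ with $Q=Q_b$ on $\partial\Omega$ in the sense of traces. Let $Q^L$ be a global minimizer of $$\mathcal I[Q]=\int_\Omega \tfrac12|\nabla Q|^2+\tfrac1L f_B(Q)\,dV$$ in $\mathcal A_Q$, and suppose that $Q^L$ is uniaxial: $Q^L=s^L(n^L\otimes n^L-\frac13 I)$ almost everywhere in $\Omega$ for some $s^L:\Omega\to\mathbb R$ and $n^L\in W^{1,2}(\Omega;S^2)$.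 Then, after modification on a null set of $\Omega$, $s^L$ is continuous and nonnegative in $\Omega$ and equals $s_+>0$ on $\partial\Omega$ in the sense of traces (so that it may be regarded as a nonnegative function on $\overline\Omega$), $|n^L|=1$ everywhere in $\Omega$, and with the isotropic set $\Theta_L=\{x\in\Omega: s^L(x)=0\}$ both $s^L$ and $n^L$ are of class $C^2$ in the open set $\Omega\setminus\Theta_L$. Everywhere in $\Omega\setminus\Theta_L$ we have, with summation over the repeated index $k$, $$\Delta s^L-3s^L|\nabla n^L|^2=\frac{s^L}{3L}\left(2c^2(s^L)^2-b^2s^L-3a^2\right),$$ $$\Delta n^L_j+|\nabla n^L|^2n^L_j+2\,\frac{\partial_k s^L}{s^L}\,\partial_k n^L_j=0,\qquad j=1,2,3.$$ Moreover, each point of $\Omega\setminus\Theta_L$ at which $n^L\ne(0,0,\pm1)$ has an open neighbourhood in $\Omega\setminus\Theta_L$ on which $n^L=(\sin\theta^L\cos\phi^L,\sin\theta^L\sin\phi^L,\cos\theta^L)$ with $C^2$ functions $\theta^L,\phi^L$; and whenever $\theta^L,\phi^L$ are $C^2$ functions on an open set $U\subset\Omega\setminus\Theta_L$ for which this representation holds,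 then in $U$ $$\nabla\cdot\left((s^L)^2\nabla\theta^L\right)=(s^L)^2\sin\theta^L\cos\theta^L\,|\nabla\phi^L|^2,\qquad \nabla\cdot\left((s^L)^2\sin^2\theta^L\,\nabla\phi^L\right)=0.$$ -/

import Mathlib

open MeasureTheory Filter Topology
open scoped ContDiff ENNReal Laplacian InnerProductSpace

namespace LandauDeGennes

/-- Three-dimensional Euclidean space. -/
abbrev E3 : Type := EuclideanSpace ℝ (Fin 3)

/-- Real `3 × 3` matrices. -/
abbrev M3 : Type := Matrix (Fin 3) (Fin 3) ℝ

/-- The classical partial derivative `∂ₖ f`. -/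
noncomputable def pd (k : Fin 3) (f : E3 → ℝ) (x : E3) : ℝ :=
  fderiv ℝ f x (EuclideanSpace.single k 1)

/-! ### Domains -/

/-- The open set `Ω` has smooth boundary: near each boundary point it is the sublevel set
of a smooth function with nonvanishing differential. -/
def HasSmoothBoundary (Ω : Set E3) : Prop :=
  ∀ x ∈ frontier Ω, ∃ (U : Set E3) (ρ : E3 → ℝ), IsOpen U ∧ x ∈ U ∧
    ContDiffOn ℝ ∞ ρ U ∧ fderiv ℝ ρ x ≠ 0 ∧ Ω ∩ U = {y | y ∈ U ∧ ρ y < 0}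

/-- Bounded, connected, simply connected domains with smooth boundary. -/
structure IsNematicDomain (Ω : Set E3) : Prop where
  isOpen : IsOpen Ω
  isBounded : Bornology.IsBounded Ω
  isConnected : IsConnected Ω
  isSimplyConnected : IsSimplyConnected Ω
  smoothBoundary : HasSmoothBoundary Ω

/-! ### The Sobolev space `W^{1,2}(Ω)` -/

/-- Test functions on `Ω`: smooth with compact support contained in `Ω`. -/
def IsTestFunction (Ω : Set E3) (φ : E3 → ℝ) : Prop :=
  ContDiff ℝ ∞ φ ∧ HasCompactSupport φ ∧ tsupport φ ⊆ Ω

/-- `v ∈ L²(Ω)` is the weak `k`-th partial derivative of `u` on `Ω`. -/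
def IsWeakPartial (Ω : Set E3) (k : Fin 3) (u v : E3 → ℝ) : Prop :=
  MemLp v 2 (volume.restrict Ω) ∧
    ∀ φ : E3 → ℝ, IsTestFunction Ω φ →
      ∫ x in Ω, u x * pd k φ x = - ∫ x in Ω, v x * φ x

/-- `u ∈ W^{1,2}(Ω)`. -/
def MemW12 (Ω : Set E3) (u : E3 → ℝ) : Prop :=
  MemLp u 2 (volume.restrict Ω) ∧ ∀ k, ∃ v, IsWeakPartial Ω k u v

open Classical in
/-- The weak partial derivative (unique up to null sets in `Ω`; `0` if there is none). -/
noncomputable def weakPartial (Ω : Set E3) (k : Fin 3) (u : E3 → ℝ) : E3 → ℝ :=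
  if h : ∃ v, IsWeakPartial Ω k u v then h.choose else 0

/-- `u ∈ W₀^{1,2}(Ω)`, i.e. `u` lies in the `W^{1,2}`-closure of the test functions:
`u` vanishes on `∂Ω` in the sense of traces. -/
def MemW12Zero (Ω : Set E3) (u : E3 → ℝ) : Prop :=
  MemW12 Ω u ∧ ∀ ε : ℝ, 0 < ε → ∃ φ : E3 → ℝ, IsTestFunction Ω φ ∧
    eLpNorm (fun x => u x - φ x) 2 (volume.restrict Ω) ≤ ENNReal.ofReal ε ∧
    ∀ k, eLpNorm (fun x => weakPartial Ω k u x - pd k φ x) 2 (volume.restrict Ω)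
      ≤ ENNReal.ofReal ε

/-- `n ∈ W^{1,2}(Ω; S²)`. -/
def MemW12Sphere (Ω : Set E3) (n : E3 → E3) : Prop :=
  (∀ j, MemW12 Ω (fun x => n x j)) ∧ ∀ᵐ x ∂(volume.restrict Ω), ‖n x‖ = 1

/-! ### Q-tensors and the Landau-de Gennes energy -/

/-- The space of symmetric traceless matrices. -/
def IsQTensor (M : M3) : Prop := M.transpose = M ∧ M.trace = 0

/-- `s (n ⊗ n - I / 3)`. -/
noncomputable def uniaxial (s : ℝ) (n : E3) : M3 :=
  fun i j => s * (n i * n j - if i = j then 1 / 3 else 0)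

/-- The bulk energy density `f_B`, with additive constant `C`. -/
noncomputable def bulk (a b c C : ℝ) (M : M3) : ℝ :=
  -(a ^ 2 / 2) * (M * M).trace - b ^ 2 / 3 * (M * M * M).trace
    + c ^ 2 / 4 * (M * M).trace ^ 2 + C

/-- The order parameter `s₊` of the minimizers of the bulk energy density. -/
noncomputable def sPlus (a b c : ℝ) : ℝ :=
  (b ^ 2 + √(b ^ 4 + 24 * a ^ 2 * c ^ 2)) / (4 * c ^ 2)

/-- The energy `∫_Ω ½ |∇Q|² + f_B(Q) / L`, with values in `[0, ∞]` (the integrand is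
nonnegative on Q-tensor fields when `C` is chosen so that `f_B ≥ 0`). -/
noncomputable def energy (Ω : Set E3) (a b c C L : ℝ) (Q : E3 → M3) : ℝ≥0∞ :=
  ∫⁻ x in Ω, ENNReal.ofReal
    (1 / 2 * ∑ i, ∑ j, ∑ k, weakPartial Ω k (fun y => Q y i j) x ^ 2
      + bulk a b c C (Q x) / L)

/-- The admissible space: `Q ∈ W^{1,2}(Ω; S̄)` with
`Q = s₊ (n_b ⊗ n_b - I / 3)` on `∂Ω` in the sense of traces. -/
def Admissible (Ω : Set E3) (a b c : ℝ) (nb : E3 → E3) (Q : E3 → M3) : Prop :=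
  (∀ i j, MemW12 Ω (fun x => Q x i j)) ∧
  (∀ᵐ x ∂(volume.restrict Ω), IsQTensor (Q x)) ∧
  ∀ i j, MemW12Zero Ω (fun x => Q x i j - uniaxial (sPlus a b c) (nb x) i j)

/-- `Q` minimizes the energy among all admissible Q-tensor fields. -/
def IsGlobalMinimizer (Ω : Set E3) (a b c C L : ℝ) (nb : E3 → E3) (Q : E3 → M3) : Prop :=
  Admissible Ω a b c nb Q ∧
    ∀ P : E3 → M3, Admissible Ω a b c nb P → energy Ω a b c C L Q ≤ energy Ω a b c C L P

/-- `Q = s (n ⊗ n - I / 3)` in `Ω`, with `s : Ω → ℝ` and `n ∈ W^{1,2}(Ω; S²)`. -/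
def IsUniaxialRep (Ω : Set E3) (Q : E3 → M3) (s : E3 → ℝ) (n : E3 → E3) : Prop :=
  MemW12Sphere Ω n ∧ ∀ᵐ x ∂(volume.restrict Ω), Q x = uniaxial (s x) (n x)

/-! ### The terms of the equations -/

/-- The part of `Ω` off the isotropic set `{x ∈ Ω | s x = 0}`. -/
def anisotropicSet (Ω : Set E3) (s : E3 → ℝ) : Set E3 := {x | x ∈ Ω ∧ s x ≠ 0}

/-- `|∇ f|²` for a scalar function. -/
noncomputable def gradSq (f : E3 → ℝ) (x : E3) : ℝ := ∑ k, pd k f x ^ 2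

/-- `|∇ n|²` for a vector field. -/
noncomputable def vecGradSq (n : E3 → E3) (x : E3) : ℝ := ∑ j, gradSq (fun y => n y j) x

/-- `∇ · (w ∇ f)`. -/
noncomputable def divGrad (w f : E3 → ℝ) (x : E3) : ℝ :=
  ∑ k, pd k (fun y => w y * pd k f y) x

/-- The unit vector with spherical angles `θ, φ`. -/
noncomputable def sphericalVec (θ φ : ℝ) : E3 :=
  !₂[Real.sin θ * Real.cos φ, Real.sin θ * Real.sin φ, Real.cos θ]

end LandauDeGennes

open LandauDeGennes

/-! The proof has four ingredients: smoothness of the minimizer, a sign for the order parameter, a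
lift of the line field to a smooth director, and algebra.

Smoothness. Since `Q` minus its boundary datum lies in `W₀^{1,2} ⊆ L⁶` and the datum is bounded, the
cubic Euler-Lagrange nonlinearity lies in `L²`. Perturbing by `φ H` with a constant Q-tensor `H`
changes the energy by a polynomial of degree four in the size of the perturbation, so minimality
gives the equation weakly (`IsGlobalMinimizer.isWeakLapl`). Interior regularity for `Δ u = g` is
obtained from a dyadic decomposition of a truncated Newtonian kernel: convolutions of `u` at scales
`2⁻ⁿ` differ by convolutions of `g` with explicit small kernels, so they converge geometrically.
This gives `L² → C⁰`, then `C⁰ → C¹`, and a bootstrap (`IsGlobalMinimizer.exists_smooth_rep`).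

Sign. Replacing `s` by `|s|` keeps `tr Q²`, does not increase the gradient energy and strictly
lowers `-b²/3 tr Q³` where `s < 0`. So minimality forces `s ≥ 0` almost everywhere
(`IsGlobalMinimizer.ae_nonneg`). The competitor is `sign (tr Q³) Q`. It is weakly differentiable
because `|Q|³` is a multiple of `|tr Q³|` for uniaxial tensors, and it has the right trace because
it is a Lipschitz function of `Q` (`memW12Zero_lipschitz_comp`). The same lemma gives the trace of
`s = √(3/2) |Q|`.

Director. Where `s ≠ 0`, the tensor `n ⊗ n = Q / s + I / 3` is smooth, but it determines `n` only up
to sign. Locally some component `n_j` is nonzero, and `n_j / |n_j|` is a `W^{1,2}` function with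
values `±1`. Such a function has zero weak gradient, so it is harmonic and smooth after
modification. Hence the given Sobolev director has a `C²` representative (`exists_director`).

Equations. Inserting `s (n ⊗ n - I / 3)` in the tensor equation and contracting with `n` once and
twice, using `|n| = 1`, separates the equations for `s` and `n` (`contract_director`). The equations
for the angles are the components of the director equation in the moving frame of spherical
coordinates. -/

namespace LandauDeGennes

/-! ### Partial derivatives -/

/-- The `k`-th coordinate vector. -/
noncomputable abbrev ek (k : Fin 3) : E3 := EuclideanSpace.single k 1

theorem pd_congr {k : Fin 3} {f g : E3 → ℝ} {x : E3} (h : f =ᶠ[𝓝 x] g) : pd k f x = pd k g x := by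
  unfold pd; rw [h.fderiv_eq]

theorem pd_congr_on {k : Fin 3} {f g : E3 → ℝ} {U : Set E3} (hU : IsOpen U)
    (h : ∀ y ∈ U, f y = g y) {x : E3} (hx : x ∈ U) : pd k f x = pd k g x :=
  pd_congr (by filter_upwards [hU.mem_nhds hx] with y hy using h y hy)

theorem pd_add {k : Fin 3} {f g : E3 → ℝ} {x : E3} (hf : DifferentiableAt ℝ f x)
    (hg : DifferentiableAt ℝ g x) : pd k (fun y => f y + g y) x = pd k f x + pd k g x := by
  unfold pd; rw [fderiv_fun_add hf hg]; rfl

theorem pd_sub {k : Fin 3} {f g : E3 → ℝ} {x : E3} (hf : DifferentiableAt ℝ f x)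
    (hg : DifferentiableAt ℝ g x) : pd k (fun y => f y - g y) x = pd k f x - pd k g x := by
  unfold pd; rw [fderiv_fun_sub hf hg]; rfl

theorem pd_mul {k : Fin 3} {f g : E3 → ℝ} {x : E3} (hf : DifferentiableAt ℝ f x)
    (hg : DifferentiableAt ℝ g x) :
    pd k (fun y => f y * g y) x = pd k f x * g x + f x * pd k g x := by
  unfold pd; rw [fderiv_fun_mul hf hg]; simp; ring

@[simp] theorem pd_const (k : Fin 3) (c : ℝ) (x : E3) : pd k (fun _ => c) x = 0 := by
  simp [pd]

theorem pd_const_mul {k : Fin 3} {f : E3 → ℝ} {x : E3} (c : ℝ) (hf : DifferentiableAt ℝ f x) :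
    pd k (fun y => c * f y) x = c * pd k f x := by
  rw [pd_mul (by fun_prop) hf]; simp

theorem pd_neg (k : Fin 3) (f : E3 → ℝ) (x : E3) : pd k (fun y => - f y) x = - pd k f x := by
  unfold pd; rw [fderiv_fun_neg]; rfl

theorem pd_sum {ι : Type*} {k : Fin 3} {s : Finset ι} {f : ι → E3 → ℝ} {x : E3}
    (hf : ∀ i ∈ s, DifferentiableAt ℝ (f i) x) :
    pd k (fun y => ∑ i ∈ s, f i y) x = ∑ i ∈ s, pd k (f i) x := by
  unfold pd; rw [fderiv_fun_sum hf]; simp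

theorem pd_comp {k : Fin 3} {F : ℝ → ℝ} {f : E3 → ℝ} {x : E3} (hF : DifferentiableAt ℝ F (f x))
    (hf : DifferentiableAt ℝ f x) : pd k (fun y => F (f y)) x = deriv F (f x) * pd k f x := by
  unfold pd
  have := fderiv_comp x hF hf
  rw [show (fun y => F (f y)) = F ∘ f from rfl, this]
  simp [mul_comm]

theorem contDiffOn_pd {k : Fin 3} {m n : ℕ∞ω} {f : E3 → ℝ} {U : Set E3} (hU : IsOpen U)
    (hf : ContDiffOn ℝ n f U) (h : m + 1 ≤ n) : ContDiffOn ℝ m (pd k f) U :=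
  (hf.fderiv_of_isOpen hU h).clm_apply contDiffOn_const

theorem contDiff_pd {k : Fin 3} {f : E3 → ℝ} (hf : ContDiff ℝ ∞ f) : ContDiff ℝ ∞ (pd k f) :=
  (hf.fderiv_right (m := ∞) (by simp)).clm_apply contDiff_const

theorem tsupport_pd_subset (k : Fin 3) (f : E3 → ℝ) : tsupport (pd k f) ⊆ tsupport f := by
  refine (closure_mono ?_).trans (tsupport_fderiv_subset ℝ (f := f))
  intro x hx
  simp only [Function.mem_support, pd] at hx ⊢
  intro h; apply hx; rw [h]; rfl

theorem pd_comm {i j : Fin 3} {f : E3 → ℝ} {x : E3} (hf : ContDiffAt ℝ 2 f x) :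
    pd i (pd j f) x = pd j (pd i f) x := by
  have key : ∀ i j : Fin 3, pd i (pd j f) x = fderiv ℝ (fderiv ℝ f) x (ek i) (ek j) := by
    intro i j
    have hd : DifferentiableAt ℝ (fderiv ℝ f) x :=
      (hf.fderiv_right (m := 1) (by norm_num)).differentiableAt (by simp)
    show fderiv ℝ (fun y => fderiv ℝ f y (ek j)) x (ek i) = _
    rw [fderiv_clm_apply hd (differentiableAt_const _)]
    simp
  rw [key, key]
  exact (hf.isSymmSndFDerivAt (by simp)).eq _ _

/-- The Laplacian as the sum of the pure second partial derivatives. -/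
noncomputable def lapl (f : E3 → ℝ) (x : E3) : ℝ := ∑ k, pd k (pd k f) x

theorem laplacian_eq_lapl {f : E3 → ℝ} {x : E3} (hf : ContDiffAt ℝ 2 f x) :
    Δ f x = lapl f x := by
  rw [InnerProductSpace.laplacian_eq_iteratedFDeriv_orthonormalBasis f
    (EuclideanSpace.basisFun (Fin 3) ℝ)]
  unfold lapl
  refine Finset.sum_congr rfl fun k _ => ?_
  have hd : DifferentiableAt ℝ (fderiv ℝ f) x :=
    (hf.fderiv_right (m := 1) (by norm_num)).differentiableAt (by simp)
  rw [iteratedFDeriv_two_apply]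
  show _ = fderiv ℝ (fun y => fderiv ℝ f y (ek k)) x (ek k)
  rw [fderiv_clm_apply hd (differentiableAt_const _)]
  simp

theorem contDiff_lapl {f : E3 → ℝ} (hf : ContDiff ℝ ∞ f) : ContDiff ℝ ∞ (lapl f) :=
  ContDiff.sum fun _ _ => contDiff_pd (contDiff_pd hf)

theorem norm_fderiv_le_sum_pd (f : E3 → ℝ) (x : E3) : ‖fderiv ℝ f x‖ ≤ ∑ k, |pd k f x| := by
  refine ContinuousLinearMap.opNorm_le_bound _ (Finset.sum_nonneg fun _ _ => abs_nonneg _) ?_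
  intro v
  have hv : v = ∑ k, v k • ek k := by
    ext i; simp [Finset.sum_apply, Pi.single_apply]
  have : fderiv ℝ f x v = ∑ k, v k * pd k f x := by
    conv_lhs => rw [hv]
    rw [map_sum]; simp [pd]
  rw [this, Finset.sum_mul]
  refine (norm_sum_le _ _).trans (Finset.sum_le_sum fun k _ => ?_)
  rw [norm_mul, mul_comm, Real.norm_eq_abs (pd k f x)]
  exact mul_le_mul_of_nonneg_left (PiLp.norm_apply_le v k) (abs_nonneg _)

/-! ### Test functions -/

namespace IsTestFunction

variable {Ω : Set E3} {φ ψ : E3 → ℝ}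

theorem differentiableAt (h : IsTestFunction Ω φ) (x : E3) : DifferentiableAt ℝ φ x :=
  (h.1.differentiable (by simp)) x

theorem eq_zero (h : IsTestFunction Ω φ) {x : E3} (hx : x ∉ Ω) : φ x = 0 :=
  image_eq_zero_of_notMem_tsupport fun h' => hx (h.2.2 h')

theorem of_subset (hφ : ContDiff ℝ ∞ φ) (hψ : IsTestFunction Ω ψ)
    (h : Function.support φ ⊆ tsupport ψ) : IsTestFunction Ω φ := by
  have h' : tsupport φ ⊆ tsupport ψ := closure_minimal h (isClosed_tsupport _)
  exact ⟨hφ, hψ.2.1.of_isClosed_subset (isClosed_tsupport _) h', h'.trans hψ.2.2⟩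

theorem mono {U : Set E3} (h : IsTestFunction U φ) (hU : U ⊆ Ω) : IsTestFunction Ω φ :=
  ⟨h.1, h.2.1, h.2.2.trans hU⟩

theorem zero : IsTestFunction Ω (fun _ => 0) := by
  refine ⟨contDiff_const, HasCompactSupport.zero, ?_⟩
  have : tsupport (fun _ : E3 => (0 : ℝ)) = ∅ := tsupport_eq_empty_iff.2 rfl
  simp [this]

theorem add (hφ : IsTestFunction Ω φ) (hψ : IsTestFunction Ω ψ) :
    IsTestFunction Ω (fun x => φ x + ψ x) :=
  ⟨hφ.1.add hψ.1, hφ.2.1.add hψ.2.1,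
    (tsupport_add φ ψ).trans (Set.union_subset hφ.2.2 hψ.2.2)⟩

theorem const_mul (c : ℝ) (hφ : IsTestFunction Ω φ) : IsTestFunction Ω (fun x => c * φ x) :=
  of_subset (contDiff_const.mul hφ.1) hφ fun x hx => subset_tsupport _ (by
    intro h; apply hx; show c * φ x = 0; rw [h, mul_zero])

theorem sum {ι : Type*} {s : Finset ι} {f : ι → E3 → ℝ} (h : ∀ i ∈ s, IsTestFunction Ω (f i)) :
    IsTestFunction Ω (fun x => ∑ i ∈ s, f i x) := by
  classical
  induction s using Finset.induction_on with
  | empty => simpa using zero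
  | insert a s ha ih =>
    simp only [Finset.sum_insert ha]
    exact (h a (by simp)).add (ih fun i hi => h i (by simp [hi]))

/-- The values of `g` outside `Ω` play no role: off the support of `φ` the product vanishes near
each point. -/
theorem mul_contDiffOn {g : E3 → ℝ} (hΩ : IsOpen Ω) (hg : ContDiffOn ℝ ∞ g Ω)
    (hφ : IsTestFunction Ω φ) : IsTestFunction Ω (fun x => g x * φ x) := by
  refine of_subset ?_ hφ fun x hx => subset_tsupport _ (by
    intro h; apply hx; show g x * φ x = 0; rw [h, mul_zero])
  rw [contDiff_iff_contDiffAt]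
  intro x
  by_cases hx : x ∈ tsupport φ
  · exact (hg.contDiffAt (hΩ.mem_nhds (hφ.2.2 hx))).mul hφ.1.contDiffAt
  · have : (fun x => g x * φ x) =ᶠ[𝓝 x] fun _ => 0 := by
      filter_upwards [(isClosed_tsupport φ).isOpen_compl.mem_nhds hx] with y hy
      rw [image_eq_zero_of_notMem_tsupport hy, mul_zero]
    exact contDiffAt_const.congr_of_eventuallyEq this

theorem pd (k : Fin 3) (hφ : IsTestFunction Ω φ) : IsTestFunction Ω (pd k φ) :=
  of_subset (contDiff_pd hφ.1) hφ ((subset_tsupport _).trans (tsupport_pd_subset k φ))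

theorem lapl (hφ : IsTestFunction Ω φ) : IsTestFunction Ω (lapl φ) :=
  sum fun _ _ => (hφ.pd _).pd _

theorem continuous (hφ : IsTestFunction Ω φ) : Continuous φ := hφ.1.continuous

theorem integrable (hφ : IsTestFunction Ω φ) : Integrable φ :=
  hφ.continuous.integrable_of_hasCompactSupport hφ.2.1

theorem memLp (hφ : IsTestFunction Ω φ) (p : ℝ≥0∞) (μ : Measure E3) [IsFiniteMeasureOnCompacts μ] :
    MemLp φ p μ := hφ.continuous.memLp_of_hasCompactSupport hφ.2.1

theorem exists_bound (hφ : IsTestFunction Ω φ) : ∃ B, 0 ≤ B ∧ ∀ x, |φ x| ≤ B := by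
  obtain ⟨B, hB⟩ := hφ.2.1.exists_bound_of_continuous hφ.continuous
  exact ⟨B, (norm_nonneg _).trans (hB 0), hB⟩

theorem integral_mul (hφ : IsTestFunction Ω φ) (u : E3 → ℝ) :
    ∫ x in Ω, u x * φ x = ∫ x, u x * φ x :=
  setIntegral_eq_integral_of_forall_compl_eq_zero fun x hx => by rw [hφ.eq_zero hx, mul_zero]

theorem setIntegral_mul_mono {U : Set E3} (hφ : IsTestFunction U φ) (hU : U ⊆ Ω) (u : E3 → ℝ) :
    ∫ x in Ω, u x * φ x = ∫ x in U, u x * φ x := by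
  rw [hφ.integral_mul, (hφ.mono hU).integral_mul]

theorem integrableOn_mul (hφ : IsTestFunction Ω φ) {u : E3 → ℝ} {μ : Measure E3}
    (hu : Integrable u μ) : Integrable (fun x => u x * φ x) μ := by
  obtain ⟨B, -, hB⟩ := hφ.exists_bound
  exact hu.mul_bdd (c := B) hφ.continuous.aestronglyMeasurable (Eventually.of_forall hB)

/-- A product with a function that is continuous on the domain is integrable. -/
theorem integrable_mul_of_continuousOn (hΩ : IsOpen Ω) (hφ : IsTestFunction Ω φ) {u : E3 → ℝ}
    (hu : ContinuousOn u Ω) : Integrable (fun x => u x * φ x) := by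
  have hs : Function.support (fun x => u x * φ x) ⊆ tsupport φ := fun x hx =>
    subset_tsupport _ (by intro h; apply hx; show u x * φ x = 0; rw [h, mul_zero])
  refine Continuous.integrable_of_hasCompactSupport ?_
    (hφ.2.1.of_isClosed_subset (isClosed_tsupport _)
      (closure_minimal hs (isClosed_tsupport _)))
  rw [continuous_iff_continuousAt]
  intro x
  by_cases hx : x ∈ tsupport φ
  · exact (hu.continuousAt (hΩ.mem_nhds (hφ.2.2 hx))).mul hφ.continuous.continuousAt
  · have : (fun x => u x * φ x) =ᶠ[𝓝 x] fun _ => 0 := by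
      filter_upwards [(isClosed_tsupport φ).isOpen_compl.mem_nhds hx] with y hy
      rw [image_eq_zero_of_notMem_tsupport hy, mul_zero]
    exact continuousAt_const.congr this.symm

end IsTestFunction

/-- Integration by parts against a test function. -/
theorem integral_mul_pd {Ω : Set E3} (hΩ : IsOpen Ω) {u φ : E3 → ℝ} (hu : ContDiffOn ℝ 1 u Ω)
    (hφ : IsTestFunction Ω φ) (k : Fin 3) :
    ∫ x in Ω, u x * pd k φ x = - ∫ x in Ω, pd k u x * φ x := by
  rw [(hφ.pd k).integral_mul, hφ.integral_mul]
  refine integral_mul_fderiv_eq_neg_fderiv_mul_of_integrable ?_ ?_ ?_ ?_ ?_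
  · exact hφ.integrable_mul_of_continuousOn hΩ
      (contDiffOn_pd (m := 0) hΩ hu (by simp)).continuousOn
  · exact (hφ.pd k).integrable_mul_of_continuousOn hΩ hu.continuousOn
  · exact hφ.integrable_mul_of_continuousOn hΩ hu.continuousOn
  · exact fun x hx => (hu.contDiffAt (hΩ.mem_nhds (hφ.2.2 hx))).differentiableAt (by simp)
  · exact fun x _ => hφ.differentiableAt x

/-! ### Weak derivatives -/

/-- The fundamental lemma of the calculus of variations. It underlies the uniqueness of weak
derivatives and the passage from distributional to pointwise equations. -/
theorem ae_eq_of_forall_integral_eq {Ω : Set E3} (hΩ : IsOpen Ω) {v w : E3 → ℝ}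
    (hv : LocallyIntegrableOn v Ω) (hw : LocallyIntegrableOn w Ω)
    (h : ∀ φ, IsTestFunction Ω φ → ∫ x in Ω, v x * φ x = ∫ x in Ω, w x * φ x) :
    v =ᵐ[volume.restrict Ω] w := by
  have := hΩ.ae_eq_zero_of_integral_contDiff_smul_eq_zero (f := fun x => v x - w x)
    (μ := volume) (hv.sub hw) ?_
  · rw [EventuallyEq, ae_restrict_iff' hΩ.measurableSet]
    filter_upwards [this] with x hx hxΩ
    linarith [hx hxΩ]
  · intro g hg hgc hgs
    have ht : IsTestFunction Ω g := ⟨hg, hgc, hgs⟩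
    have key : ∀ z : E3 → ℝ, LocallyIntegrableOn z Ω → Integrable (fun x => z x * g x) := by
      intro z hz
      have h1 : IntegrableOn z (tsupport g) :=
        hz.integrableOn_compact_subset hgs hgc
      have h2 := ht.integrableOn_mul h1
      have h3 : (fun x => z x * g x) = (tsupport g).indicator (fun x => z x * g x) := by
        ext x
        by_cases hx : x ∈ tsupport g
        · rw [Set.indicator_of_mem hx]
        · rw [Set.indicator_of_notMem hx, image_eq_zero_of_notMem_tsupport hx, mul_zero]
      rw [h3]
      exact (integrable_indicator_iff (isClosed_tsupport g).measurableSet).2 h2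
    have h' := h g ht
    rw [ht.integral_mul, ht.integral_mul] at h'
    have : (fun x => g x • (v x - w x)) = fun x => v x * g x - w x * g x := by
      ext x; simp; ring
    rw [this, integral_sub (key v hv) (key w hw), h', sub_self]

theorem locallyIntegrableOn_of_memLp {Ω : Set E3} {v : E3 → ℝ}
    (hv : MemLp v 2 (volume.restrict Ω)) : LocallyIntegrableOn v Ω := by
  have : LocallyIntegrable v (volume.restrict Ω) := hv.locallyIntegrable (by norm_num)
  exact fun x _ => by
    obtain ⟨s, hs, hi⟩ := this x
    refine ⟨Ω ∩ s, ?_, ?_⟩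
    · exact inter_mem_nhdsWithin _ hs
    · rw [IntegrableOn, Measure.restrict_restrict_of_subset Set.inter_subset_left |>.symm,
        ← IntegrableOn]
      exact hi.mono_set Set.inter_subset_right

namespace IsWeakPartial

variable {Ω : Set E3} {k : Fin 3} {u u' v v' : E3 → ℝ}

theorem ae_eq (hΩ : IsOpen Ω) (h : IsWeakPartial Ω k u v) (h' : IsWeakPartial Ω k u v') :
    v =ᵐ[volume.restrict Ω] v' := by
  refine ae_eq_of_forall_integral_eq hΩ (locallyIntegrableOn_of_memLp h.1)
    (locallyIntegrableOn_of_memLp h'.1) fun φ hφ => ?_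
  have h1 := h.2 φ hφ
  have h2 := h'.2 φ hφ
  linarith

theorem congr (h : IsWeakPartial Ω k u v) (hu : u =ᵐ[volume.restrict Ω] u')
    (hv : v =ᵐ[volume.restrict Ω] v') : IsWeakPartial Ω k u' v' := by
  refine ⟨h.1.ae_eq hv, fun φ hφ => ?_⟩
  have h1 : ∫ x in Ω, u x * LandauDeGennes.pd k φ x = ∫ x in Ω, u' x * LandauDeGennes.pd k φ x :=
    integral_congr_ae (by filter_upwards [hu] with x hx; rw [hx])
  have h2 : ∫ x in Ω, v x * φ x = ∫ x in Ω, v' x * φ x :=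
    integral_congr_ae (by filter_upwards [hv] with x hx; rw [hx])
  rw [← h1, ← h2, h.2 φ hφ]

theorem mul_integrable {φ w : E3 → ℝ} (hw : MemLp w 2 (volume.restrict Ω))
    (hφ : IsTestFunction Ω φ) : Integrable (fun x => w x * φ x) (volume.restrict Ω) :=
  hw.integrable_mul (hφ.memLp 2 _)

theorem add (hu : MemLp u 2 (volume.restrict Ω)) (hu' : MemLp u' 2 (volume.restrict Ω))
    (h : IsWeakPartial Ω k u v) (h' : IsWeakPartial Ω k u' v') :
    IsWeakPartial Ω k (fun x => u x + u' x) (fun x => v x + v' x) := by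
  refine ⟨h.1.add h'.1, fun φ hφ => ?_⟩
  simp only [add_mul]
  rw [integral_add (mul_integrable hu (hφ.pd k)) (mul_integrable hu' (hφ.pd k)),
    integral_add (mul_integrable h.1 hφ) (mul_integrable h'.1 hφ), h.2 φ hφ, h'.2 φ hφ]
  ring

theorem const_mul (c : ℝ) (h : IsWeakPartial Ω k u v) :
    IsWeakPartial Ω k (fun x => c * u x) (fun x => c * v x) := by
  refine ⟨h.1.const_mul c, fun φ hφ => ?_⟩
  simp only [mul_assoc, integral_const_mul, h.2 φ hφ]
  ring

theorem sub (hu : MemLp u 2 (volume.restrict Ω)) (hu' : MemLp u' 2 (volume.restrict Ω))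
    (h : IsWeakPartial Ω k u v) (h' : IsWeakPartial Ω k u' v') :
    IsWeakPartial Ω k (fun x => u x - u' x) (fun x => v x - v' x) := by
  have := add hu (hu'.const_mul (-1)) h (h'.const_mul (-1))
  simpa [sub_eq_add_neg] using this

theorem mono {U : Set E3} (h : IsWeakPartial Ω k u v) (hU : U ⊆ Ω) : IsWeakPartial U k u v := by
  refine ⟨h.1.mono_measure (Measure.restrict_mono_set _ hU), fun φ hφ => ?_⟩
  rw [← (hφ.pd k).setIntegral_mul_mono hU, ← hφ.setIntegral_mul_mono hU]
  exact h.2 φ (hφ.mono hU)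

theorem memW12_weakPartial (h : IsWeakPartial Ω k u v) :
    IsWeakPartial Ω k u (weakPartial Ω k u) := by
  have hex : ∃ v, IsWeakPartial Ω k u v := ⟨v, h⟩
  unfold weakPartial
  rw [dif_pos hex]
  exact hex.choose_spec

theorem weakPartial_ae_eq (hΩ : IsOpen Ω) (h : IsWeakPartial Ω k u v) :
    weakPartial Ω k u =ᵐ[volume.restrict Ω] v :=
  h.memW12_weakPartial.ae_eq hΩ h

end IsWeakPartial

theorem IsTestFunction.isWeakPartial {Ω : Set E3} (hΩ : IsOpen Ω) {φ : E3 → ℝ}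
    (hφ : IsTestFunction Ω φ) (k : Fin 3) : IsWeakPartial Ω k φ (LandauDeGennes.pd k φ) :=
  ⟨(hφ.pd k).memLp 2 _, fun _ hψ => integral_mul_pd hΩ (hφ.1.contDiffOn.of_le (by simp)) hψ k⟩

namespace MemW12

variable {Ω : Set E3} {u u' : E3 → ℝ}

theorem isWeakPartial (h : MemW12 Ω u) (k : Fin 3) : IsWeakPartial Ω k u (weakPartial Ω k u) :=
  (h.2 k).choose_spec.memW12_weakPartial

theorem congr (h : MemW12 Ω u) (hu : u =ᵐ[volume.restrict Ω] u') : MemW12 Ω u' :=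
  ⟨h.1.ae_eq hu, fun k => ⟨_, (h.isWeakPartial k).congr hu EventuallyEq.rfl⟩⟩

theorem add (h : MemW12 Ω u) (h' : MemW12 Ω u') : MemW12 Ω (fun x => u x + u' x) :=
  ⟨h.1.add h'.1, fun k => ⟨_, (h.isWeakPartial k).add h.1 h'.1 (h'.isWeakPartial k)⟩⟩

theorem sub (h : MemW12 Ω u) (h' : MemW12 Ω u') : MemW12 Ω (fun x => u x - u' x) :=
  ⟨h.1.sub h'.1, fun k => ⟨_, (h.isWeakPartial k).sub h.1 h'.1 (h'.isWeakPartial k)⟩⟩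

end MemW12

theorem IsTestFunction.memW12 {Ω : Set E3} (hΩ : IsOpen Ω) {φ : E3 → ℝ}
    (hφ : IsTestFunction Ω φ) : MemW12 Ω φ :=
  ⟨hφ.memLp 2 _, fun k => ⟨_, hφ.isWeakPartial hΩ k⟩⟩

/-- `weakPartial` is made by choice, so for two almost everywhere equal functions the chosen
derivatives agree only almost everywhere. That is enough for the `L²` norms. -/
theorem MemW12Zero.congr {Ω : Set E3} (hΩ : IsOpen Ω) {u u' : E3 → ℝ} (h : MemW12Zero Ω u)
    (hu : u =ᵐ[volume.restrict Ω] u') : MemW12Zero Ω u' := by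
  refine ⟨h.1.congr hu, fun ε hε => ?_⟩
  obtain ⟨φ, hφ, h1, h2⟩ := h.2 ε hε
  refine ⟨φ, hφ, ?_, fun k => ?_⟩
  · rwa [eLpNorm_congr_ae (g := fun x => u x - φ x)]
    filter_upwards [hu] with x hx; rw [hx]
  · rw [eLpNorm_congr_ae (g := fun x => weakPartial Ω k u x - LandauDeGennes.pd k φ x)]
    · exact h2 k
    · filter_upwards [((h.1.isWeakPartial k).congr hu EventuallyEq.rfl).weakPartial_ae_eq hΩ]
        with x hx
      rw [hx]

/-- Adding a test function does not change the boundary values. -/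
theorem MemW12Zero.add_test {Ω : Set E3} (hΩ : IsOpen Ω) {u ψ : E3 → ℝ} (h : MemW12Zero Ω u)
    (hψ : IsTestFunction Ω ψ) : MemW12Zero Ω (fun x => u x + ψ x) := by
  refine ⟨h.1.add (hψ.memW12 hΩ), fun ε hε => ?_⟩
  obtain ⟨φ, hφ, h1, h2⟩ := h.2 ε hε
  refine ⟨_, hφ.add hψ, ?_, fun k => ?_⟩
  · simpa [add_sub_add_right_eq_sub] using h1
  · rw [eLpNorm_congr_ae (g := fun x => weakPartial Ω k u x - LandauDeGennes.pd k φ x)]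
    · exact h2 k
    · filter_upwards [((h.1.isWeakPartial k).add h.1.1 (hψ.memLp 2 _)
        (hψ.isWeakPartial hΩ k)).weakPartial_ae_eq hΩ] with x hx
      rw [hx, pd_add (hφ.differentiableAt x) (hψ.differentiableAt x)]
      ring

/-! ### Square-integrable functions -/

theorem sq_eLpNorm_two {α : Type*} [MeasurableSpace α] (μ : Measure α) (f : α → ℝ) :
    eLpNorm f 2 μ ^ 2 = ∫⁻ x, ENNReal.ofReal (f x ^ 2) ∂μ := by
  have h := eLpNorm_nnreal_pow_eq_lintegral (f := f) (μ := μ) (p := 2) (by norm_num)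
  have e : ((2 : NNReal) : ℝ) = ((2 : ℕ) : ℝ) := by norm_num
  rw [e] at h
  simp only [ENNReal.rpow_natCast] at h
  rw [show ((2 : NNReal) : ℝ≥0∞) = 2 by norm_num] at h
  rw [h]
  refine lintegral_congr fun x => ?_
  rw [Real.enorm_eq_ofReal_abs, ← ENNReal.ofReal_pow (abs_nonneg _), sq_abs]

theorem eLpNorm_two_le_iff {α : Type*} [MeasurableSpace α] {μ : Measure α} {f : α → ℝ} {C : ℝ≥0∞} :
    eLpNorm f 2 μ ≤ C ↔ ∫⁻ x, ENNReal.ofReal (f x ^ 2) ∂μ ≤ C ^ 2 := by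
  rw [← sq_eLpNorm_two]
  exact (ENNReal.pow_le_pow_left_iff (by norm_num)).symm

theorem eLpNorm_two_le_of_integral_le {α β : Type*} [MeasurableSpace α] [MeasurableSpace β]
    {μ : Measure α} {ν : Measure β} {f : α → ℝ} {g : β → ℝ}
    (hf : Integrable (fun x => f x ^ 2) μ) (hg : Integrable (fun x => g x ^ 2) ν)
    (h : ∫ x, f x ^ 2 ∂μ ≤ ∫ x, g x ^ 2 ∂ν) : eLpNorm f 2 μ ≤ eLpNorm g 2 ν := by
  rw [eLpNorm_two_le_iff, sq_eLpNorm_two,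
    ← ofReal_integral_eq_lintegral_ofReal hf (Eventually.of_forall fun x => sq_nonneg _),
    ← ofReal_integral_eq_lintegral_ofReal hg (Eventually.of_forall fun x => sq_nonneg _)]
  exact ENNReal.ofReal_le_ofReal h

/-- Cauchy-Schwarz in integrated form. -/
theorem abs_integral_mul_le {α : Type*} [MeasurableSpace α] {μ : Measure α} {f g : α → ℝ}
    (hf : MemLp f 2 μ) (hg : MemLp g 2 μ) :
    ENNReal.ofReal |∫ x, f x * g x ∂μ| ≤ eLpNorm f 2 μ * eLpNorm g 2 μ := by
  have h1 : ENNReal.ofReal |∫ x, f x * g x ∂μ| ≤ eLpNorm (fun x => f x * g x) 1 μ := by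
    rw [← Real.enorm_eq_ofReal_abs, eLpNorm_one_eq_lintegral_enorm]
    exact enorm_integral_le_lintegral_enorm _
  refine h1.trans ?_
  have := eLpNorm_smul_le_mul_eLpNorm (p := 2) (q := 2) (r := 1) (μ := μ) hg.1 hf.1
  exact this

/-! ### Convolution with smooth kernels -/

/-- The convolution of `f`, extended by zero off `Ω`, with the kernel `η`. -/
noncomputable def smear (Ω : Set E3) (f η : E3 → ℝ) (x : E3) : ℝ := ∫ y in Ω, f y * η (x - y)

section smear

variable {Ω : Set E3} {f g η : E3 → ℝ}

theorem smear_eq_convolution (hΩ : MeasurableSet Ω) (f η : E3 → ℝ) :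
    smear Ω f η = convolution (Ω.indicator f) η (ContinuousLinearMap.mul ℝ ℝ) volume := by
  ext x
  unfold smear convolution
  rw [← integral_indicator hΩ]
  refine integral_congr_ae (Eventually.of_forall fun y => ?_)
  by_cases hy : y ∈ Ω <;> simp [hy]

theorem locallyIntegrable_indicator (hΩ : MeasurableSet Ω) (hf : IntegrableOn f Ω) :
    LocallyIntegrable (Ω.indicator f) :=
  ((integrable_indicator_iff hΩ).2 hf).locallyIntegrable

theorem contDiff_smear (hΩ : MeasurableSet Ω) (hf : IntegrableOn f Ω) (hη : ContDiff ℝ ∞ η)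
    (hη' : HasCompactSupport η) : ContDiff ℝ ∞ (smear Ω f η) := by
  rw [smear_eq_convolution hΩ]
  exact hη'.contDiff_convolution_right _ (locallyIntegrable_indicator hΩ hf) hη

theorem continuous_smear (hΩ : MeasurableSet Ω) (hf : IntegrableOn f Ω) (hη : ContDiff ℝ ∞ η)
    (hη' : HasCompactSupport η) : Continuous (smear Ω f η) :=
  (contDiff_smear hΩ hf hη hη').continuous

theorem pd_smear (hΩ : MeasurableSet Ω) (hf : IntegrableOn f Ω) (hη : ContDiff ℝ ∞ η)
    (hη' : HasCompactSupport η) (k : Fin 3) (x : E3) :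
    pd k (smear Ω f η) x = smear Ω f (pd k η) x := by
  have h := hη'.hasFDerivAt_convolution_right (ContinuousLinearMap.mul ℝ ℝ)
    (locallyIntegrable_indicator hΩ hf) (hη.of_le (by simp)) x
  rw [← smear_eq_convolution hΩ] at h
  rw [smear_eq_convolution hΩ f (pd k η)]
  unfold pd
  rw [h.fderiv]
  unfold convolution
  rw [ContinuousLinearMap.integral_apply]
  · simp
  · exact (hη'.fderiv ℝ).convolutionExists_right _ (locallyIntegrable_indicator hΩ hf)
      (hη.continuous_fderiv (by simp)) x

theorem pd_reflect (k : Fin 3) (hη : ContDiff ℝ ∞ η) (x y : E3) :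
    pd k (fun z => η (x - z)) y = - pd k η (x - y) := by
  unfold pd
  have h : HasFDerivAt η (fderiv ℝ η (x - y)) (x - y) :=
    (hη.differentiable (by simp) _).hasFDerivAt
  have h2 : HasFDerivAt (fun z => x - z) (-ContinuousLinearMap.id ℝ E3) y :=
    (hasFDerivAt_id y).const_sub x
  have h3 : HasFDerivAt (fun z => η (x - z)) _ y := h.comp y h2
  rw [h3.fderiv]
  simp

theorem lapl_reflect (hη : ContDiff ℝ ∞ η) (x y : E3) :
    lapl (fun z => η (x - z)) y = lapl η (x - y) := by
  unfold lapl
  refine Finset.sum_congr rfl fun k _ => ?_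
  rw [show pd k (fun z => η (x - z)) = fun z => - pd k η (x - z) from
    funext fun z => pd_reflect k hη x z, pd_neg, pd_reflect k (contDiff_pd hη), neg_neg]

theorem isTestFunction_reflect (hη : ContDiff ℝ ∞ η) {r : ℝ}
    (hs : Function.support η ⊆ Metric.closedBall 0 r) {x : E3} (hx : Metric.closedBall x r ⊆ Ω) :
    IsTestFunction Ω (fun y => η (x - y)) := by
  have h : tsupport (fun y => η (x - y)) ⊆ Metric.closedBall x r := by
    refine closure_minimal (fun y hy => ?_) Metric.isClosed_closedBall
    have : x - y ∈ Metric.closedBall (0 : E3) r := hs hy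
    rw [mem_closedBall_zero_iff] at this
    rwa [Metric.mem_closedBall, dist_comm, dist_eq_norm]
  exact ⟨hη.comp (contDiff_const.sub contDiff_id),
    (isCompact_closedBall x r).of_isClosed_subset (isClosed_tsupport _) h, h.trans hx⟩

theorem pd_smear_weak (hΩ : IsOpen Ω) {u v : E3 → ℝ} {k : Fin 3} (hu : IntegrableOn u Ω)
    (h : IsWeakPartial Ω k u v) (hη : ContDiff ℝ ∞ η) (hη' : HasCompactSupport η) {r : ℝ}
    (hs : Function.support η ⊆ Metric.closedBall 0 r) {x : E3} (hx : Metric.closedBall x r ⊆ Ω) :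
    pd k (smear Ω u η) x = smear Ω v η x := by
  rw [pd_smear hΩ.measurableSet hu hη hη']
  have := h.2 _ (isTestFunction_reflect hη hs hx)
  simp only [pd_reflect k hη, mul_neg, integral_neg, neg_inj] at this
  exact this

/-- Convolution with a probability density is a contraction of `L²`. -/
theorem eLpNorm_smear_le (hΩ : MeasurableSet Ω) (hfi : IntegrableOn f Ω)
    (hf : MemLp f 2 (volume.restrict Ω)) (hη : ContDiff ℝ ∞ η) (hη' : HasCompactSupport η)
    (hpos : ∀ x, 0 ≤ η x) (h1 : ∫ x, η x = 1) :
    eLpNorm (smear Ω f η) 2 volume ≤ eLpNorm f 2 (volume.restrict Ω) := by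
  set F := Ω.indicator f with hF
  have hFi : Integrable F := (integrable_indicator_iff hΩ).2 hfi
  have hF2 : Integrable (fun x => F x ^ 2) := by
    have : (fun x => F x ^ 2) = Ω.indicator (fun x => f x ^ 2) := by
      ext x; by_cases hx : x ∈ Ω <;> simp [hF, hx]
    rw [this, integrable_indicator_iff hΩ]
    exact hf.integrable_sq
  have hηi : Integrable η := hη.continuous.integrable_of_hasCompactSupport hη'
  have hconv : Integrable (convolution (fun x => F x ^ 2) η (ContinuousLinearMap.mul ℝ ℝ) volume) :=
    hF2.integrable_convolution _ hηi
  obtain ⟨B, hB⟩ := hη'.exists_bound_of_continuous hη.continuous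
  have hpt : ∀ x, smear Ω f η x ^ 2 ≤
      convolution (fun x => F x ^ 2) η (ContinuousLinearMap.mul ℝ ℝ) volume x := by
    intro x
    rw [smear_eq_convolution hΩ]
    unfold convolution
    simp only [ContinuousLinearMap.mul_apply']
    have hmeas : AEStronglyMeasurable (fun t => η (x - t)) (volume : Measure E3) :=
      (hη.continuous.comp (continuous_const.sub continuous_id)).aestronglyMeasurable
    have i1 : Integrable (fun t => F t * η (x - t)) :=
      hFi.mul_bdd (c := B) hmeas (Eventually.of_forall fun t => hB _)
    have i2 : Integrable (fun t => F t ^ 2 * η (x - t)) :=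
      hF2.mul_bdd (c := B) hmeas (Eventually.of_forall fun t => hB _)
    have i3 : Integrable (fun t => η (x - t)) := hηi.comp_sub_left x
    have e3 : ∫ t, η (x - t) = 1 := by rw [integral_sub_left_eq_self η volume x, h1]
    set c := ∫ t, F t * η (x - t) with hc
    -- Jensen's inequality for the probability density `η (x - ·)`, in the form that the variance of
    -- `F` around its mean `c` is nonnegative.
    have h0 : 0 ≤ ∫ t, (F t - c) ^ 2 * η (x - t) :=
      integral_nonneg fun t => mul_nonneg (sq_nonneg _) (hpos _)
    have e : ∫ t, (F t - c) ^ 2 * η (x - t) = (∫ t, F t ^ 2 * η (x - t)) - c ^ 2 := by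
      have : (fun t => (F t - c) ^ 2 * η (x - t)) = fun t =>
          (F t ^ 2 * η (x - t) - 2 * c * (F t * η (x - t))) + c ^ 2 * η (x - t) := by
        ext t; ring
      have s1 : ∫ t, (F t ^ 2 * η (x - t) - 2 * c * (F t * η (x - t))) + c ^ 2 * η (x - t)
          = (∫ t, F t ^ 2 * η (x - t) - 2 * c * (F t * η (x - t))) + ∫ t, c ^ 2 * η (x - t) :=
        integral_add (i2.sub (i1.const_mul _)) (i3.const_mul _)
      rw [this, s1, integral_sub i2 (i1.const_mul _), integral_const_mul, integral_const_mul, e3,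
        ← hc]
      ring
    linarith
  refine eLpNorm_two_le_of_integral_le ?_ hf.integrable_sq ?_
  · refine hconv.mono' ?_ (Eventually.of_forall fun x => ?_)
    · exact ((continuous_smear hΩ hfi hη hη').pow 2).aestronglyMeasurable
    · rw [Real.norm_of_nonneg (sq_nonneg _)]; exact hpt x
  · calc ∫ x, smear Ω f η x ^ 2 ≤ ∫ x, convolution (fun x => F x ^ 2) η
          (ContinuousLinearMap.mul ℝ ℝ) volume x := by
          refine integral_mono_of_nonneg (Eventually.of_forall fun x => sq_nonneg _) hconv
            (Eventually.of_forall hpt)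
      _ = ∫ x, F x ^ 2 := by
          rw [integral_convolution _ hF2 hηi]; simp [h1]
      _ = ∫ x in Ω, f x ^ 2 := by
          rw [← integral_indicator hΩ]
          refine integral_congr_ae (Eventually.of_forall fun y => ?_)
          by_cases hy : y ∈ Ω <;> simp [hF, hy]

end smear

/-! ### Mollifiers -/

/-- A bump function supported in the ball of radius `1 / (n + 1)`. -/
noncomputable def bump (n : ℕ) : ContDiffBump (0 : E3) where
  rIn := 1 / (n + 1 : ℝ) / 2
  rOut := 1 / (n + 1 : ℝ)
  rIn_pos := by positivity
  rIn_lt_rOut := by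
    have : (0 : ℝ) < 1 / (n + 1 : ℝ) := by positivity
    linarith

/-- The standard mollifiers. -/
noncomputable def moll (n : ℕ) : E3 → ℝ := (bump n).normed volume

theorem contDiff_moll (n : ℕ) : ContDiff ℝ ∞ (moll n) := (bump n).contDiff_normed
theorem hasCompactSupport_moll (n : ℕ) : HasCompactSupport (moll n) :=
  (bump n).hasCompactSupport_normed
theorem moll_nonneg (n : ℕ) (x : E3) : 0 ≤ moll n x := (bump n).nonneg_normed x
theorem integral_moll (n : ℕ) : ∫ x, moll n x = 1 := (bump n).integral_normed
theorem support_moll (n : ℕ) :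
    Function.support (moll n) ⊆ Metric.closedBall 0 (1 / (n + 1 : ℝ)) := by
  unfold moll
  rw [(bump n).support_normed_eq]
  exact Metric.ball_subset_closedBall

theorem ae_tendsto_smear_moll {Ω : Set E3} (hΩ : MeasurableSet Ω) {f : E3 → ℝ}
    (hf : IntegrableOn f Ω) :
    ∀ᵐ x ∂(volume.restrict Ω), Tendsto (fun n => smear Ω f (moll n) x) atTop (𝓝 (f x)) := by
  have h0 : Tendsto (fun n => (bump n).rOut) atTop (𝓝 0) :=
    tendsto_one_div_add_atTop_nhds_zero_nat (𝕜 := ℝ)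
  -- Comparable inner and outer radii are what Lebesgue differentiation needs; this is why `bump`
  -- takes `rIn` to be half of `rOut`.
  have h1 : ∀ᶠ n in atTop, (bump n).rOut ≤ 2 * (bump n).rIn :=
    Eventually.of_forall fun n => le_of_eq (by simp only [bump]; ring)
  have h := ContDiffBump.ae_convolution_tendsto_right_of_locallyIntegrable
    (μ := (volume : Measure E3)) h0 h1 (locallyIntegrable_indicator hΩ hf)
  rw [ae_restrict_iff' hΩ]
  filter_upwards [h] with x hx hxΩ
  rw [Set.indicator_of_mem hxΩ] at hx
  refine hx.congr fun n => ?_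
  rw [convolution_eq_swap]
  unfold smear
  rw [← integral_indicator hΩ]
  refine integral_congr_ae (Eventually.of_forall fun y => ?_)
  by_cases hy : y ∈ Ω <;> simp [hy, moll, mul_comm]

theorem abs_smear_moll_le {Ω : Set E3} {f : E3 → ℝ} {B : ℝ} (hB : 0 ≤ B)
    (hf : ∀ᵐ x ∂(volume.restrict Ω), |f x| ≤ B) (n : ℕ) (x : E3) :
    |smear Ω f (moll n) x| ≤ B := by
  have hi : Integrable (fun y => moll n (x - y)) :=
    ((contDiff_moll n).continuous.integrable_of_hasCompactSupport
      (hasCompactSupport_moll n)).comp_sub_left x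
  have h1 : |smear Ω f (moll n) x| ≤ ∫ y in Ω, B * moll n (x - y) := by
    rw [← Real.norm_eq_abs, smear]
    refine norm_integral_le_of_norm_le (hi.const_mul B).integrableOn ?_
    filter_upwards [hf] with y hy
    rw [norm_mul, Real.norm_of_nonneg (moll_nonneg _ _)]
    exact mul_le_mul_of_nonneg_right hy (moll_nonneg _ _)
  refine h1.trans ?_
  calc ∫ y in Ω, B * moll n (x - y) ≤ ∫ y, B * moll n (x - y) :=
        setIntegral_le_integral (hi.const_mul B)
          (Eventually.of_forall fun y => mul_nonneg hB (moll_nonneg _ _))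
    _ = B := by
        rw [integral_const_mul, integral_sub_left_eq_self (moll n) volume x, integral_moll, mul_one]

/-- Bounded convergence in `L²`. -/
theorem tendsto_eLpNorm_two_of_bounded {α : Type*} [MeasurableSpace α] {μ : Measure α}
    [IsFiniteMeasure μ] {F : ℕ → α → ℝ} {f : α → ℝ} {B : ℝ}
    (hF : ∀ n, AEStronglyMeasurable (F n) μ) (hfm : AEStronglyMeasurable f μ)
    (hb : ∀ n, ∀ᵐ x ∂μ, |F n x| ≤ B) (hfb : ∀ᵐ x ∂μ, |f x| ≤ B)
    (h : ∀ᵐ x ∂μ, Tendsto (fun n => F n x) atTop (𝓝 (f x))) :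
    Tendsto (fun n => eLpNorm (fun x => F n x - f x) 2 μ) atTop (𝓝 0) := by
  have key : Tendsto (fun n => ∫⁻ x, ENNReal.ofReal ((F n x - f x) ^ 2) ∂μ) atTop (𝓝 0) := by
    have := tendsto_lintegral_of_dominated_convergence' (μ := μ)
      (F := fun n x => ENNReal.ofReal ((F n x - f x) ^ 2)) (f := fun _ => 0)
      (fun _ => ENNReal.ofReal ((2 * B) ^ 2)) ?_ ?_ ?_ ?_
    · simpa using this
    · exact fun n => ((((hF n).sub hfm).aemeasurable).pow_const 2).ennreal_ofReal
    · intro n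
      filter_upwards [hb n, hfb] with x h1 h2
      refine ENNReal.ofReal_le_ofReal (sq_le_sq' ?_ ?_) <;>
      linarith [abs_le.1 h1, abs_le.1 h2]
    · simpa using ENNReal.mul_ne_top ENNReal.ofReal_ne_top (measure_ne_top μ _)
    · filter_upwards [h] with x hx
      have : Tendsto (fun n => (F n x - f x) ^ 2) atTop (𝓝 ((f x - f x) ^ 2)) :=
        (hx.sub_const _).pow 2
      simpa using ENNReal.tendsto_ofReal this
  simp only [← sq_eLpNorm_two] at key
  have h2 := (ENNReal.continuous_rpow_const (y := (1 / 2 : ℝ))).tendsto 0 |>.comp key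
  have h3 : ∀ z : ℝ≥0∞, (z ^ 2) ^ (1 / 2 : ℝ) = z := by
    intro z
    rw [← ENNReal.rpow_natCast, ← ENNReal.rpow_mul]
    norm_num
  simp only [Function.comp_def, h3] at h2
  simpa using h2

/-- For bounded `f` on a set of finite measure, almost everywhere convergence and dominated
convergence give convergence in `L²` directly. -/
theorem tendsto_smear_moll {Ω : Set E3} (hΩ : MeasurableSet Ω) (hfin : volume Ω ≠ ⊤) {f : E3 → ℝ}
    {B : ℝ} (hB : 0 ≤ B) (hfi : IntegrableOn f Ω)
    (hf : ∀ᵐ x ∂(volume.restrict Ω), |f x| ≤ B) :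
    Tendsto (fun n => eLpNorm (fun x => smear Ω f (moll n) x - f x) 2 (volume.restrict Ω))
      atTop (𝓝 0) := by
  have : IsFiniteMeasure (volume.restrict Ω) := ⟨by simpa using hfin.lt_top⟩
  refine tendsto_eLpNorm_two_of_bounded (B := B) (fun n => ?_) hfi.1
    (fun n => Eventually.of_forall fun x => abs_smear_moll_le hB hf n x) hf
    (ae_tendsto_smear_moll hΩ hfi)
  exact (continuous_smear hΩ hfi (contDiff_moll n)
    (hasCompactSupport_moll n)).aestronglyMeasurable

/-! ### Weak closedness of `W₀^{1,2}` -/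

/-- A decreasing sequence of convex sets containing elements of bounded norm in an inner product
space admits a Cauchy sequence of elements. -/
theorem exists_cauchySeq_of_antitone_convex {H : Type*} [NormedAddCommGroup H]
    [InnerProductSpace ℝ H] {S : ℕ → Set H} (hS : Antitone S) (hconv : ∀ m, Convex ℝ (S m)) {C : ℝ}
    (hC : ∀ m, ∃ z ∈ S m, ‖z‖ ≤ C) : ∃ z : ℕ → H, (∀ m, z m ∈ S m) ∧ CauchySeq z := by
  -- The distances from the origin to the sets increase and are bounded by `C`, so they converge.
  -- Almost minimal elements will form the Cauchy sequence.
  set a : ℕ → ℝ := fun m => sInf ((fun z => ‖z‖) '' S m) with ha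
  have hbdd : ∀ m, BddBelow ((fun z : H => ‖z‖) '' S m) := fun m =>
    ⟨0, by rintro _ ⟨z, -, rfl⟩; exact norm_nonneg z⟩
  have hne : ∀ m, ((fun z : H => ‖z‖) '' S m).Nonempty := fun m => by
    obtain ⟨z, hz, -⟩ := hC m; exact ⟨_, z, hz, rfl⟩
  have ha_le : ∀ m, ∀ z ∈ S m, a m ≤ ‖z‖ := fun m z hz => csInf_le (hbdd m) ⟨z, hz, rfl⟩
  have ha0 : ∀ m, 0 ≤ a m := fun m =>
    le_csInf (hne m) (by rintro _ ⟨z, -, rfl⟩; exact norm_nonneg z)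
  have haC : ∀ m, a m ≤ C := fun m => by
    obtain ⟨z, hz, h⟩ := hC m; exact (ha_le m z hz).trans h
  have hamono : Monotone a := fun m n hmn =>
    csInf_le_csInf (hbdd m) (hne n) (Set.image_mono (hS hmn))
  have hlim : Tendsto a atTop (𝓝 (⨆ m, a m)) :=
    tendsto_atTop_ciSup hamono ⟨C, by rintro _ ⟨m, rfl⟩; exact haC m⟩
  set α := ⨆ m, a m
  have haα : ∀ m, a m ≤ α := fun m => hamono.ge_of_tendsto hlim m
  have hz : ∀ m : ℕ, ∃ z ∈ S m, ‖z‖ < a m + 1 / (m + 1 : ℝ) := fun m => by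
    obtain ⟨_, ⟨z, hz, rfl⟩, h⟩ := exists_lt_of_csInf_lt (hne m)
      (show sInf ((fun z : H => ‖z‖) '' S m) < a m + 1 / (m + 1 : ℝ) from
        lt_add_of_pos_right _ (by positivity))
    exact ⟨z, hz, h⟩
  choose z hzS hzn using hz
  refine ⟨z, hzS, ?_⟩
  -- By the parallelogram law, `‖z m - z l‖²` is `2 ‖z m‖² + 2 ‖z l‖²` minus four times the squared
  -- norm of the midpoint. The midpoint lies in `S N` by convexity, so its norm is at least `a N`.
  set b : ℕ → ℝ := fun N => Real.sqrt (4 * ((α + 1 / (N + 1 : ℝ)) ^ 2 - a N ^ 2)) with hb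
  have hkey : ∀ N m l, N ≤ m → N ≤ l → dist (z m) (z l) ≤ b N := by
    intro N m l hm hl
    have hmem : (1 / 2 : ℝ) • z m + (1 / 2 : ℝ) • z l ∈ S N :=
      hconv N (hS hm (hzS m)) (hS hl (hzS l)) (by norm_num) (by norm_num) (by norm_num)
    have h1 := ha_le N _ hmem
    rw [← smul_add, norm_smul, Real.norm_of_nonneg (by norm_num : (0 : ℝ) ≤ 1 / 2)] at h1
    have hpar := parallelogram_law_with_norm ℝ (z m) (z l)
    have hbd : ∀ i, N ≤ i → ‖z i‖ ≤ α + 1 / (N + 1 : ℝ) := fun i hi => by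
      have e1 : 1 / (i + 1 : ℝ) ≤ 1 / (N + 1 : ℝ) := by gcongr
      linarith [hzn i, haα i]
    have h2 := hbd m hm
    have h3 := hbd l hl
    rw [dist_eq_norm]
    refine Real.le_sqrt_of_sq_le ?_
    nlinarith [norm_nonneg (z m), norm_nonneg (z l), ha0 N, norm_nonneg (z m + z l)]
  refine cauchySeq_of_le_tendsto_0 b (fun m l N hm hl => hkey N m l hm hl) ?_
  have h1 : Tendsto (fun N : ℕ => 4 * ((α + 1 / (N + 1 : ℝ)) ^ 2 - a N ^ 2)) atTop
      (𝓝 (4 * ((α + 0) ^ 2 - α ^ 2))) :=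
    (((tendsto_one_div_add_atTop_nhds_zero_nat.const_add α).pow 2).sub (hlim.pow 2)).const_mul 4
  have h2 := (Real.continuous_sqrt.tendsto _).comp h1
  simpa [hb, Function.comp_def] using h2

theorem tendsto_integral_mul_of_tendsto {α : Type*} [MeasurableSpace α] {μ : Measure α}
    {f : ℕ → α → ℝ} {f₀ g : α → ℝ} (hf : ∀ n, MemLp (f n) 2 μ) (hf₀ : MemLp f₀ 2 μ)
    (hg : MemLp g 2 μ) (h : Tendsto (fun n => eLpNorm (fun x => f n x - f₀ x) 2 μ) atTop (𝓝 0)) :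
    Tendsto (fun n => ∫ x, f n x * g x ∂μ) atTop (𝓝 (∫ x, f₀ x * g x ∂μ)) := by
  have h1 : ∀ n, ENNReal.ofReal |(∫ x, f n x * g x ∂μ) - ∫ x, f₀ x * g x ∂μ| ≤
      eLpNorm (fun x => f n x - f₀ x) 2 μ * eLpNorm g 2 μ := fun n => by
    have e : (∫ x, f n x * g x ∂μ) - ∫ x, f₀ x * g x ∂μ = ∫ x, (f n x - f₀ x) * g x ∂μ := by
      have i1 : Integrable (fun x => f n x * g x) μ := (hf n).integrable_mul hg
      have i2 : Integrable (fun x => f₀ x * g x) μ := hf₀.integrable_mul hg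
      rw [← integral_sub i1 i2]
      simp only [sub_mul]
    rw [e]
    exact abs_integral_mul_le ((hf n).sub hf₀) hg
  have h2 : Tendsto (fun n => eLpNorm (fun x => f n x - f₀ x) 2 μ * eLpNorm g 2 μ) atTop (𝓝 0) := by
    simpa using ENNReal.Tendsto.mul_const h (Or.inr hg.2.ne)
  have h3 := tendsto_of_tendsto_of_tendsto_of_le_of_le tendsto_const_nhds h2
    (fun n => bot_le) h1
  have h4 := (ENNReal.tendsto_toReal ENNReal.zero_ne_top).comp h3
  simp only [Function.comp_def, ENNReal.toReal_ofReal (abs_nonneg _), ENNReal.toReal_zero] at h4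
  rw [tendsto_iff_norm_sub_tendsto_zero]
  exact h4

theorem eLpNorm_fun_sub_comm {α : Type*} [MeasurableSpace α] (f g : α → ℝ) (p : ℝ≥0∞)
    (μ : Measure α) : eLpNorm (fun x => f x - g x) p μ = eLpNorm (fun x => g x - f x) p μ :=
  eLpNorm_sub_comm f g p μ

/-- An `L²` limit of test functions whose gradients stay bounded in `L²` vanishes on the
boundary. -/
theorem memW12Zero_of_bounded {Ω : Set E3} (hΩ : IsOpen Ω) {v : E3 → ℝ}
    (hv : MemLp v 2 (volume.restrict Ω)) {A : ℝ≥0∞} (hA : A ≠ ⊤) {C : ℝ≥0∞} (hC : C ≠ ⊤)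
    (h : ∀ ε : ℝ, 0 < ε → ε ≤ 1 → ∃ φ, IsTestFunction Ω φ ∧
      eLpNorm (fun x => v x - φ x) 2 (volume.restrict Ω) ≤ A * ENNReal.ofReal ε ∧
      ∀ k, eLpNorm (pd k φ) 2 (volume.restrict Ω) ≤ C) : MemW12Zero Ω v := by
  set μ := volume.restrict Ω
  let H := PiLp 2 (fun _ : Fin 3 => Lp ℝ 2 μ)
  -- The gradients of test functions that are close to `v` in `L²`. These sets are convex and meet a
  -- fixed ball, so near-minimal elements converge strongly. This plays the role of weak compactness
  -- followed by Mazur's lemma.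
  let S : ℕ → Set H := fun m => {z | ∃ φ, IsTestFunction Ω φ ∧
    eLpNorm (fun x => v x - φ x) 2 μ ≤ A * ENNReal.ofReal (1 / (m + 1 : ℝ)) ∧
    ∀ k, (z k : E3 → ℝ) =ᵐ[μ] pd k φ}
  have hSanti : Antitone S := by
    rintro m n hmn z ⟨φ, h1, h2, h3⟩
    refine ⟨φ, h1, h2.trans ?_, h3⟩
    gcongr
  have hSconv : ∀ m, Convex ℝ (S m) := by
    rintro m z ⟨φ, h1, h2, h3⟩ z' ⟨φ', h1', h2', h3'⟩ a b ha hb hab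
    refine ⟨_, (h1.const_mul a).add (h1'.const_mul b), ?_, fun k => ?_⟩
    · have e : (fun x => v x - (a * φ x + b * φ' x)) =
          a • (fun x => v x - φ x) + b • (fun x => v x - φ' x) := by
        ext x; simp only [Pi.add_apply, Pi.smul_apply, smul_eq_mul]
        linear_combination (-v x) * hab
      rw [e]
      refine (eLpNorm_add_le ((hv.sub (h1.memLp 2 _)).const_smul a).1
        ((hv.sub (h1'.memLp 2 _)).const_smul b).1 (by norm_num)).trans ?_
      rw [eLpNorm_const_smul, eLpNorm_const_smul]
      calc _ ≤ ‖a‖ₑ * (A * ENNReal.ofReal (1 / (m + 1 : ℝ)))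
            + ‖b‖ₑ * (A * ENNReal.ofReal (1 / (m + 1 : ℝ))) :=
          add_le_add (mul_le_mul_right h2 _) (mul_le_mul_right h2' _)
        _ = A * ENNReal.ofReal (1 / (m + 1 : ℝ)) := by
          rw [← add_mul, Real.enorm_eq_ofReal ha, Real.enorm_eq_ofReal hb,
            ← ENNReal.ofReal_add ha hb, hab, ENNReal.ofReal_one, one_mul]
    · have e : ((a • z + b • z') k : Lp ℝ 2 μ) = a • z k + b • z' k := rfl
      rw [e]
      filter_upwards [Lp.coeFn_add (a • z k) (b • z' k), Lp.coeFn_smul a (z k),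
        Lp.coeFn_smul b (z' k), h3 k, h3' k] with x e1 e2 e3 e4 e5
      rw [e1, Pi.add_apply, e2, e3, Pi.smul_apply, Pi.smul_apply, e4, e5,
        pd_add ((h1.const_mul a).differentiableAt x) ((h1'.const_mul b).differentiableAt x),
        pd_const_mul _ (h1.differentiableAt x), pd_const_mul _ (h1'.differentiableAt x)]
      rfl
  have hSne : ∀ m, ∃ z ∈ S m, ‖z‖ ≤ ∑ _k : Fin 3, C.toReal := by
    intro m
    obtain ⟨φ, h1, h2, h3⟩ := h (1 / (m + 1 : ℝ)) (by positivity)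
      (by rw [div_le_one (by positivity)]; linarith [(Nat.cast_nonneg m : (0 : ℝ) ≤ m)])
    let z : H := WithLp.toLp 2 fun k => ((h1.pd k).memLp 2 μ).toLp (pd k φ)
    refine ⟨z, ⟨φ, h1, h2, fun k => ((h1.pd k).memLp 2 μ).coeFn_toLp⟩, ?_⟩
    have hzk : ∀ k, ‖z k‖ ≤ C.toReal := fun k => by
      show ‖((h1.pd k).memLp 2 μ).toLp (pd k φ)‖ ≤ _
      rw [Lp.norm_toLp]
      exact ENNReal.toReal_mono hC (h3 k)
    rw [PiLp.norm_eq_of_L2]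
    refine (Real.sqrt_le_sqrt (Finset.sum_le_sum fun k _ =>
      pow_le_pow_left₀ (norm_nonneg _) (hzk k) 2)).trans ?_
    refine Real.sqrt_le_iff.2 ⟨Finset.sum_nonneg fun _ _ => ENNReal.toReal_nonneg, ?_⟩
    simp only [Finset.sum_const, Finset.card_univ, Fintype.card_fin, nsmul_eq_mul]
    norm_num
    nlinarith [sq_nonneg C.toReal]
  obtain ⟨z, hzS, hzc⟩ := exists_cauchySeq_of_antitone_convex hSanti hSconv hSne
  obtain ⟨w, hw⟩ := cauchySeq_tendsto_of_complete hzc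
  choose φ hφ hφv hφz using hzS
  have hconvv : Tendsto (fun n => eLpNorm (fun x => φ n x - v x) 2 μ) atTop (𝓝 0) := by
    have h0 : Tendsto (fun m : ℕ => A * ENNReal.ofReal (1 / (m + 1 : ℝ))) atTop (𝓝 0) := by
      have := ENNReal.Tendsto.const_mul (a := A)
        (ENNReal.tendsto_ofReal (tendsto_one_div_add_atTop_nhds_zero_nat (𝕜 := ℝ))) (Or.inr hA)
      simpa using this
    refine tendsto_of_tendsto_of_tendsto_of_le_of_le tendsto_const_nhds h0 (fun n => bot_le)
      fun n => ?_
    have := hφv n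
    rwa [eLpNorm_fun_sub_comm] at this
  have hconvw : ∀ k, Tendsto (fun n => eLpNorm (fun x => pd k (φ n) x - w k x) 2 μ)
      atTop (𝓝 0) := by
    intro k
    have h1 : Tendsto (fun n => z n k) atTop (𝓝 (w k)) :=
      ((PiLp.continuous_apply 2 _ k).tendsto w).comp hw
    rw [Lp.tendsto_Lp_iff_tendsto_eLpNorm'] at h1
    refine h1.congr fun n => eLpNorm_congr_ae ?_
    filter_upwards [hφz n k] with x hx
    rw [Pi.sub_apply, hx]
  -- The limit of the gradients is the weak gradient of `v`: both sides of the integration by parts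
  -- identity pass to the `L²` limit.
  have hwp : ∀ k, IsWeakPartial Ω k v (w k) := fun k => by
    refine ⟨Lp.memLp _, fun ψ hψ => ?_⟩
    have l1 := tendsto_integral_mul_of_tendsto (fun n => (hφ n).memLp 2 μ) hv
      ((hψ.pd k).memLp 2 μ) hconvv
    have l2 := tendsto_integral_mul_of_tendsto (fun n => ((hφ n).pd k).memLp 2 μ) (Lp.memLp (w k))
      (hψ.memLp 2 μ) (hconvw k)
    refine tendsto_nhds_unique l1 (l2.neg.congr fun n => ?_)
    rw [((hφ n).isWeakPartial hΩ k).2 ψ hψ]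
  refine ⟨⟨hv, fun k => ⟨_, hwp k⟩⟩, fun ε hε => ?_⟩
  have hε' : 0 < ENNReal.ofReal ε := ENNReal.ofReal_pos.2 hε
  have ev : ∀ᶠ n in atTop, eLpNorm (fun x => φ n x - v x) 2 μ < ENNReal.ofReal ε ∧
      ∀ k, eLpNorm (fun x => pd k (φ n) x - w k x) 2 μ < ENNReal.ofReal ε :=
    (hconvv.eventually_lt_const hε').and
      (eventually_all.2 fun k => (hconvw k).eventually_lt_const hε')
  obtain ⟨n, hn1, hn2⟩ := ev.exists
  refine ⟨φ n, hφ n, ?_, fun k => ?_⟩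
  · have := hn1.le
    rwa [eLpNorm_fun_sub_comm] at this
  · have := (hn2 k).le
    rw [eLpNorm_fun_sub_comm] at this
    refine le_trans (le_of_eq (eLpNorm_congr_ae ?_)) this
    filter_upwards [(hwp k).weakPartial_ae_eq hΩ] with x hx
    rw [hx]

/-! ### Lipschitz functions of Sobolev functions -/

/-- Lipschitz functions are uniform limits of smooth functions with the same Lipschitz constant. -/
theorem exists_contDiff_lipschitz_approx {E : Type*} [NormedAddCommGroup E] [NormedSpace ℝ E]
    [FiniteDimensional ℝ E] {F : E → ℝ} {K : NNReal} (hF : LipschitzWith K F) {δ : ℝ}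
    (hδ : 0 < δ) : ∃ g : E → ℝ, ContDiff ℝ ∞ g ∧ LipschitzWith K g ∧ ∀ x, |g x - F x| ≤ δ := by
  borelize E
  let μ : Measure E := Measure.addHaar
  -- Within the mollification radius `F` varies by at most `K r ≤ δ`; the summand `1` covers `K =
  -- 0`.
  set r := δ / (K + 1) with hr
  have hr0 : 0 < r := by positivity
  set φ : ContDiffBump (0 : E) := ⟨r / 2, r, half_pos hr0, half_lt_self hr0⟩
  set g := convolution (φ.normed μ) F (ContinuousLinearMap.lsmul ℝ ℝ) μ with hg
  have hloc : LocallyIntegrable F μ := hF.continuous.locallyIntegrable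
  refine ⟨g, φ.hasCompactSupport_normed.contDiff_convolution_left _ φ.contDiff_normed hloc, ?_, ?_⟩
  · have hi : ∀ x, Integrable (fun t => φ.normed μ t * F (x - t)) μ := fun x => by
      refine Continuous.integrable_of_hasCompactSupport ?_ ?_
      · exact φ.continuous_normed.mul (hF.continuous.comp (continuous_const.sub continuous_id))
      · exact φ.hasCompactSupport_normed.mul_right
    refine LipschitzWith.of_dist_le_mul fun x y => ?_
    rw [Real.dist_eq, hg]
    unfold convolution
    simp only [ContinuousLinearMap.lsmul_apply, smul_eq_mul]
    rw [← integral_sub (hi x) (hi y), ← Real.norm_eq_abs]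
    refine (norm_integral_le_of_norm_le (g := fun t => φ.normed μ t * (K * dist x y)) ?_ ?_).trans ?_
    · exact (φ.integrable_normed).mul_const _
    · refine Eventually.of_forall fun t => ?_
      rw [← mul_sub, norm_mul, Real.norm_of_nonneg (φ.nonneg_normed t)]
      refine mul_le_mul_of_nonneg_left ?_ (φ.nonneg_normed t)
      have := hF.dist_le_mul (x - t) (y - t)
      rwa [dist_sub_right, Real.dist_eq] at this
    · rw [integral_mul_const, φ.integral_normed, one_mul]
  · intro x
    have := φ.dist_normed_convolution_le (μ := μ) (g := F) (x₀ := x) (ε := δ)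
      hF.continuous.aestronglyMeasurable fun y hy => by
        refine (hF.dist_le_mul y x).trans ?_
        have h1 : dist y x ≤ r := le_of_lt hy
        calc (K : ℝ) * dist y x ≤ (K + 1) * r := by gcongr; linarith
          _ = δ := by rw [hr]; field_simp
    rwa [Real.dist_eq] at this

theorem euclidean_norm_le_sum {ι : Type*} [Fintype ι] (v : EuclideanSpace ℝ ι) :
    ‖v‖ ≤ ∑ i, |v i| := by
  rw [EuclideanSpace.norm_eq]
  refine Real.sqrt_le_iff.2 ⟨Finset.sum_nonneg fun _ _ => abs_nonneg _, ?_⟩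
  simp only [Real.norm_eq_abs]
  exact Finset.sum_sq_le_sq_sum_of_nonneg fun _ _ => abs_nonneg _

/-- Chain rule together with `‖Dg‖ ≤ K`. The bound involves only the Lipschitz constant, so it is
uniform over the smooth approximations of a Lipschitz function. -/
theorem abs_pd_comp_le {ι : Type*} [Fintype ι] {g : EuclideanSpace ℝ ι → ℝ} {K : NNReal}
    (hg : ContDiff ℝ ∞ g) (hK : LipschitzWith K g) {W : ι → E3 → ℝ} {x : E3}
    (hW : ∀ p, DifferentiableAt ℝ (W p) x) (k : Fin 3) :
    |pd k (fun y => g (WithLp.toLp 2 fun p => W p y)) x| ≤ K * ∑ p, |pd k (W p) x| := by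
  have hWd : HasFDerivAt (fun y => (WithLp.toLp 2 fun p => W p y : EuclideanSpace ℝ ι))
      (fderiv ℝ (fun y => (WithLp.toLp 2 fun p => W p y : EuclideanSpace ℝ ι)) x) x := by
    refine DifferentiableAt.hasFDerivAt ?_
    rw [differentiableAt_euclidean]
    exact hW
  have hc : HasFDerivAt (fun y => g (WithLp.toLp 2 fun p => W p y)) _ x :=
    (hg.differentiable (by simp) _).hasFDerivAt.comp x hWd
  unfold pd
  rw [hc.fderiv]
  have h1 := (fderiv ℝ g (WithLp.toLp 2 fun p => W p x)).le_opNorm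
    (fderiv ℝ (fun y => (WithLp.toLp 2 fun p => W p y : EuclideanSpace ℝ ι)) x (ek k))
  rw [Real.norm_eq_abs] at h1
  refine h1.trans ?_
  refine mul_le_mul (norm_fderiv_le_of_lipschitz ℝ hK) ?_ (norm_nonneg _) K.2
  refine (euclidean_norm_le_sum _).trans (le_of_eq (Finset.sum_congr rfl fun p _ => ?_))
  have h2 : HasFDerivAt (W p) _ x :=
    (EuclideanSpace.proj p : EuclideanSpace ℝ ι →L[ℝ] ℝ).hasFDerivAt.comp x hWd
  rw [h2.fderiv]
  rfl

/-- If `U` and the bounded map `V` have the same boundary values, so do their images under a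
Lipschitz function. -/
theorem memW12Zero_lipschitz_comp {Ω : Set E3} (hΩ : IsOpen Ω) (hfin : volume Ω ≠ ⊤) {ι : Type*}
    [Fintype ι] {U V : ι → E3 → ℝ} {B : ℝ} (hB : 0 ≤ B) (hU : ∀ p, MemW12 Ω (U p))
    (hV : ∀ p, MemW12 Ω (V p)) (hVb : ∀ p, ∀ᵐ x ∂(volume.restrict Ω), |V p x| ≤ B)
    (hUV : ∀ p, MemW12Zero Ω (fun x => U p x - V p x)) {F : EuclideanSpace ℝ ι → ℝ} {K : NNReal}
    (hF : LipschitzWith K F) :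
    MemW12Zero Ω (fun x => F (WithLp.toLp 2 fun p => U p x) - F (WithLp.toLp 2 fun p => V p x)) := by
  set μ := volume.restrict Ω with hμ
  have : IsFiniteMeasure μ := ⟨by simpa [hμ] using hfin.lt_top⟩
  have hm : ∀ {W : ι → E3 → ℝ}, (∀ p, MemLp (W p) 2 μ) →
      AEStronglyMeasurable (fun x => (WithLp.toLp 2 fun p => W p x : EuclideanSpace ℝ ι)) μ := by
    intro W hW
    refine (PiLp.continuous_toLp 2 _).comp_aestronglyMeasurable ?_
    exact (aemeasurable_pi_lambda _ fun p => (hW p).1.aemeasurable).aestronglyMeasurable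
  have hVi : ∀ p, IntegrableOn (V p) Ω := fun p => (hV p).1.integrable (by norm_num)
  set Z : E3 → ℝ := fun x => F (WithLp.toLp 2 fun p => U p x) - F (WithLp.toLp 2 fun p => V p x)
    with hZ
  have hZm : AEStronglyMeasurable Z μ :=
    (hF.continuous.comp_aestronglyMeasurable (hm fun p => (hU p).1)).sub
      (hF.continuous.comp_aestronglyMeasurable (hm fun p => (hV p).1))
  have hlip : ∀ {g : EuclideanSpace ℝ ι → ℝ} {a b : ι → ℝ}, LipschitzWith K g →
      |g (WithLp.toLp 2 a) - g (WithLp.toLp 2 b)| ≤ K * ∑ p, |a p - b p| := by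
    intro g a b hg
    have h1 := hg.dist_le_mul (WithLp.toLp 2 a) (WithLp.toLp 2 b)
    rw [Real.dist_eq, dist_eq_norm] at h1
    refine h1.trans (mul_le_mul_of_nonneg_left ?_ K.2)
    exact (euclidean_norm_le_sum _).trans (le_of_eq rfl)
  have hZ2 : MemLp Z 2 μ := by
    have h1 : MemLp (fun x => K * ∑ p, |U p x - V p x|) 2 μ :=
      (memLp_finsetSum _ fun p _ => ((hU p).1.sub (hV p).1).abs).const_mul _
    refine h1.mono hZm (Eventually.of_forall fun x => ?_)
    rw [Real.norm_eq_abs]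
    exact (hlip hF).trans (le_abs_self _)
  let wV : ι → Fin 3 → E3 → ℝ := fun p k => weakPartial Ω k (V p)
  let wD : ι → Fin 3 → E3 → ℝ := fun p k => weakPartial Ω k fun x => U p x - V p x
  -- Error budget for the approximation `ψ` below: per component, `2 K` for replacing `V` by its
  -- mollification in both terms and `K` for replacing `U - V` by a test function. The last summand
  -- pays for replacing `F` by a smooth `g` twice.
  let A : ℝ≥0∞ := (∑ _p : ι, (2 * (K : ℝ≥0∞) + K)) + 2 * μ Set.univ ^ (1 / 2 : ℝ)
  have hA : A ≠ ⊤ := by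
    refine ENNReal.add_ne_top.2 ⟨?_, ?_⟩
    · refine (ENNReal.sum_lt_top.2 fun p _ => ?_).ne
      exact ENNReal.add_lt_top.2 ⟨ENNReal.mul_lt_top (by simp) (by simp), by simp⟩
    · exact ENNReal.mul_ne_top (by simp)
        (ENNReal.rpow_ne_top_of_nonneg (by norm_num) (measure_ne_top μ _))
  let C : ℝ≥0∞ := ∑ k, ∑ p, (2 * K * eLpNorm (wV p k) 2 μ + K * (eLpNorm (wD p k) 2 μ + 1))
  have hC : C ≠ ⊤ := by
    refine (ENNReal.sum_lt_top.2 fun k _ => ENNReal.sum_lt_top.2 fun p _ => ?_).ne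
    refine ENNReal.add_lt_top.2 ⟨?_, ?_⟩
    · exact ENNReal.mul_lt_top (ENNReal.mul_lt_top (by simp) (by simp))
        ((hV p).isWeakPartial k).1.2
    · exact ENNReal.mul_lt_top (by simp)
        (ENNReal.add_lt_top.2 ⟨((hUV p).1.isWeakPartial k).1.2, by simp⟩)
  refine memW12Zero_of_bounded hΩ hZ2 hA hC fun ε hε hε1 => ?_
  obtain ⟨g, hgs, hgK, hgF⟩ := exists_contDiff_lipschitz_approx hF hε
  choose φ hφ hφ0 hφ1 using fun p => (hUV p).2 ε hε
  set K0 : Set E3 := ⋃ p, tsupport (φ p) with hK0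
  have hK0c : IsCompact K0 := isCompact_iUnion fun p => (hφ p).2.1
  have hK0Ω : K0 ⊆ Ω := Set.iUnion_subset fun p => (hφ p).2.2
  -- Weak derivatives commute with mollification only where the mollifying ball stays in `Ω`. A
  -- margin around the supports of the `φ p` suffices.
  obtain ⟨d, hd, hdΩ⟩ := hK0c.exists_cthickening_subset_open hΩ hK0Ω
  have ev : ∀ᶠ n : ℕ in atTop, 1 / (n + 1 : ℝ) ≤ d ∧
      ∀ p, eLpNorm (fun x => smear Ω (V p) (moll n) x - V p x) 2 μ ≤ ENNReal.ofReal ε := by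
    refine ((tendsto_one_div_add_atTop_nhds_zero_nat (𝕜 := ℝ)).eventually_le_const hd).and
      (eventually_all.2 fun p => ?_)
    exact (tendsto_smear_moll hΩ.measurableSet hfin hB (hVi p) (hVb p)).eventually_le_const
      (ENNReal.ofReal_pos.2 hε)
  obtain ⟨n, hnd, hnV⟩ := ev.exists
  set Ve : ι → E3 → ℝ := fun p => smear Ω (V p) (moll n) with hVe
  have hVes : ∀ p, ContDiff ℝ ∞ (Ve p) := fun p =>
    contDiff_smear hΩ.measurableSet (hVi p) (contDiff_moll n) (hasCompactSupport_moll n)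
  have hVepd : ∀ p k, ∀ x ∈ K0, pd k (Ve p) x = smear Ω (wV p k) (moll n) x := fun p k x hx =>
    pd_smear_weak hΩ (hVi p) ((hV p).isWeakPartial k) (contDiff_moll n) (hasCompactSupport_moll n)
      (support_moll n) ((Metric.closedBall_subset_closedBall hnd).trans
        ((Metric.closedBall_subset_cthickening hx d).trans hdΩ))
  -- Smooth, and supported where some `φ p` is, because the two terms cancel elsewhere. Its gradient
  -- need only stay bounded in `L²`, not converge, thanks to `memW12Zero_of_bounded`.
  set ψ : E3 → ℝ := fun x => g (WithLp.toLp 2 fun p => Ve p x + φ p x)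
    - g (WithLp.toLp 2 fun p => Ve p x) with hψ
  have hs1 : ContDiff ℝ ∞ fun x => g (WithLp.toLp 2 fun p => Ve p x + φ p x) := by
    refine hgs.comp ?_
    rw [contDiff_euclidean]
    exact fun p => (hVes p).add (hφ p).1
  have hs2 : ContDiff ℝ ∞ fun x => g (WithLp.toLp 2 fun p => Ve p x) := by
    refine hgs.comp ?_
    rw [contDiff_euclidean]
    exact fun p => hVes p
  have hsupp : tsupport ψ ⊆ K0 := by
    refine closure_minimal (fun x hx => ?_) hK0c.isClosed
    by_contra hx0
    refine hx ?_
    have : ∀ p, φ p x = 0 := fun p => image_eq_zero_of_notMem_tsupport fun h =>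
      hx0 (Set.mem_iUnion.2 ⟨p, h⟩)
    simp [hψ, this]
  have hψt : IsTestFunction Ω ψ :=
    ⟨hs1.sub hs2, hK0c.of_isClosed_subset (isClosed_tsupport _) hsupp, hsupp.trans hK0Ω⟩
  have hVem : ∀ p, MemLp (fun x => Ve p x - V p x) 2 μ := fun p =>
    ⟨(hVes p).continuous.aestronglyMeasurable.sub (hV p).1.1,
      (hnV p).trans_lt ENNReal.ofReal_lt_top⟩
  have hDm : ∀ p, MemLp (fun x => U p x - V p x - φ p x) 2 μ := fun p =>
    ((hU p).1.sub (hV p).1).sub ((hφ p).memLp 2 μ)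
  have hnn : ∀ a : NNReal, ‖(a : ℝ)‖ₑ = a := fun a => by
    rw [Real.enorm_of_nonneg a.coe_nonneg]; exact ENNReal.ofReal_coe_nnreal
  refine ⟨ψ, hψt, ?_, fun k => ?_⟩
  · have hpt : ∀ x, |Z x - ψ x| ≤ (∑ p, ((2 * (K : ℝ)) * |Ve p x - V p x|
        + (K : ℝ) * |U p x - V p x - φ p x|)) + 2 * ε := by
      intro x
      have e1 : |g (WithLp.toLp 2 fun p => U p x) - g (WithLp.toLp 2 fun p => Ve p x + φ p x)|
          ≤ K * ∑ p, |U p x - (Ve p x + φ p x)| := hlip hgK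
      have e2 : |g (WithLp.toLp 2 fun p => Ve p x) - g (WithLp.toLp 2 fun p => V p x)|
          ≤ K * ∑ p, |Ve p x - V p x| := hlip hgK
      have e3 : ∑ p, |U p x - (Ve p x + φ p x)| ≤
          ∑ p, (|Ve p x - V p x| + |U p x - V p x - φ p x|) :=
        Finset.sum_le_sum fun p _ => by
          have : U p x - (Ve p x + φ p x) = -(Ve p x - V p x) + (U p x - V p x - φ p x) := by ring
          rw [this]
          exact (abs_add_le _ _).trans (by rw [abs_neg])
      have e4 := hgF (WithLp.toLp 2 fun p => U p x)
      have e5 := hgF (WithLp.toLp 2 fun p => V p x)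
      have e6 : (K : ℝ) * ∑ p, |U p x - (Ve p x + φ p x)| ≤
          K * ∑ p, (|Ve p x - V p x| + |U p x - V p x - φ p x|) :=
        mul_le_mul_of_nonneg_left e3 K.2
      have e7 : (∑ p, ((2 * (K : ℝ)) * |Ve p x - V p x| + (K : ℝ) * |U p x - V p x - φ p x|))
          = K * ∑ p, |Ve p x - V p x| + K * ∑ p, (|Ve p x - V p x| + |U p x - V p x - φ p x|) := by
        rw [← mul_add, ← Finset.sum_add_distrib, Finset.mul_sum]
        exact Finset.sum_congr rfl fun p _ => by ring
      rw [e7]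
      simp only [hZ, hψ]
      rw [abs_le] at *
      constructor <;> linarith [e1.1, e1.2, e2.1, e2.2, e4.1, e4.2, e5.1, e5.2]
    have m1 : ∀ p, MemLp (fun x => (2 * (K : ℝ)) * |Ve p x - V p x|) 2 μ := fun p =>
      (hVem p).abs.const_mul _
    have m2 : ∀ p, MemLp (fun x => (K : ℝ) * |U p x - V p x - φ p x|) 2 μ := fun p =>
      (hDm p).abs.const_mul _
    refine (eLpNorm_mono_real (g := fun x => (∑ p, ((2 * (K : ℝ)) * |Ve p x - V p x|
        + (K : ℝ) * |U p x - V p x - φ p x|)) + 2 * ε) hpt).trans ?_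
    have s1 := eLpNorm_add_le (μ := μ) (p := 2) (f := fun x => ∑ p, ((2 * (K : ℝ)) *
      |Ve p x - V p x| + (K : ℝ) * |U p x - V p x - φ p x|)) (g := fun _ => 2 * ε)
      (memLp_finsetSum _ fun p _ => (m1 p).add (m2 p)).1 aestronglyMeasurable_const (by norm_num)
    refine s1.trans ?_
    have s2 : eLpNorm (fun x => ∑ p, ((2 * (K : ℝ)) * |Ve p x - V p x|
        + (K : ℝ) * |U p x - V p x - φ p x|)) 2 μ
        ≤ ∑ _p : ι, (2 * (K : ℝ≥0∞) + K) * ENNReal.ofReal ε := by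
      have := eLpNorm_sum_le (μ := μ) (p := 2) (s := Finset.univ) (f := fun p x => (2 * (K : ℝ)) *
        |Ve p x - V p x| + (K : ℝ) * |U p x - V p x - φ p x|)
        (fun p _ => ((m1 p).add (m2 p)).1) (by norm_num)
      rw [show (∑ p, fun x => (2 * (K : ℝ)) * |Ve p x - V p x| + (K : ℝ) * |U p x - V p x - φ p x|)
        = fun x => ∑ p, ((2 * (K : ℝ)) * |Ve p x - V p x| + (K : ℝ) * |U p x - V p x - φ p x|) by
          ext x; simp] at this
      refine this.trans (Finset.sum_le_sum fun p _ => ?_)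
      refine (eLpNorm_add_le (m1 p).1 (m2 p).1 (by norm_num)).trans ?_
      have t1 : eLpNorm (fun x => (2 * (K : ℝ)) * |Ve p x - V p x|) 2 μ
          = 2 * K * eLpNorm (fun x => Ve p x - V p x) 2 μ := by
        have := eLpNorm_const_smul (2 * (K : ℝ)) (fun x => |Ve p x - V p x|) 2 μ
        have h2 := eLpNorm_norm (p := 2) (μ := μ) fun x => Ve p x - V p x
        simp only [Real.norm_eq_abs] at h2
        rw [h2, show ‖2 * (K : ℝ)‖ₑ = 2 * K by
          rw [show 2 * (K : ℝ) = ((2 * K : NNReal) : ℝ) by push_cast; ring, hnn]; push_cast; ring]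
          at this
        exact this
      have t2 : eLpNorm (fun x => (K : ℝ) * |U p x - V p x - φ p x|) 2 μ
          = K * eLpNorm (fun x => U p x - V p x - φ p x) 2 μ := by
        have := eLpNorm_const_smul (K : ℝ) (fun x => |U p x - V p x - φ p x|) 2 μ
        have h2 := eLpNorm_norm (p := 2) (μ := μ) fun x => U p x - V p x - φ p x
        simp only [Real.norm_eq_abs] at h2
        rw [h2, hnn] at this
        exact this
      rw [t1, t2, add_mul]
      exact add_le_add (mul_le_mul_right (hnV p) _) (mul_le_mul_right (hφ0 p) _)
    have s3 : eLpNorm (fun _ : E3 => 2 * ε) 2 μ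
        ≤ 2 * μ Set.univ ^ (1 / 2 : ℝ) * ENNReal.ofReal ε := by
      rw [eLpNorm_const' _ (by norm_num) (by norm_num), Real.enorm_of_nonneg (by positivity),
        ENNReal.ofReal_mul (by norm_num)]
      simp only [ENNReal.ofReal_ofNat, ENNReal.toReal_ofNat]
      rw [mul_right_comm]
    refine (add_le_add s2 s3).trans (le_of_eq ?_)
    rw [← Finset.sum_mul, ← add_mul]
  · have hpt : ∀ x, |pd k ψ x| ≤ ∑ p, ((2 * (K : ℝ)) * |smear Ω (wV p k) (moll n) x|
        + (K : ℝ) * |pd k (φ p) x|) := by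
      intro x
      by_cases hx : x ∈ K0
      · have d1 : DifferentiableAt ℝ (fun x => g (WithLp.toLp 2 fun p => Ve p x + φ p x)) x :=
          hs1.differentiable (by simp) x
        have d2 : DifferentiableAt ℝ (fun x => g (WithLp.toLp 2 fun p => Ve p x)) x :=
          hs2.differentiable (by simp) x
        have d3 : ∀ p, DifferentiableAt ℝ (Ve p) x := fun p => (hVes p).differentiable (by simp) x
        have e1 := abs_pd_comp_le hgs hgK (W := fun p x => Ve p x + φ p x) (x := x)
          (fun p => (d3 p).add ((hφ p).differentiableAt x)) k
        have e2 := abs_pd_comp_le hgs hgK (W := Ve) (x := x) d3 k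
        rw [hψ, pd_sub d1 d2]
        refine (abs_sub _ _).trans ((add_le_add e1 e2).trans ?_)
        rw [← mul_add, ← Finset.sum_add_distrib, Finset.mul_sum]
        refine Finset.sum_le_sum fun p _ => ?_
        rw [pd_add (d3 p) ((hφ p).differentiableAt x), hVepd p k x hx]
        have := abs_add_le (smear Ω (wV p k) (moll n) x) (pd k (φ p) x)
        have h3 := mul_le_mul_of_nonneg_left this K.2
        simp only [NNReal.val_eq_coe] at h3
        linarith
      · have : pd k ψ x = 0 := image_eq_zero_of_notMem_tsupport fun h =>
          hx (hsupp (tsupport_pd_subset k ψ h))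
        rw [this, abs_zero]
        exact Finset.sum_nonneg fun p _ => by positivity
    have wi : ∀ p, IntegrableOn (wV p k) Ω := fun p =>
      ((hV p).isWeakPartial k).1.integrable (by norm_num)
    have m1 : ∀ p, AEStronglyMeasurable (fun x => (2 * (K : ℝ)) *
        |smear Ω (wV p k) (moll n) x|) μ := fun p =>
      (continuous_const.mul (continuous_smear hΩ.measurableSet (wi p) (contDiff_moll n)
        (hasCompactSupport_moll n)).abs).aestronglyMeasurable
    have m2 : ∀ p, AEStronglyMeasurable (fun x => (K : ℝ) * |pd k (φ p) x|) μ := fun p =>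
      (continuous_const.mul ((hφ p).pd k).continuous.abs).aestronglyMeasurable
    refine (eLpNorm_mono_real hpt).trans ?_
    have := eLpNorm_sum_le (μ := μ) (p := 2) (s := Finset.univ) (f := fun p x => (2 * (K : ℝ)) *
      |smear Ω (wV p k) (moll n) x| + (K : ℝ) * |pd k (φ p) x|)
      (fun p _ => (m1 p).add (m2 p)) (by norm_num)
    rw [show (∑ p, fun x => (2 * (K : ℝ)) * |smear Ω (wV p k) (moll n) x|
      + (K : ℝ) * |pd k (φ p) x|) = fun x => ∑ p, ((2 * (K : ℝ)) * |smear Ω (wV p k) (moll n) x|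
      + (K : ℝ) * |pd k (φ p) x|) by ext x; simp] at this
    refine this.trans ?_
    refine le_trans (Finset.sum_le_sum fun p _ => ?_) (Finset.single_le_sum (f := fun k => ∑ p,
      (2 * K * eLpNorm (wV p k) 2 μ + K * (eLpNorm (wD p k) 2 μ + 1)))
      (fun _ _ => bot_le) (Finset.mem_univ k))
    refine (eLpNorm_add_le (m1 p) (m2 p) (by norm_num)).trans ?_
    have t1 : eLpNorm (fun x => (2 * (K : ℝ)) * |smear Ω (wV p k) (moll n) x|) 2 μ
        = 2 * K * eLpNorm (smear Ω (wV p k) (moll n)) 2 μ := by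
      have := eLpNorm_const_smul (2 * (K : ℝ)) (fun x => |smear Ω (wV p k) (moll n) x|) 2 μ
      have h2 := eLpNorm_norm (p := 2) (μ := μ) (smear Ω (wV p k) (moll n))
      simp only [Real.norm_eq_abs] at h2
      rw [h2, show ‖2 * (K : ℝ)‖ₑ = 2 * K by
        rw [show 2 * (K : ℝ) = ((2 * K : NNReal) : ℝ) by push_cast; ring, hnn]; push_cast; ring]
        at this
      exact this
    have t2 : eLpNorm (fun x => (K : ℝ) * |pd k (φ p) x|) 2 μ = K * eLpNorm (pd k (φ p)) 2 μ := by
      have := eLpNorm_const_smul (K : ℝ) (fun x => |pd k (φ p) x|) 2 μ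
      have h2 := eLpNorm_norm (p := 2) (μ := μ) (pd k (φ p))
      simp only [Real.norm_eq_abs] at h2
      rw [h2, hnn] at this
      exact this
    have t3 : eLpNorm (smear Ω (wV p k) (moll n)) 2 μ ≤ eLpNorm (wV p k) 2 μ :=
      (eLpNorm_mono_measure _ Measure.restrict_le_self).trans
        (eLpNorm_smear_le hΩ.measurableSet (wi p) ((hV p).isWeakPartial k).1 (contDiff_moll n)
          (hasCompactSupport_moll n) (moll_nonneg n) (integral_moll n))
    have t4 : eLpNorm (pd k (φ p)) 2 μ ≤ eLpNorm (wD p k) 2 μ + 1 := by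
      have e : pd k (φ p) = wD p k - fun x => wD p k x - pd k (φ p) x := by
        ext x; simp
      rw [e]
      refine (eLpNorm_sub_le ((hUV p).1.isWeakPartial k).1.1
        (((hUV p).1.isWeakPartial k).1.1.sub ((hφ p).pd k).continuous.aestronglyMeasurable)
        (by norm_num)).trans ?_
      refine add_le_add le_rfl ((hφ1 p k).trans ?_)
      rw [← ENNReal.ofReal_one]
      exact ENNReal.ofReal_le_ofReal hε1
    rw [t1, t2]
    exact add_le_add (mul_le_mul_right t3 _) (mul_le_mul_right t4 _)

/-! ### A smooth truncation of the Newtonian kernel and its rescalings -/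

/-- A smooth function equal to `t ^ (-1/2)` for `t ≥ 1`. -/
noncomputable def invSqrtCutoff (t : ℝ) : ℝ := Real.smoothTransition (2 * t - 1) * (√t)⁻¹

theorem contDiff_invSqrtCutoff : ContDiff ℝ ∞ invSqrtCutoff := by
  rw [contDiff_iff_contDiffAt]
  intro t
  rcases lt_or_ge 0 t with ht | ht
  · refine ContDiffAt.mul ?_ ?_
    · exact (Real.smoothTransition.contDiff.comp
        ((contDiff_const.mul contDiff_id).sub contDiff_const)).contDiffAt
    · exact (contDiffAt_id.sqrt ht.ne').inv (Real.sqrt_pos.2 ht).ne'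
  · have : invSqrtCutoff =ᶠ[𝓝 t] fun _ => 0 := by
      filter_upwards [gt_mem_nhds (show t < 1 / 2 by linarith)] with y hy
      rw [invSqrtCutoff, Real.smoothTransition.zero_of_nonpos (by linarith), zero_mul]
    exact contDiffAt_const.congr_of_eventuallyEq this

theorem invSqrtCutoff_of_one_le {t : ℝ} (ht : 1 ≤ t) : invSqrtCutoff t = (√t)⁻¹ := by
  rw [invSqrtCutoff, Real.smoothTransition.one_of_one_le (by linarith), one_mul]

theorem deriv_invSqrtCutoff {t : ℝ} (ht : 1 < t) :
    deriv invSqrtCutoff t = -(1 / 2) * (√t)⁻¹ ^ 3 := by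
  have h : invSqrtCutoff =ᶠ[𝓝 t] fun t => (√t)⁻¹ := by
    filter_upwards [lt_mem_nhds ht] with y hy using invSqrtCutoff_of_one_le hy.le
  rw [h.deriv_eq]
  have hs : 0 < √t := Real.sqrt_pos.2 (by linarith)
  have hd : HasDerivAt (fun t : ℝ => (√t)⁻¹) (-(1 / (2 * √t)) / √t ^ 2) t :=
    (Real.hasDerivAt_sqrt (by linarith)).inv hs.ne'
  rw [hd.deriv]
  field_simp

theorem deriv_deriv_invSqrtCutoff {t : ℝ} (ht : 1 < t) :
    deriv (deriv invSqrtCutoff) t = 3 / 4 * (√t)⁻¹ ^ 5 := by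
  have h : deriv invSqrtCutoff =ᶠ[𝓝 t] fun t => -(1 / 2) * (√t)⁻¹ ^ 3 := by
    filter_upwards [lt_mem_nhds ht] with y hy using deriv_invSqrtCutoff hy
  rw [h.deriv_eq]
  have hs : 0 < √t := Real.sqrt_pos.2 (by linarith)
  have hd : HasDerivAt (fun t : ℝ => (√t)⁻¹) (-(1 / (2 * √t)) / √t ^ 2) t :=
    (Real.hasDerivAt_sqrt (by linarith)).inv hs.ne'
  have hd2 := (hd.pow 3).const_mul (-(1 / 2) : ℝ)
  have : deriv (fun t : ℝ => -(1 / 2) * (√t)⁻¹ ^ 3) t = _ := hd2.deriv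
  rw [this]
  norm_num
  field_simp
  norm_num

/-- A smooth function on `E3` equal to `1 / |x|` off the unit ball. -/
noncomputable def newton (x : E3) : ℝ := invSqrtCutoff (‖x‖ ^ 2)

theorem contDiff_newton : ContDiff ℝ ∞ newton := contDiff_invSqrtCutoff.comp (contDiff_norm_sq ℝ)

theorem newton_of_one_le {x : E3} (hx : 1 ≤ ‖x‖) : newton x = ‖x‖⁻¹ := by
  rw [newton, invSqrtCutoff_of_one_le (by nlinarith), Real.sqrt_sq (norm_nonneg _)]

theorem pd_norm_sq (k : Fin 3) (x : E3) : pd k (fun y => ‖y‖ ^ 2) x = 2 * x k := by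
  have h := (hasStrictFDerivAt_norm_sq x).hasFDerivAt.fderiv
  unfold pd
  rw [h]
  simp [EuclideanSpace.inner_single_right]

theorem pd_coord (k j : Fin 3) (x : E3) : pd k (fun y => y j) x = if j = k then 1 else 0 := by
  have h : HasFDerivAt (fun y : E3 => y j) (EuclideanSpace.proj j : E3 →L[ℝ] ℝ) x :=
    (EuclideanSpace.proj j : E3 →L[ℝ] ℝ).hasFDerivAt
  unfold pd
  rw [h.fderiv]
  simp

theorem pd_newton (k : Fin 3) (x : E3) :
    pd k newton x = deriv invSqrtCutoff (‖x‖ ^ 2) * (2 * x k) := by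
  have := pd_comp (k := k) (F := invSqrtCutoff) (f := fun y : E3 => ‖y‖ ^ 2) (x := x)
    (contDiff_invSqrtCutoff.differentiable (by simp) _)
    ((contDiff_norm_sq ℝ (n := ∞)).differentiable (by simp) _)
  rw [pd_norm_sq] at this
  exact this

/-- For a radial function `f (|x|²)` in dimension three, `∂ₖ∂ₖ` gives `2 f' + 4 xₖ² f''`, to be
summed over `k`. -/
theorem lapl_newton (x : E3) : lapl newton x = 6 * deriv invSqrtCutoff (‖x‖ ^ 2)
    + 4 * ‖x‖ ^ 2 * deriv (deriv invSqrtCutoff) (‖x‖ ^ 2) := by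
  have hd : ContDiff ℝ ∞ (deriv invSqrtCutoff) :=
    (contDiff_infty_iff_deriv.1 contDiff_invSqrtCutoff).2
  have hn : DifferentiableAt ℝ (fun y : E3 => ‖y‖ ^ 2) x :=
    (contDiff_norm_sq ℝ (n := ∞)).differentiable (by simp) _
  have key : ∀ k, pd k (pd k newton) x = 2 * deriv invSqrtCutoff (‖x‖ ^ 2)
      + 4 * x k ^ 2 * deriv (deriv invSqrtCutoff) (‖x‖ ^ 2) := by
    intro k
    rw [show pd k newton = fun y => deriv invSqrtCutoff (‖y‖ ^ 2) * (2 * y k) from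
      funext (pd_newton k)]
    have d1 : DifferentiableAt ℝ (fun y : E3 => deriv invSqrtCutoff (‖y‖ ^ 2)) x :=
      DifferentiableAt.comp x (hd.differentiable (by simp) _) hn
    have d2 : DifferentiableAt ℝ (fun y : E3 => y k) x := by fun_prop
    rw [pd_mul d1 (d2.const_mul 2), pd_const_mul _ d2, pd_coord,
      pd_comp (hd.differentiable (by simp) _) hn, pd_norm_sq]
    simp
    ring
  unfold lapl
  simp only [key]
  rw [EuclideanSpace.real_norm_sq_eq]
  simp only [Fin.sum_univ_three]
  ring

/-- The Laplacian of the truncated kernel. -/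
noncomputable abbrev newtonLapl : E3 → ℝ := lapl newton

theorem support_newtonLapl : Function.support newtonLapl ⊆ Metric.closedBall 0 1 := by
  intro x hx
  rw [mem_closedBall_zero_iff]
  by_contra h
  push Not at h
  refine hx ?_
  have h2 : 1 < ‖x‖ ^ 2 := by nlinarith
  have hs : √(‖x‖ ^ 2) = ‖x‖ := Real.sqrt_sq (norm_nonneg _)
  show lapl newton x = 0
  rw [lapl_newton, deriv_invSqrtCutoff h2, deriv_deriv_invSqrtCutoff h2, hs]
  have : ‖x‖ ≠ 0 := by linarith
  field_simp
  ring

theorem hasCompactSupport_of_support_subset {η : E3 → ℝ} {r : ℝ}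
    (h : Function.support η ⊆ Metric.closedBall 0 r) : HasCompactSupport η :=
  (isCompact_closedBall (0 : E3) r).of_isClosed_subset (isClosed_tsupport _)
    (closure_minimal h Metric.isClosed_closedBall)

/-- The integral is the flux of the gradient of `1 / |x|` through a large sphere. Being nonzero, it
can be divided out: the kernels `rho n` are an approximate identity up to this constant. -/
theorem integral_newtonLapl_ne_zero : ∫ x, newtonLapl x ≠ 0 := by
  let r : ℝ → ℝ := fun y => 6 * deriv invSqrtCutoff (y ^ 2)
    + 4 * y ^ 2 * deriv (deriv invSqrtCutoff) (y ^ 2)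
  have hd : ContDiff ℝ ∞ (deriv invSqrtCutoff) :=
    (contDiff_infty_iff_deriv.1 contDiff_invSqrtCutoff).2
  have hd2 : ContDiff ℝ ∞ (deriv (deriv invSqrtCutoff)) := (contDiff_infty_iff_deriv.1 hd).2
  have h1 : ∫ x, newtonLapl x = ∫ x : E3, r ‖x‖ :=
    integral_congr_ae (Eventually.of_forall lapl_newton)
  rw [h1, integral_fun_norm_addHaar]
  have hdim : Module.finrank ℝ E3 = 3 := by simp
  rw [hdim]
  have hint : ∫ y in Set.Ioi (0 : ℝ), y ^ (3 - 1) • r y = -1 := by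
    have hz : ∀ y ∈ Set.Ioi (0 : ℝ) \ Set.Ioc 0 2, y ^ (3 - 1) • r y = 0 := by
      intro y hy
      have hy2 : 2 < y := by
        by_contra h
        exact hy.2 ⟨hy.1, not_lt.1 h⟩
      have h2 : 1 < y ^ 2 := by nlinarith
      have hy0 : y ≠ 0 := by linarith
      simp only [r]
      rw [deriv_invSqrtCutoff h2, deriv_deriv_invSqrtCutoff h2, Real.sqrt_sq (by linarith)]
      simp only [smul_eq_mul]
      field_simp
      ring
    have e1 : ∫ y in Set.Ioi (0 : ℝ), y ^ (3 - 1) • r y = ∫ y in Set.Ioc (0 : ℝ) 2, y ^ 2 * r y :=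
      setIntegral_eq_of_subset_of_forall_sdiff_eq_zero measurableSet_Ioi
        (fun y hy => hy.1) hz
    rw [e1, ← intervalIntegral.integral_of_le (by norm_num)]
    -- The antiderivative is `y²` times the radial derivative of `newton`. At `y = 2` it equals `16
    -- * (-1/16) = -1`.
    have hder : ∀ y : ℝ, HasDerivAt (fun y => 2 * y ^ 3 * deriv invSqrtCutoff (y ^ 2))
        (y ^ 2 * r y) y := by
      intro y
      have a1 : HasDerivAt (fun y : ℝ => deriv invSqrtCutoff (y ^ 2))
          (deriv (deriv invSqrtCutoff) (y ^ 2) * (2 * y)) y := by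
        have := (hd.differentiable (by simp) (y ^ 2)).hasDerivAt
        have h2 : HasDerivAt (fun y : ℝ => y ^ 2) (2 * y) y := by simpa using hasDerivAt_pow 2 y
        exact HasDerivAt.comp (h₂ := deriv invSqrtCutoff) (h := fun y : ℝ => y ^ 2) y this h2
      have a2 : HasDerivAt (fun y : ℝ => 2 * y ^ 3) (2 * (3 * y ^ 2)) y := by
        simpa using (hasDerivAt_pow 3 y).const_mul 2
      refine (a2.mul a1).congr_deriv ?_
      show _ = y ^ 2 * (6 * _ + 4 * y ^ 2 * _)
      ring
    have hcont : Continuous fun y : ℝ => y ^ 2 * r y := by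
      have c1 := hd.continuous
      have c2 := hd2.continuous
      simp only [r]
      fun_prop
    rw [intervalIntegral.integral_eq_sub_of_hasDerivAt (fun y _ => hder y)
      (hcont.intervalIntegrable _ _), deriv_invSqrtCutoff (by norm_num),
      Real.sqrt_sq (by norm_num)]
    norm_num
  rw [hint]
  have : 0 < volume.real (Metric.ball (0 : E3) 1) :=
    ENNReal.toReal_pos (Metric.measure_ball_pos _ _ one_pos).ne' Metric.isBounded_ball.measure_lt_top.ne
  simp only [smul_eq_mul, nsmul_eq_mul]
  intro h
  norm_num at h
  exact this.ne' (by simpa using h)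

theorem pd_comp_smul (k : Fin 3) {f : E3 → ℝ} (hf : ContDiff ℝ ∞ f) (a : ℝ) (x : E3) :
    pd k (fun y => f (a • y)) x = a * pd k f (a • x) := by
  have h : HasFDerivAt (fun y => f (a • y)) _ x :=
    (hf.differentiable (by simp) (a • x)).hasFDerivAt.comp x ((hasFDerivAt_id x).const_smul a)
  unfold pd
  rw [h.fderiv]
  simp

theorem pd_scaled (k : Fin 3) {f : E3 → ℝ} (hf : ContDiff ℝ ∞ f) (c a : ℝ) (x : E3) :
    pd k (fun y => c * f (a • y)) x = c * a * pd k f (a • x) := by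
  have hd : ContDiff ℝ ∞ fun y => f (a • y) := hf.comp (contDiff_const_smul a)
  rw [pd_const_mul _ (hd.differentiable (by simp) x), pd_comp_smul k hf]
  ring

theorem contDiff_scaled {f : E3 → ℝ} (hf : ContDiff ℝ ∞ f) (c a : ℝ) :
    ContDiff ℝ ∞ fun y => c * f (a • y) :=
  contDiff_const.mul (hf.comp (contDiff_const_smul a))

theorem lapl_scaled {f : E3 → ℝ} (hf : ContDiff ℝ ∞ f) (c a : ℝ) (x : E3) :
    lapl (fun y => c * f (a • y)) x = c * a ^ 2 * lapl f (a • x) := by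
  unfold lapl
  rw [Finset.mul_sum]
  refine Finset.sum_congr rfl fun k _ => ?_
  rw [show pd k (fun y => c * f (a • y)) = fun y => c * a * pd k f (a • y) from
    funext (pd_scaled k hf c a), pd_scaled k (contDiff_pd hf)]
  ring

theorem lapl_sub {f g : E3 → ℝ} (hf : ContDiff ℝ ∞ f) (hg : ContDiff ℝ ∞ g) (x : E3) :
    lapl (fun y => f y - g y) x = lapl f x - lapl g x := by
  unfold lapl
  rw [← Finset.sum_sub_distrib]
  refine Finset.sum_congr rfl fun k _ => ?_
  rw [show pd k (fun y => f y - g y) = fun y => pd k f y - pd k g y from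
    funext fun y => pd_sub (hf.differentiable (by simp) y) (hg.differentiable (by simp) y),
    pd_sub ((contDiff_pd hf).differentiable (by simp) x)
      ((contDiff_pd hg).differentiable (by simp) x)]

/-- The approximate identities `8ⁿ ρ(2ⁿ x)`, where `ρ` is the Laplacian of the truncated kernel. -/
noncomputable def rho (n : ℕ) (x : E3) : ℝ := 8 ^ n * newtonLapl ((2 : ℝ) ^ n • x)

/-- The difference of the truncated kernels at two consecutive scales. -/
noncomputable def newtonDiff (x : E3) : ℝ := newton x - 2 * newton ((2 : ℝ) • x)

/-- The rescalings `2ⁿ D(2ⁿ x)` of `newtonDiff`. -/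
noncomputable def jker (n : ℕ) (x : E3) : ℝ := 2 ^ n * newtonDiff ((2 : ℝ) ^ n • x)

theorem contDiff_newtonDiff : ContDiff ℝ ∞ newtonDiff :=
  contDiff_newton.sub (contDiff_scaled contDiff_newton 2 2)

/-- `1 / |x|` is homogeneous of degree `-1`, so `2 / |2 x|` cancels it outside the unit ball. -/
theorem support_newtonDiff : Function.support newtonDiff ⊆ Metric.closedBall 0 1 := by
  intro x hx
  rw [mem_closedBall_zero_iff]
  by_contra h
  push Not at h
  refine hx ?_
  have hn : ‖(2 : ℝ) • x‖ = 2 * ‖x‖ := by rw [norm_smul]; norm_num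
  rw [newtonDiff, newton_of_one_le h.le, newton_of_one_le (by rw [hn]; linarith), hn]
  have : ‖x‖ ≠ 0 := by linarith
  field_simp
  ring

theorem contDiff_jker (n : ℕ) : ContDiff ℝ ∞ (jker n) := contDiff_scaled contDiff_newtonDiff _ _

theorem contDiff_rho (n : ℕ) : ContDiff ℝ ∞ (rho n) :=
  contDiff_scaled (contDiff_lapl contDiff_newton) _ _

theorem support_scaled_subset {f : E3 → ℝ} (hf : Function.support f ⊆ Metric.closedBall 0 1)
    (c : ℝ) (n : ℕ) : Function.support (fun x => c * f ((2 : ℝ) ^ n • x)) ⊆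
      Metric.closedBall 0 ((1 / 2 : ℝ) ^ n) := by
  intro x hx
  have h1 : f ((2 : ℝ) ^ n • x) ≠ 0 := right_ne_zero_of_mul hx
  have h2 := hf h1
  rw [mem_closedBall_zero_iff] at h2 ⊢
  rw [norm_smul, norm_pow, Real.norm_ofNat] at h2
  rw [one_div, inv_pow, ← one_div, le_div_iff₀ (by positivity)]
  linarith

theorem support_jker (n : ℕ) :
    Function.support (jker n) ⊆ Metric.closedBall 0 ((1 / 2 : ℝ) ^ n) :=
  support_scaled_subset support_newtonDiff _ n

theorem support_rho (n : ℕ) :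
    Function.support (rho n) ⊆ Metric.closedBall 0 ((1 / 2 : ℝ) ^ n) :=
  support_scaled_subset support_newtonLapl _ n

/-- The telescoping identity behind the regularity theory. Differences of consecutive approximate
identities are Laplacians of compactly supported kernels, so the equation can be tested with them.
The factors are dictated by scaling: `2ⁿ` from the kernel and `4ⁿ` from the Laplacian make the `8ⁿ`
of a three-dimensional approximate identity. -/
theorem lapl_jker (n : ℕ) (x : E3) : lapl (jker n) x = rho n x - rho (n + 1) x := by
  have h1 : lapl newtonDiff ((2 : ℝ) ^ n • x)
      = newtonLapl ((2 : ℝ) ^ n • x) - 8 * newtonLapl ((2 : ℝ) ^ (n + 1) • x) := by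
    have e := lapl_sub contDiff_newton (contDiff_scaled contDiff_newton 2 2) ((2 : ℝ) ^ n • x)
    rw [lapl_scaled contDiff_newton, smul_smul] at e
    rw [show newtonDiff = fun y => newton y - 2 * newton ((2 : ℝ) • y) from rfl, e,
      pow_succ' (2 : ℝ) n]
    norm_num
  have h2 := lapl_scaled contDiff_newtonDiff (2 ^ n) (2 ^ n) x
  rw [show jker n = fun y => 2 ^ n * newtonDiff ((2 : ℝ) ^ n • y) from rfl, h2, h1, rho, rho]
  have : (8 : ℝ) ^ n = 2 ^ n * (2 ^ n) ^ 2 := by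
    rw [show (8 : ℝ) = 2 ^ 3 by norm_num, ← pow_mul]; ring
  rw [pow_succ (8 : ℝ), this]
  ring

theorem exists_bound_jker : ∃ C, 0 ≤ C ∧ (∀ n x, |jker n x| ≤ C * 2 ^ n) ∧
    ∀ n k x, |pd k (jker n) x| ≤ C * 4 ^ n := by
  have hc := hasCompactSupport_of_support_subset support_newtonDiff
  obtain ⟨C0, hC0⟩ := hc.exists_bound_of_continuous contDiff_newtonDiff.continuous
  have hk : ∀ k, ∃ C, ∀ x, ‖pd k newtonDiff x‖ ≤ C := fun k =>
    (show HasCompactSupport (pd k newtonDiff) from hc.of_isClosed_subset (isClosed_tsupport _)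
      (tsupport_pd_subset k newtonDiff)).exists_bound_of_continuous
      (contDiff_pd contDiff_newtonDiff).continuous
  choose C hC using hk
  have hCn : ∀ k, 0 ≤ C k := fun k => (norm_nonneg _).trans (hC k 0)
  have hC0n : 0 ≤ C0 := (norm_nonneg _).trans (hC0 0)
  refine ⟨C0 + ∑ k, C k, add_nonneg hC0n (Finset.sum_nonneg fun k _ => hCn k), fun n x => ?_,
    fun n k x => ?_⟩
  · rw [jker, abs_mul, abs_of_pos (by positivity : (0 : ℝ) < 2 ^ n), mul_comm]
    refine mul_le_mul_of_nonneg_right ((hC0 _).trans ?_) (by positivity)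
    linarith [Finset.sum_nonneg fun k (_ : k ∈ Finset.univ) => hCn k]
  · have := pd_scaled k contDiff_newtonDiff (2 ^ n) (2 ^ n) x
    rw [show jker n = fun y => 2 ^ n * newtonDiff ((2 : ℝ) ^ n • y) from rfl, this, ← mul_pow,
      abs_mul, abs_of_pos (by positivity), show (2 : ℝ) * 2 = 4 by norm_num, mul_comm]
    refine mul_le_mul_of_nonneg_right ((hC k _).trans ?_) (by positivity)
    linarith [Finset.single_le_sum (fun k (_ : k ∈ Finset.univ) => hCn k) (Finset.mem_univ k)]

/-! ### Interior regularity for the Poisson equation -/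

/-- `Δ u = g` in `U` in the sense of distributions. -/
def IsWeakLapl (U : Set E3) (u g : E3 → ℝ) : Prop :=
  ∀ φ, IsTestFunction U φ → ∫ x in U, u x * lapl φ x = ∫ x in U, g x * φ x

theorem IsWeakLapl.mono {U V : Set E3} {u g : E3 → ℝ} (h : IsWeakLapl U u g) (hV : V ⊆ U) :
    IsWeakLapl V u g := fun φ hφ => by
  rw [← hφ.lapl.setIntegral_mul_mono hV, ← hφ.setIntegral_mul_mono hV]
  exact h φ (hφ.mono hV)

theorem IsWeakLapl.congr {U : Set E3} {u u' g g' : E3 → ℝ} (h : IsWeakLapl U u g)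
    (hu : u =ᵐ[volume.restrict U] u') (hg : g =ᵐ[volume.restrict U] g') :
    IsWeakLapl U u' g' := fun φ hφ => by
  have h1 : ∫ x in U, u x * lapl φ x = ∫ x in U, u' x * lapl φ x :=
    integral_congr_ae (by filter_upwards [hu] with x hx; rw [hx])
  have h2 : ∫ x in U, g x * φ x = ∫ x in U, g' x * φ x :=
    integral_congr_ae (by filter_upwards [hg] with x hx; rw [hx])
  rw [← h1, ← h2, h φ hφ]

theorem exists_tendstoUniformlyOn_of_geometric {α X : Type*} [NormedAddCommGroup X]
    [CompleteSpace X] {f : ℕ → α → X} {S : Set α} {C q : ℝ} (hq1 : q < 1) (hq0 : 0 ≤ q)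
    (h : ∀ n, ∀ x ∈ S, dist (f n x) (f (n + 1) x) ≤ C * q ^ n) :
    ∃ F : α → X, TendstoUniformlyOn f F atTop S := by
  classical
  have hc : ∀ x, ∃ y, x ∈ S → Tendsto (fun n => f n x) atTop (𝓝 y) := fun x => by
    by_cases hx : x ∈ S
    · obtain ⟨y, hy⟩ := cauchySeq_tendsto_of_complete
        (cauchySeq_of_le_geometric q C hq1 fun n => h n x hx)
      exact ⟨y, fun _ => hy⟩
    · exact ⟨0, fun h' => absurd h' hx⟩
  choose F hF using hc
  refine ⟨F, ?_⟩
  rw [Metric.tendstoUniformlyOn_iff]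
  intro ε hε
  have hlim : Tendsto (fun n : ℕ => C * q ^ n / (1 - q)) atTop (𝓝 0) := by
    have := ((tendsto_pow_atTop_nhds_zero_of_lt_one hq0 hq1).const_mul C).div_const (1 - q)
    simpa using this
  filter_upwards [hlim.eventually_lt_const hε] with n hn x hx
  rw [dist_comm]
  exact (dist_le_of_le_geometric_of_tendsto q C hq1 (fun n => h n x hx) (hF x hx) n).trans_lt hn

theorem abs_smear_le {U : Set E3} {g η : E3 → ℝ} (hg : IntegrableOn g U)
    {r b : ℝ} (hη : ∀ x, |η x| ≤ b) (hs : Function.support η ⊆ Metric.closedBall 0 r)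
    (x : E3) : |smear U g η x| ≤ b * ∫ y in U ∩ Metric.closedBall x r, |g y| := by
  have hms : MeasurableSet (Metric.closedBall x r) := Metric.isClosed_closedBall.measurableSet
  rw [← Real.norm_eq_abs, smear, ← integral_const_mul, Set.inter_comm,
    ← Measure.restrict_restrict hms, ← integral_indicator hms]
  refine norm_integral_le_of_norm_le ?_ (Eventually.of_forall fun y => ?_)
  · exact (hg.abs.const_mul b).indicator hms
  · by_cases hy : y ∈ Metric.closedBall x r
    · rw [Set.indicator_of_mem hy, norm_mul, mul_comm]
      exact mul_le_mul_of_nonneg_right (hη _) (norm_nonneg _)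
    · rw [Set.indicator_of_notMem hy]
      have : η (x - y) = 0 := by
        by_contra h
        have := hs h
        rw [mem_closedBall_zero_iff, ← dist_eq_norm, dist_comm] at this
        exact hy this
      rw [this, mul_zero, norm_zero]

/-- Testing `Δ u = g` with the translate of `jker n` centred at `x`, which is admissible once its
supporting ball lies in `U`. The change of scale of `u` is thereby expressed through `g` alone. -/
theorem smear_rho_sub {U : Set E3} {u g : E3 → ℝ} (hu : IntegrableOn u U)
    (h : IsWeakLapl U u g) {n : ℕ} {x : E3} (hx : Metric.closedBall x ((1 / 2 : ℝ) ^ n) ⊆ U) :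
    smear U u (rho n) x - smear U u (rho (n + 1)) x = smear U g (jker n) x := by
  have h1 := h _ (isTestFunction_reflect (contDiff_jker n) (support_jker n) hx)
  simp only [lapl_reflect (contDiff_jker n), lapl_jker] at h1
  unfold smear
  rw [← h1]
  have hi : ∀ m, Integrable (fun y => u y * rho m (x - y)) (volume.restrict U) := fun m => by
    obtain ⟨B, hB⟩ := (hasCompactSupport_of_support_subset (support_rho m)).exists_bound_of_continuous
      (contDiff_rho m).continuous
    exact hu.mul_bdd (c := B) ((contDiff_rho m).continuous.comp
      (continuous_const.sub continuous_id)).aestronglyMeasurable (Eventually.of_forall fun y => hB _)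
  rw [← integral_sub (hi n) (hi (n + 1))]
  simp only [mul_sub]

/-- The convolutions with the approximate identities converge in the sense of distributions. -/
theorem tendsto_integral_smear_rho {U : Set E3} {u φ : E3 → ℝ}
    (hu : IntegrableOn u U) (hφ : IsTestFunction U φ) :
    Tendsto (fun n => ∫ x, smear U u (rho n) x * φ x) atTop
      (𝓝 ((∫ x, newtonLapl x) * ∫ x in U, u x * φ x)) := by
  have hρc := hasCompactSupport_of_support_subset support_newtonLapl
  have hρs : Continuous newtonLapl := (contDiff_lapl contDiff_newton).continuous
  have hρi : Integrable newtonLapl := hρs.integrable_of_hasCompactSupport hρc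
  obtain ⟨B, hB0, hB⟩ := hφ.exists_bound
  -- By Fubini the convolution is moved to the test function. After rescaling, the kernel is fixed
  -- and `φ` is evaluated at points tending to `y`, so dominated convergence applies.
  let A : ℕ → E3 → ℝ := fun n y => ∫ z, newtonLapl z * φ (y + ((2 : ℝ) ^ n)⁻¹ • z)
  have hswap : ∀ n, ∫ x, smear U u (rho n) x * φ x = ∫ y in U, u y * A n y := by
    intro n
    have hint : Integrable (Function.uncurry fun (x y : E3) => u y * rho n (x - y) * φ x)
        (volume.prod (volume.restrict U)) := by
      obtain ⟨D, hD⟩ := (hasCompactSupport_of_support_subset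
        (support_rho n)).exists_bound_of_continuous (contDiff_rho n).continuous
      have h1 : Integrable (fun z : E3 × E3 => φ z.1 * u z.2) (volume.prod (volume.restrict U)) :=
        hφ.integrable.mul_prod hu
      have hc : Continuous fun z : E3 × E3 => rho n (z.1 - z.2) :=
        (contDiff_rho n).continuous.comp (continuous_fst.sub continuous_snd)
      have h2 := h1.mul_bdd (c := D) hc.aestronglyMeasurable (Eventually.of_forall fun z => hD _)
      refine h2.congr (Eventually.of_forall fun z => ?_)
      simp only [Function.uncurry]
      ring
    have e1 : ∫ x, smear U u (rho n) x * φ x = ∫ x, ∫ y in U, u y * rho n (x - y) * φ x :=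
      integral_congr_ae (Eventually.of_forall fun x => by
        simp only [smear]; rw [← integral_mul_const])
    rw [e1, integral_integral_swap hint]
    refine integral_congr_ae (Eventually.of_forall fun y => ?_)
    simp only [A]
    have e2 : ∫ x, u y * rho n (x - y) * φ x = u y * ∫ x, rho n (x - y) * φ x := by
      rw [← integral_const_mul]
      simp only [mul_assoc]
    rw [e2]
    congr 1
    have e3 : ∫ x, rho n (x - y) * φ x = ∫ z, rho n z * φ (y + z) := by
      rw [← integral_add_right_eq_self (fun x => rho n (x - y) * φ x) y]
      refine integral_congr_ae (Eventually.of_forall fun z => ?_)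
      show rho n (z + y - y) * φ (z + y) = _
      rw [add_sub_cancel_right, add_comm]
    rw [e3]
    have e4 := Measure.integral_comp_smul (volume : Measure E3)
      (fun z => newtonLapl z * φ (y + ((2 : ℝ) ^ n)⁻¹ • z)) ((2 : ℝ) ^ n)
    have hdim : Module.finrank ℝ E3 = 3 := by simp
    have h2 : ((2 : ℝ) ^ n) ≠ 0 := by positivity
    have h8 : ((2 : ℝ) ^ n) ^ 3 = 8 ^ n := by
      rw [← pow_mul, mul_comm, pow_mul]; norm_num
    rw [hdim, h8, abs_of_pos (by positivity), smul_eq_mul] at e4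
    have e5 : ∀ z : E3, rho n z * φ (y + z) = 8 ^ n * (newtonLapl ((2 : ℝ) ^ n • z) *
        φ (y + ((2 : ℝ) ^ n)⁻¹ • (2 : ℝ) ^ n • z)) := fun z => by
      rw [smul_smul, inv_mul_cancel₀ h2, one_smul, rho]; ring
    simp only [e5]
    rw [integral_const_mul, e4, ← mul_assoc, mul_inv_cancel₀ (by positivity), one_mul]
  simp only [hswap]
  have hAlim : ∀ y, Tendsto (fun n => A n y) atTop (𝓝 ((∫ x, newtonLapl x) * φ y)) := by
    intro y
    rw [← integral_mul_const]
    refine tendsto_integral_of_dominated_convergence (fun z => |newtonLapl z| * B) ?_ ?_ ?_ ?_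
    · exact fun n => (hρs.mul (hφ.continuous.comp
        (continuous_const.add (continuous_const_smul _)))).aestronglyMeasurable
    · exact hρi.abs.mul_const B
    · refine fun n => Eventually.of_forall fun z => ?_
      rw [norm_mul]
      exact mul_le_mul_of_nonneg_left (hB _) (norm_nonneg _)
    · refine Eventually.of_forall fun z => ?_
      refine Tendsto.const_mul _ ?_
      have h1 : Tendsto (fun n : ℕ => ((2 : ℝ) ^ n)⁻¹) atTop (𝓝 0) := by
        have := tendsto_pow_atTop_nhds_zero_of_lt_one (r := (1 / 2 : ℝ)) (by norm_num) (by norm_num)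
        simpa [one_div, inv_pow] using this
      have h2 : Tendsto (fun n : ℕ => y + ((2 : ℝ) ^ n)⁻¹ • z) atTop (𝓝 (y + (0 : ℝ) • z)) :=
        (h1.smul_const z).const_add y
      rw [zero_smul, add_zero] at h2
      exact (hφ.continuous.tendsto y).comp h2
  have hAb : ∀ n y, |A n y| ≤ (∫ z, |newtonLapl z|) * B := by
    intro n y
    rw [← integral_mul_const, ← Real.norm_eq_abs]
    refine norm_integral_le_of_norm_le (hρi.abs.mul_const B) (Eventually.of_forall fun z => ?_)
    rw [norm_mul]
    exact mul_le_mul_of_nonneg_left (hB _) (norm_nonneg _)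
  have hAc : ∀ n, Continuous (A n) := by
    intro n
    refine continuous_of_dominated (bound := fun z => |newtonLapl z| * B) ?_ ?_ ?_ ?_
    · exact fun y => (hρs.mul (hφ.continuous.comp
        (continuous_const.add (continuous_const_smul _)))).aestronglyMeasurable
    · refine fun y => Eventually.of_forall fun z => ?_
      rw [norm_mul]
      exact mul_le_mul_of_nonneg_left (hB _) (norm_nonneg _)
    · exact hρi.abs.mul_const B
    · exact Eventually.of_forall fun z => continuous_const.mul
        (hφ.continuous.comp (continuous_id.add continuous_const))
  rw [← integral_const_mul]
  refine tendsto_integral_of_dominated_convergence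
    (fun y => |u y| * ((∫ z, |newtonLapl z|) * B)) ?_ ?_ ?_ ?_
  · exact fun n => hu.1.mul (hAc n).aestronglyMeasurable
  · exact hu.abs.mul_const _
  · refine fun n => Eventually.of_forall fun y => ?_
    rw [norm_mul]
    exact mul_le_mul_of_nonneg_left (hAb n y) (norm_nonneg _)
  · refine Eventually.of_forall fun y => ?_
    have := (hAlim y).const_mul (u y)
    rwa [show u y * ((∫ x, newtonLapl x) * φ y) = (∫ x, newtonLapl x) * (u y * φ y) by ring] at this

/-- A uniform limit of the convolutions is a representative of the function, up to a constant. -/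
theorem ae_eq_of_tendstoUniformlyOn {U V : Set E3} (hU : MeasurableSet U) (hV : IsOpen V)
    (hVU : V ⊆ U) {u v : E3 → ℝ} (hu : IntegrableOn u U) {N : ℕ}
    (hv : TendstoUniformlyOn (fun n => smear U u (rho (n + N))) v atTop V) :
    u =ᵐ[volume.restrict V] fun x => (∫ x, newtonLapl x)⁻¹ * v x := by
  have hsc : ∀ n, Continuous (smear U u (rho n)) := fun n => continuous_smear hU hu (contDiff_rho n)
    (hasCompactSupport_of_support_subset (support_rho n))
  have hvc : ContinuousOn v V :=
    hv.continuousOn (Eventually.of_forall fun n => (hsc _).continuousOn).frequently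
  refine ae_eq_of_forall_integral_eq hV (hu.mono_set hVU).locallyIntegrableOn
    ((continuousOn_const.mul hvc).locallyIntegrableOn hV.measurableSet) fun φ hφ => ?_
  have l1 := (tendsto_integral_smear_rho hu (hφ.mono hVU)).comp (tendsto_add_atTop_nat N)
  have l2 : Tendsto (fun n => ∫ x, smear U u (rho (n + N)) x * φ x) atTop
      (𝓝 (∫ x, v x * φ x)) := by
    have hvi : Integrable fun x => v x * φ x := hφ.integrable_mul_of_continuousOn hV hvc
    have hni : ∀ n, Integrable fun x => smear U u (rho (n + N)) x * φ x := fun n =>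
      hφ.integrable_mul_of_continuousOn hV (hsc _).continuousOn
    rw [tendsto_iff_dist_tendsto_zero, Metric.tendsto_atTop]
    intro ε hε
    have hI : 0 ≤ ∫ x, |φ x| := integral_nonneg fun _ => abs_nonneg _
    have hpos : 0 < ε / ((∫ x, |φ x|) + 1) := by positivity
    obtain ⟨M, hM⟩ := eventually_atTop.1 (Metric.tendstoUniformlyOn_iff.1 hv _ hpos)
    refine ⟨M, fun n hn => ?_⟩
    rw [Real.dist_eq, sub_zero, abs_of_nonneg dist_nonneg, Real.dist_eq, ← integral_sub (hni n) hvi,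
      ← Real.norm_eq_abs]
    refine (norm_integral_le_of_norm_le
      (g := fun x => ε / ((∫ x, |φ x|) + 1) * |φ x|) (hφ.integrable.abs.const_mul _)
      (Eventually.of_forall fun x => ?_)).trans_lt ?_
    · rw [← sub_mul, norm_mul]
      by_cases hx : x ∈ V
      · have := (hM n hn x hx).le
        rw [dist_comm, dist_eq_norm] at this
        exact mul_le_mul_of_nonneg_right this (norm_nonneg _)
      · simp [hφ.eq_zero hx]
    · rw [integral_const_mul, div_mul_eq_mul_div, div_lt_iff₀ (by positivity)]
      nlinarith
  -- The same integrals converge to the constant times `∫ u φ` in the sense of distributions, and to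
  -- `∫ v φ` by uniform convergence.
  have h3 := tendsto_nhds_unique l1 l2
  have hκ := integral_newtonLapl_ne_zero
  have h4 : ∫ x in U, u x * φ x = ∫ x in V, u x * φ x := hφ.setIntegral_mul_mono hVU u
  rw [h4] at h3
  have h5 : ∫ x in V, (∫ x, newtonLapl x)⁻¹ * v x * φ x
      = (∫ x, newtonLapl x)⁻¹ * ∫ x, v x * φ x := by
    rw [← hφ.integral_mul, ← integral_const_mul]
    simp only [mul_assoc]
  rw [h5, ← h3, ← mul_assoc, inv_mul_cancel₀ hκ, one_mul]

/-- Scales at which all balls around points near `x₀` lie in the domain. -/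
theorem exists_ball_and_scale {U : Set E3} (hU : IsOpen U) {x₀ : E3} (hx₀ : x₀ ∈ U) :
    ∃ δ > 0, Metric.ball x₀ δ ⊆ U ∧ ∃ N : ℕ, ∀ n ≥ N, ∀ x ∈ Metric.ball x₀ δ,
      Metric.closedBall x ((1 / 2 : ℝ) ^ n) ⊆ U := by
  obtain ⟨d, hd, hdU⟩ := Metric.isOpen_iff.1 hU x₀ hx₀
  obtain ⟨N, hN⟩ := exists_pow_lt_of_lt_one (half_pos hd) (show (1 / 2 : ℝ) < 1 by norm_num)
  refine ⟨d / 2, half_pos hd, (Metric.ball_subset_ball (by linarith)).trans hdU, N,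
    fun n hn x hx => ?_⟩
  refine Set.Subset.trans (fun y hy => ?_) hdU
  have h1 : (1 / 2 : ℝ) ^ n ≤ (1 / 2 : ℝ) ^ N :=
    pow_le_pow_of_le_one (by norm_num) (by norm_num) hn
  rw [Metric.mem_ball] at hx ⊢
  rw [Metric.mem_closedBall] at hy
  linarith [dist_triangle y x x₀]

/-- `jker n` is of size `2ⁿ` and lives on a ball of radius `r = 2⁻ⁿ`. A mass of `|g|` of order
`r^{3/2}` on such balls therefore makes consecutive convolutions differ by `O(2^{-n/2})`, and they
converge uniformly. -/
theorem exists_continuousOn_rep_of_growth {U : Set E3} (hU : IsOpen U) {u g : E3 → ℝ}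
    (hu : IntegrableOn u U) (hg : IntegrableOn g U) (h : IsWeakLapl U u g) {K : ℝ}
    (hgrow : ∀ (n : ℕ) x, ∫ y in U ∩ Metric.closedBall x ((1 / 2 : ℝ) ^ n), |g y|
      ≤ K * ((1 / 2 : ℝ) ^ n * √(1 / 2) ^ n)) {x₀ : E3} (hx₀ : x₀ ∈ U) :
    ∃ δ > 0, Metric.ball x₀ δ ⊆ U ∧ ∃ v, ContinuousOn v (Metric.ball x₀ δ) ∧
      u =ᵐ[volume.restrict (Metric.ball x₀ δ)] v := by
  obtain ⟨δ, hδ, hδU, N, hN⟩ := exists_ball_and_scale hU hx₀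
  obtain ⟨C, hC0, hC, -⟩ := exists_bound_jker
  have hq : √(1 / 2 : ℝ) < 1 := by
    rw [Real.sqrt_lt' one_pos]; norm_num
  obtain ⟨v, hv⟩ := exists_tendstoUniformlyOn_of_geometric (α := E3) (X := ℝ)
    (f := fun n => smear U u (rho (n + N))) (S := Metric.ball x₀ δ)
    (C := C * K * √(1 / 2) ^ N) hq (Real.sqrt_nonneg _) (fun n x hx => by
      have e1 := smear_rho_sub hu h (hN (n + N) (Nat.le_add_left _ _) x hx)
      rw [Real.dist_eq, show n + 1 + N = n + N + 1 by ring, e1]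
      refine (abs_smear_le hg (hC (n + N))
        (support_jker (n + N)) x).trans ?_
      refine (mul_le_mul_of_nonneg_left (hgrow (n + N) x) (by positivity)).trans (le_of_eq ?_)
      have : (2 : ℝ) ^ (n + N) * (1 / 2) ^ (n + N) = 1 := by rw [← mul_pow]; norm_num
      calc C * 2 ^ (n + N) * (K * ((1 / 2) ^ (n + N) * √(1 / 2) ^ (n + N)))
          = C * K * (2 ^ (n + N) * (1 / 2) ^ (n + N)) * √(1 / 2) ^ (n + N) := by ring
        _ = C * K * √(1 / 2) ^ N * √(1 / 2) ^ n := by rw [this, pow_add]; ring)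
  refine ⟨δ, hδ, hδU, _, ?_, ae_eq_of_tendstoUniformlyOn hU.measurableSet Metric.isOpen_ball hδU
    hu hv⟩
  refine continuousOn_const.mul (hv.continuousOn (Eventually.of_forall fun n => ?_).frequently)
  exact (continuous_smear hU.measurableSet hu (contDiff_rho _)
    (hasCompactSupport_of_support_subset (support_rho _))).continuousOn

theorem volume_real_closedBall (x : E3) {r : ℝ} (hr : 0 ≤ r) :
    volume.real (Metric.closedBall x r) = r ^ 3 * volume.real (Metric.ball (0 : E3) 1) := by
  have hdim : Module.finrank ℝ E3 = 3 := by simp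
  rw [Measure.real, Measure.addHaar_closedBall _ _ hr, hdim, ENNReal.toReal_mul,
    ENNReal.toReal_ofReal (by positivity)]
  rfl

theorem volume_real_unitBall_pos : 0 < volume.real (Metric.ball (0 : E3) 1) :=
  ENNReal.toReal_pos (Metric.measure_ball_pos _ _ one_pos).ne'
    Metric.isBounded_ball.measure_lt_top.ne

/-- Cauchy-Schwarz on a ball of radius `r`, whose volume is of order `r³`; the factor `√(1/2) ^ n`
is `√r`. -/
theorem integral_abs_le_of_memLp_two {U : Set E3} {g : E3 → ℝ}
    (hg : MemLp g 2 (volume.restrict U)) (n : ℕ) (x : E3) :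
    ∫ y in U ∩ Metric.closedBall x ((1 / 2 : ℝ) ^ n), |g y| ≤
      √((∫ y in U, g y ^ 2) * volume.real (Metric.ball (0 : E3) 1))
        * ((1 / 2 : ℝ) ^ n * √(1 / 2) ^ n) := by
  set r : ℝ := (1 / 2 : ℝ) ^ n with hr
  have hr0 : 0 < r := by positivity
  set A := U ∩ Metric.closedBall x r with hA
  set V := volume.real (Metric.closedBall x r) with hV
  have hVr : V = r ^ 3 * volume.real (Metric.ball (0 : E3) 1) := volume_real_closedBall x hr0.le
  have hV0 : 0 < V := by rw [hVr]; have := volume_real_unitBall_pos; positivity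
  have hfin : volume (Metric.closedBall x r) ≠ ⊤ := Metric.isBounded_closedBall.measure_lt_top.ne
  have hAfin : volume A ≠ ⊤ := measure_ne_top_of_subset Set.inter_subset_right hfin
  have hVA : volume.real A ≤ V := measureReal_mono Set.inter_subset_right hfin
  have hfm : IsFiniteMeasure (volume.restrict A) := ⟨by simpa using hAfin.lt_top⟩
  have hgA : MemLp g 2 (volume.restrict A) :=
    hg.mono_measure (Measure.restrict_mono_set _ Set.inter_subset_left)
  have i1 : Integrable (fun y => |g y|) (volume.restrict A) := (hgA.integrable (by norm_num)).abs
  have i2 : Integrable (fun y => g y ^ 2) (volume.restrict A) := hgA.integrable_sq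
  set b := ∫ y in A, |g y| with hb
  have hb0 : 0 ≤ b := integral_nonneg fun _ => abs_nonneg _
  have hG : ∫ y in A, g y ^ 2 ≤ ∫ y in U, g y ^ 2 :=
    setIntegral_mono_set hg.integrable_sq (Eventually.of_forall fun y => sq_nonneg _)
      (Set.inter_subset_left.eventuallyLE)
  -- Expanding this square gives Cauchy-Schwarz with the volume `V` of the whole ball in place of
  -- that of `A`.
  have h0 : 0 ≤ ∫ y in A, (|g y| - b / V) ^ 2 := integral_nonneg fun _ => sq_nonneg _
  have e : ∫ y in A, (|g y| - b / V) ^ 2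
      = (∫ y in A, g y ^ 2) - 2 * (b / V) * b + (b / V) ^ 2 * volume.real A := by
    have : (fun y => (|g y| - b / V) ^ 2) =
        fun y => (g y ^ 2 - 2 * (b / V) * |g y|) + (b / V) ^ 2 := by
      ext y; rw [sub_sq, sq_abs]; ring
    have s1 : ∫ y in A, ((g y ^ 2 - 2 * (b / V) * |g y|) + (b / V) ^ 2)
        = (∫ y in A, (g y ^ 2 - 2 * (b / V) * |g y|)) + ∫ y in A, (b / V) ^ 2 :=
      integral_add (i2.sub (i1.const_mul _)) (integrable_const _)
    rw [this, s1, integral_sub i2 (i1.const_mul _), integral_const_mul, setIntegral_const]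
    simp only [smul_eq_mul, hb]
    ring
  have hbV : b ^ 2 ≤ (∫ y in U, g y ^ 2) * V := by
    have h1 : (b / V) ^ 2 * volume.real A ≤ (b / V) ^ 2 * V := by gcongr
    have h2 : (b / V) ^ 2 * V = b ^ 2 / V := by field_simp
    have h3 : 2 * (b / V) * b = 2 * (b ^ 2 / V) := by ring
    rw [← div_le_iff₀ hV0]
    linarith
  have hfinal : b ≤ √((∫ y in U, g y ^ 2) * V) := Real.le_sqrt_of_sq_le hbV
  refine hfinal.trans (le_of_eq ?_)
  have h12 : √(1 / 2 : ℝ) ^ n = √r := by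
    rw [hr]
    exact (Real.sqrt_eq_iff_mul_self_eq (by positivity) (by positivity)).2 (by
      rw [← mul_pow, Real.mul_self_sqrt (by norm_num)]) |>.symm
  rw [hVr, h12, show (∫ y in U, g y ^ 2) * (r ^ 3 * volume.real (Metric.ball (0 : E3) 1))
    = ((∫ y in U, g y ^ 2) * volume.real (Metric.ball (0 : E3) 1)) * (r ^ 2 * r) by ring,
    Real.sqrt_mul (mul_nonneg (integral_nonneg fun _ => sq_nonneg _) measureReal_nonneg),
    Real.sqrt_mul (sq_nonneg r), Real.sqrt_sq hr0.le]

/-- Distributional solutions of `Δ u = g` with `g ∈ L²` are continuous. -/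
theorem exists_continuousOn_rep {U : Set E3} (hU : IsOpen U) (hfin : volume U ≠ ⊤) {u g : E3 → ℝ}
    (hu : IntegrableOn u U) (hg : MemLp g 2 (volume.restrict U)) (h : IsWeakLapl U u g)
    {x₀ : E3} (hx₀ : x₀ ∈ U) :
    ∃ δ > 0, Metric.ball x₀ δ ⊆ U ∧ ∃ v, ContinuousOn v (Metric.ball x₀ δ) ∧
      u =ᵐ[volume.restrict (Metric.ball x₀ δ)] v := by
  have : IsFiniteMeasure (volume.restrict U) := ⟨by simpa using hfin.lt_top⟩
  exact exists_continuousOn_rep_of_growth hU hu (hg.integrable (by norm_num)) h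
    (fun n x => integral_abs_le_of_memLp_two hg n x) hx₀

/-- Continuous distributional solutions of `Δ u = g` with `g` continuous are of class `C¹`. -/
theorem contDiffOn_one_of_isWeakLapl {U : Set E3} (hU : IsOpen U) {u g : E3 → ℝ}
    (hu : ContinuousOn u U) (hg : ContinuousOn g U) (h : IsWeakLapl U u g) :
    ContDiffOn ℝ 1 u U := by
  intro x₀ hx₀
  obtain ⟨d, hd, hdU⟩ := Metric.isOpen_iff.1 hU x₀ hx₀
  -- A ball with compact closure in `U`, on which `u` is integrable and `g` is bounded.
  set W := Metric.ball x₀ (d / 2) with hW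
  have hWc : Metric.closedBall x₀ (d / 2) ⊆ U :=
    (Metric.closedBall_subset_ball (by linarith)).trans hdU
  have hWU : W ⊆ U := Metric.ball_subset_closedBall.trans hWc
  have hWo : IsOpen W := Metric.isOpen_ball
  have hcomp := isCompact_closedBall x₀ (d / 2)
  have hui : IntegrableOn u W :=
    ((hu.mono hWc).integrableOn_compact hcomp).mono_set Metric.ball_subset_closedBall
  have hgi : IntegrableOn g W :=
    ((hg.mono hWc).integrableOn_compact hcomp).mono_set Metric.ball_subset_closedBall
  obtain ⟨M, hM⟩ := hcomp.exists_bound_of_continuousOn (hg.mono hWc)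
  have hM0 : 0 ≤ M := (norm_nonneg _).trans (hM x₀ (Metric.mem_closedBall_self (by linarith)))
  have hw := h.mono hWU
  have hx₀W : x₀ ∈ W := Metric.mem_ball_self (by linarith)
  obtain ⟨δ, hδ, hδW, N, hN⟩ := exists_ball_and_scale hWo hx₀W
  obtain ⟨C, hC0, hC1, hC2⟩ := exists_bound_jker
  set v1 := volume.real (Metric.ball (0 : E3) 1)
  -- For bounded `g` the mass in a ball is `O(8⁻ⁿ)`. This beats the `4ⁿ` of the gradient of `jker n`
  -- by a factor `2⁻ⁿ`, so the gradients converge uniformly as well.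
  have hgrow : ∀ (n : ℕ) x, ∫ y in W ∩ Metric.closedBall x ((1 / 2 : ℝ) ^ n), |g y|
      ≤ M * ((1 / 2 : ℝ) ^ n) ^ 3 * v1 := by
    intro n x
    have hfin : volume (Metric.closedBall x ((1 / 2 : ℝ) ^ n)) ≠ ⊤ :=
      Metric.isBounded_closedBall.measure_lt_top.ne
    have h1 := norm_setIntegral_le_of_norm_le_const (μ := volume)
      (s := W ∩ Metric.closedBall x ((1 / 2 : ℝ) ^ n)) (f := fun y => |g y|) (C := M)
      (measure_lt_top_of_subset Set.inter_subset_right hfin)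
      (fun y hy => by
        rw [Real.norm_eq_abs, abs_abs]; exact hM y (Metric.ball_subset_closedBall hy.1))
    refine (le_abs_self _).trans (h1.trans ?_)
    rw [mul_assoc, ← volume_real_closedBall x (by positivity)]
    exact mul_le_mul_of_nonneg_left (measureReal_mono Set.inter_subset_right hfin) hM0
  have hrs : ∀ n, ContDiff ℝ ∞ (smear W u (rho n)) := fun n =>
    contDiff_smear hWo.measurableSet hui (contDiff_rho n)
      (hasCompactSupport_of_support_subset (support_rho n))
  have hjs : ∀ n, ContDiff ℝ ∞ (smear W g (jker n)) := fun n =>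
    contDiff_smear hWo.measurableSet hgi (contDiff_jker n)
      (hasCompactSupport_of_support_subset (support_jker n))
  have hpow : ∀ n : ℕ, (4 : ℝ) ^ n * ((1 / 2 : ℝ) ^ n) ^ 3 = (1 / 2) ^ n := fun n => by
    rw [← pow_mul, mul_comm n 3, pow_mul, ← mul_pow]; norm_num
  have hpow2 : ∀ n : ℕ, (2 : ℝ) ^ n * ((1 / 2 : ℝ) ^ n) ^ 3 ≤ (1 / 2) ^ n := fun n => by
    calc (2 : ℝ) ^ n * ((1 / 2 : ℝ) ^ n) ^ 3 ≤ (4 : ℝ) ^ n * ((1 / 2 : ℝ) ^ n) ^ 3 := by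
          gcongr; norm_num
      _ = (1 / 2) ^ n := hpow n
  obtain ⟨v, hv⟩ := exists_tendstoUniformlyOn_of_geometric (α := E3) (X := ℝ)
    (f := fun n => smear W u (rho (n + N))) (S := Metric.ball x₀ δ)
    (C := C * M * v1 * (1 / 2) ^ N) (q := 1 / 2) (by norm_num) (by norm_num) (fun n x hx => by
      rw [Real.dist_eq, show n + 1 + N = n + N + 1 by ring,
        smear_rho_sub hui hw (hN (n + N) (Nat.le_add_left _ _) x hx)]
      refine (abs_smear_le hgi (hC1 (n + N)) (support_jker (n + N)) x).trans ?_
      refine (mul_le_mul_of_nonneg_left (hgrow (n + N) x) (by positivity)).trans ?_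
      have hv1 : 0 ≤ v1 := measureReal_nonneg
      calc C * 2 ^ (n + N) * (M * ((1 / 2) ^ (n + N)) ^ 3 * v1)
          = C * M * v1 * (2 ^ (n + N) * ((1 / 2) ^ (n + N)) ^ 3) := by ring
        _ ≤ C * M * v1 * (1 / 2) ^ (n + N) := by gcongr; exact hpow2 _
        _ = C * M * v1 * (1 / 2) ^ N * (1 / 2) ^ n := by rw [pow_add]; ring)
  obtain ⟨v', hv'⟩ := exists_tendstoUniformlyOn_of_geometric (α := E3) (X := E3 →L[ℝ] ℝ)
    (f := fun n => fderiv ℝ (smear W u (rho (n + N)))) (S := Metric.ball x₀ δ)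
    (C := 3 * (C * M * v1 * (1 / 2) ^ N)) (q := 1 / 2) (by norm_num) (by norm_num)
    (fun n x hx => by
      have e1 : fderiv ℝ (smear W u (rho (n + N))) x - fderiv ℝ (smear W u (rho (n + 1 + N))) x
          = fderiv ℝ (smear W g (jker (n + N))) x := by
        rw [← fderiv_sub ((hrs _).differentiable (by simp) x) ((hrs _).differentiable (by simp) x)]
        refine Filter.EventuallyEq.fderiv_eq ?_
        filter_upwards [Metric.isOpen_ball.mem_nhds hx] with y hy
        rw [Pi.sub_apply, show n + 1 + N = n + N + 1 by ring]
        exact smear_rho_sub hui hw (hN (n + N) (Nat.le_add_left _ _) y hy)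
      rw [dist_eq_norm, e1]
      refine (norm_fderiv_le_sum_pd _ _).trans ?_
      have hb : ∀ k, |pd k (smear W g (jker (n + N))) x| ≤
          C * M * v1 * (1 / 2) ^ N * (1 / 2) ^ n := fun k => by
        rw [pd_smear hWo.measurableSet hgi (contDiff_jker _)
          (hasCompactSupport_of_support_subset (support_jker _))]
        refine (abs_smear_le hgi (hC2 (n + N) k) (r := (1 / 2 : ℝ) ^ (n + N)) ?_ x).trans ?_
        · exact (subset_tsupport _).trans ((tsupport_pd_subset k _).trans
            (closure_minimal (support_jker (n + N)) Metric.isClosed_closedBall))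
        · refine (mul_le_mul_of_nonneg_left (hgrow (n + N) x) (by positivity)).trans (le_of_eq ?_)
          calc C * 4 ^ (n + N) * (M * ((1 / 2) ^ (n + N)) ^ 3 * v1)
              = C * M * v1 * (4 ^ (n + N) * ((1 / 2) ^ (n + N)) ^ 3) := by ring
            _ = C * M * v1 * (1 / 2) ^ N * (1 / 2) ^ n := by rw [hpow, pow_add]; ring
      refine (Finset.sum_le_sum fun k _ => hb k).trans (le_of_eq ?_)
      simp
      ring)
  have hball : IsOpen (Metric.ball x₀ δ) := Metric.isOpen_ball
  have hderiv : ∀ x ∈ Metric.ball x₀ δ, HasFDerivAt v (v' x) x := fun x hx =>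
    hasFDerivAt_of_tendstoUniformlyOn hball hv'
      (fun n y _ => ((hrs _).differentiable (by simp) y).hasFDerivAt)
      (fun y hy => hv.tendsto_at hy) hx
  have hv'c : ContinuousOn v' (Metric.ball x₀ δ) :=
    hv'.continuousOn (Eventually.of_forall fun n =>
      ((hrs _).continuous_fderiv (by simp)).continuousOn).frequently
  have hv1 : ContDiffOn ℝ 1 v (Metric.ball x₀ δ) := by
    rw [show (1 : ℕ∞ω) = 0 + 1 by simp, contDiffOn_succ_iff_fderiv_of_isOpen hball]
    refine ⟨fun x hx => (hderiv x hx).differentiableAt.differentiableWithinAt, by simp, ?_⟩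
    rw [contDiffOn_zero]
    exact hv'c.congr fun x hx => (hderiv x hx).fderiv
  have hae := ae_eq_of_tendstoUniformlyOn hWo.measurableSet hball hδW hui hv
  -- Two continuous functions that agree almost everywhere on an open set agree everywhere, so `u`
  -- itself is `C¹`.
  have heq : Set.EqOn u (fun x => (∫ x, newtonLapl x)⁻¹ * v x) (Metric.ball x₀ δ) :=
    Measure.eqOn_open_of_ae_eq hae hball (hu.mono (hδW.trans hWU))
      (continuousOn_const.mul hv1.continuousOn)
  have hfin : ContDiffOn ℝ 1 u (Metric.ball x₀ δ) := (contDiffOn_const.mul hv1).congr heq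
  exact (hfin.contDiffAt (hball.mem_nhds (Metric.mem_ball_self hδ))).contDiffWithinAt

theorem lapl_pd {φ : E3 → ℝ} (hφ : ContDiff ℝ ∞ φ) (i : Fin 3) (x : E3) :
    lapl (pd i φ) x = pd i (lapl φ) x := by
  have h2 : (2 : ℕ∞ω) ≤ ((⊤ : ℕ∞) : ℕ∞ω) := WithTop.coe_le_coe.2 (le_top : (2 : ℕ∞) ≤ ⊤)
  unfold lapl
  rw [pd_sum fun k _ => (contDiff_pd (contDiff_pd hφ)).differentiable (by simp) x]
  refine Finset.sum_congr rfl fun k _ => ?_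
  rw [show pd k (pd i φ) = pd i (pd k φ) from
    funext fun y => pd_comm (hφ.of_le h2).contDiffAt]
  exact pd_comm ((contDiff_pd hφ).of_le h2).contDiffAt

theorem contDiffOn_succ_of_pd {U : Set E3} (hU : IsOpen U) {u : E3 → ℝ} {n : ℕ}
    (hu : DifferentiableOn ℝ u U) (h : ∀ k, ContDiffOn ℝ n (pd k u) U) :
    ContDiffOn ℝ (n + 1) u U := by
  rw [contDiffOn_succ_iff_fderiv_of_isOpen hU]
  refine ⟨hu, by simp, ?_⟩
  rw [contDiffOn_clm_apply]
  intro y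
  have : (fun x => fderiv ℝ u x y) = fun x => ∑ k, y k * pd k u x := by
    ext x
    have hy : y = ∑ k, y k • ek k := by
      ext i; simp [Finset.sum_apply, Pi.single_apply]
    conv_lhs => rw [hy]
    rw [map_sum]; simp [pd]
  rw [this]
  exact ContDiffOn.sum fun k _ => contDiffOn_const.mul (h k)

/-- Testing the equation with `∂ᵢ φ` and integrating by parts differentiates it. -/
theorem IsWeakLapl.pd {U : Set E3} (hU : IsOpen U) {u g : E3 → ℝ} (hu : ContDiffOn ℝ 1 u U)
    (hg : ContDiffOn ℝ 1 g U) (h : IsWeakLapl U u g) (i : Fin 3) :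
    IsWeakLapl U (LandauDeGennes.pd i u) (LandauDeGennes.pd i g) := fun φ hφ => by
  have h1 := integral_mul_pd hU hu hφ.lapl i
  have h2 := integral_mul_pd hU hg hφ i
  have h3 := h _ (hφ.pd i)
  simp only [lapl_pd hφ.1] at h3
  linarith

/-- Induction on `n`, applying the statement to the first derivatives. Only one derivative is
gained, short of the optimal two, but one is enough for a bootstrap. -/
theorem contDiffOn_succ_of_isWeakLapl {U : Set E3} (hU : IsOpen U) (n : ℕ) :
    ∀ {u g : E3 → ℝ}, ContinuousOn u U → ContDiffOn ℝ n g U → IsWeakLapl U u g →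
      ContDiffOn ℝ (n + 1) u U := by
  induction n with
  | zero =>
    intro u g hu hg h
    simpa using contDiffOn_one_of_isWeakLapl hU hu hg.continuousOn h
  | succ n ih =>
    intro u g hu hg h
    have hu1 := contDiffOn_one_of_isWeakLapl hU hu hg.continuousOn h
    have hg1 : ContDiffOn ℝ 1 g U := hg.of_le (by push_cast; exact le_add_self)
    refine contDiffOn_succ_of_pd hU (hu1.differentiableOn (by simp)) fun k => ?_
    push_cast
    exact ih (contDiffOn_pd (m := 0) hU hu1 (by simp)).continuousOn
      (contDiffOn_pd hU hg (by push_cast; rfl)) (h.pd hU hu1 hg1 k)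

/-- The equation holds classically for functions of class `C²`. -/
theorem IsWeakLapl.lapl_eq {U : Set E3} (hU : IsOpen U) {u g : E3 → ℝ} (hu : ContDiffOn ℝ 2 u U)
    (hg : ContinuousOn g U) (h : IsWeakLapl U u g) {x : E3} (hx : x ∈ U) : lapl u x = g x := by
  have hpd : ∀ k, ContDiffOn ℝ 1 (LandauDeGennes.pd k u) U := fun k =>
    contDiffOn_pd hU hu (by norm_num)
  have hlc : ContinuousOn (lapl u) U := continuousOn_finsetSum _ fun k _ =>
    (contDiffOn_pd (m := 0) hU (hpd k) (by simp)).continuousOn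
  have hae : lapl u =ᵐ[volume.restrict U] g := by
    refine ae_eq_of_forall_integral_eq hU (hlc.locallyIntegrableOn hU.measurableSet)
      (hg.locallyIntegrableOn hU.measurableSet) fun φ hφ => ?_
    rw [← h φ hφ]
    simp only [lapl, Finset.sum_mul, Finset.mul_sum]
    rw [integral_finsetSum, integral_finsetSum]
    · refine Finset.sum_congr rfl fun k _ => ?_
      have h1 := integral_mul_pd hU (hu.of_le (by norm_num)) (hφ.pd k) k
      have h2 := integral_mul_pd hU (hpd k) hφ k
      linarith
    · exact fun k _ => (((hφ.pd k).pd k).integrable_mul_of_continuousOn hU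
        hu.continuousOn).integrableOn
    · exact fun k _ => (hφ.integrable_mul_of_continuousOn hU
        (contDiffOn_pd (m := 0) hU (hpd k) (by simp)).continuousOn).integrableOn
  exact Measure.eqOn_open_of_ae_eq hae hU hlc hg hx

/-- Local representatives of class `Cⁿ` can be glued. -/
theorem exists_contDiffOn_rep_of_local {U : Set E3} (hU : IsOpen U) {X : Type*}
    [NormedAddCommGroup X] [NormedSpace ℝ X] {f : E3 → X} {n : ℕ∞ω}
    (h : ∀ x₀ ∈ U, ∃ δ > 0, Metric.ball x₀ δ ⊆ U ∧ ∃ v, ContDiffOn ℝ n v (Metric.ball x₀ δ) ∧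
      f =ᵐ[volume.restrict (Metric.ball x₀ δ)] v) :
    ∃ F : E3 → X, ContDiffOn ℝ n F U ∧ f =ᵐ[volume.restrict U] F := by
  choose! δ hδ hδU v hv hfv using h
  have hopen : ∀ x, IsOpen (Metric.ball x (δ x)) := fun x => Metric.isOpen_ball
  -- The glued function takes at `y` the value of the representative centred at `y`. On overlaps the
  -- continuous representatives agree because both equal `f` almost everywhere.
  have key : ∀ x ∈ U, Set.EqOn (fun y => v y y) (v x) (Metric.ball x (δ x)) := by
    intro x hx y hy
    have hyU := hδU x hx hy
    have hae : v y =ᵐ[volume.restrict (Metric.ball x (δ x) ∩ Metric.ball y (δ y))] v x := by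
      have h1 := ae_restrict_of_ae_restrict_of_subset
        (Set.inter_subset_left (t := Metric.ball y (δ y))) (hfv x hx)
      have h2 := ae_restrict_of_ae_restrict_of_subset
        (Set.inter_subset_right (s := Metric.ball x (δ x))) (hfv y hyU)
      filter_upwards [h1, h2] with z hz1 hz2
      rw [← hz1, ← hz2]
    exact Measure.eqOn_open_of_ae_eq hae ((hopen x).inter (hopen y))
      ((hv y hyU).continuousOn.mono Set.inter_subset_right)
      ((hv x hx).continuousOn.mono Set.inter_subset_left) ⟨hy, Metric.mem_ball_self (hδ y hyU)⟩
  refine ⟨fun y => v y y, fun x hx => ?_, ?_⟩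
  · have h1 : ContDiffOn ℝ n (fun y => v y y) (Metric.ball x (δ x)) := (hv x hx).congr (key x hx)
    exact (h1.contDiffAt ((hopen x).mem_nhds (Metric.mem_ball_self (hδ x hx)))).contDiffWithinAt
  · rw [EventuallyEq, ae_restrict_iff' hU.measurableSet, ae_iff]
    refine measure_null_of_locally_null _ fun x hx => ?_
    have hxU : x ∈ U := by
      by_contra h
      exact hx fun h' => absurd h' h
    refine ⟨_, inter_mem_nhdsWithin _ ((hopen x).mem_nhds (Metric.mem_ball_self (hδ x hxU))), ?_⟩
    have h1 := hfv x hxU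
    rw [EventuallyEq, ae_restrict_iff' (hopen x).measurableSet, ae_iff] at h1
    refine measure_mono_null (fun y hy => ?_) h1
    intro h2
    refine hy.1 fun _ => ?_
    rw [h2 hy.2]
    exact (key x hxU hy.2).symm

/-! ### Sobolev embedding and integrability of products -/

/-- Gagliardo-Nirenberg-Sobolev with `1/6 = 1/2 - 1/3`. The constant does not depend on the
supports, so the bound survives limits of test functions. -/
theorem exists_eLpNorm_six_le : ∃ S : ℝ≥0∞, S ≠ ⊤ ∧ ∀ (Ω : Set E3) (φ : E3 → ℝ),
    IsTestFunction Ω φ →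
    eLpNorm φ 6 (volume.restrict Ω) ≤ S * ∑ k, eLpNorm (pd k φ) 2 (volume.restrict Ω) := by
  refine ⟨SNormLESNormFDerivOfEqConst ℝ (volume : Measure E3) 2, by simp, fun Ω φ hφ => ?_⟩
  have h := eLpNorm_le_eLpNorm_fderiv_of_eq (F := ℝ) (μ := (volume : Measure E3)) (u := φ)
    (hφ.1.of_le (by simp)) hφ.2.1 (p := 2) (p' := 6) (by norm_num) (by simp)
    (by simp; norm_num)
  refine (eLpNorm_mono_measure _ Measure.restrict_le_self).trans (h.trans ?_)
  refine mul_le_mul_right ?_ _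
  have h1 : eLpNorm (fderiv ℝ φ) 2 (volume : Measure E3)
      ≤ eLpNorm (fun x => ∑ k, |pd k φ x|) 2 volume :=
    eLpNorm_mono_real fun x => norm_fderiv_le_sum_pd φ x
  refine h1.trans ?_
  have h2 := eLpNorm_sum_le (μ := (volume : Measure E3)) (p := 2) (s := Finset.univ)
    (f := fun k x => |pd k φ x|) (fun k _ => (hφ.pd k).continuous.abs.aestronglyMeasurable)
    (by norm_num)
  rw [show (∑ k, fun x => |pd k φ x|) = fun x => ∑ k, |pd k φ x| by ext x; simp] at h2
  refine h2.trans (Finset.sum_le_sum fun k _ => ?_)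
  have h3 := eLpNorm_norm (p := 2) (μ := (volume : Measure E3)) (pd k φ)
  simp only [Real.norm_eq_abs] at h3
  rw [h3, eLpNorm_restrict_eq_of_support_subset]
  exact (subset_tsupport _).trans (hφ.pd k).2.2

/-- `W₀^{1,2} ⊆ L⁶` in dimension three. -/
theorem MemW12Zero.memLp_six {Ω : Set E3} {u : E3 → ℝ} (hu : MemW12Zero Ω u) :
    MemLp u 6 (volume.restrict Ω) := by
  set μ := volume.restrict Ω
  obtain ⟨S, hS, hSφ⟩ := exists_eLpNorm_six_le
  choose φ hφ h0 h1 using fun n : ℕ => hu.2 (1 / (n + 1 : ℝ)) (by positivity)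
  let C : ℝ≥0∞ := S * ∑ k, (eLpNorm (weakPartial Ω k u) 2 μ + 1)
  have hC : C ≠ ⊤ := by
    refine ENNReal.mul_ne_top hS (ENNReal.sum_lt_top.2 fun k _ => ?_).ne
    exact ENNReal.add_lt_top.2 ⟨(hu.1.isWeakPartial k).1.2, by simp⟩
  have hb : ∀ n, eLpNorm (φ n) 6 μ ≤ C := by
    intro n
    refine (hSφ Ω _ (hφ n)).trans (mul_le_mul_right (Finset.sum_le_sum fun k _ => ?_) _)
    have e : pd k (φ n) = weakPartial Ω k u - fun x => weakPartial Ω k u x - pd k (φ n) x := by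
      ext x; simp
    rw [e]
    refine (eLpNorm_sub_le (hu.1.isWeakPartial k).1.1 ((hu.1.isWeakPartial k).1.1.sub
      ((hφ n).pd k).continuous.aestronglyMeasurable) (by norm_num)).trans ?_
    refine add_le_add le_rfl ((h1 n k).trans ?_)
    rw [← ENNReal.ofReal_one]
    refine ENNReal.ofReal_le_ofReal ?_
    rw [div_le_one (by positivity)]
    linarith [(Nat.cast_nonneg n : (0 : ℝ) ≤ n)]
  have hlim : Tendsto (fun n => eLpNorm (φ n - u) 2 μ) atTop (𝓝 0) := by
    have h2 : Tendsto (fun n : ℕ => ENNReal.ofReal (1 / (n + 1 : ℝ))) atTop (𝓝 0) := by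
      have := ENNReal.tendsto_ofReal (tendsto_one_div_add_atTop_nhds_zero_nat (𝕜 := ℝ))
      simpa using this
    refine tendsto_of_tendsto_of_tendsto_of_le_of_le tendsto_const_nhds h2 (fun n => bot_le)
      fun n => ?_
    rw [eLpNorm_sub_comm]
    exact h0 n
  -- A subsequence converges almost everywhere, and Fatou's lemma carries the uniform `L⁶` bound to
  -- the limit.
  have hmeas : TendstoInMeasure μ φ atTop u :=
    tendstoInMeasure_of_tendsto_eLpNorm (by norm_num)
      (fun n => (hφ n).continuous.aestronglyMeasurable) hu.1.1.1 hlim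
  obtain ⟨ns, -, hns⟩ := hmeas.exists_seq_tendsto_ae
  refine ⟨hu.1.1.1, ?_⟩
  have := Lp.eLpNorm_lim_le_liminf_eLpNorm (p := 6) (f := fun n => φ (ns n))
    (fun n => (hφ _).continuous.aestronglyMeasurable) u hns
  refine (this.trans (liminf_le_of_le ⟨0, by simp⟩ fun b hb' => ?_)).trans_lt hC.lt_top
  obtain ⟨n, hn⟩ := hb'.exists
  exact hn.trans (hb _)

section products

variable {α : Type*} [MeasurableSpace α] {μ : Measure α} [IsFiniteMeasure μ] {f g h l : α → ℝ}

/-- Hölder with `1/6 + 1/6 + 1/6 = 1/2`. Cubic expressions in an `L⁶` tensor are in `L²`, as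
`exists_continuousOn_rep` requires. -/
theorem memLp_two_mul_mul (hf : MemLp f 6 μ) (hg : MemLp g 6 μ) (hh : MemLp h 6 μ) :
    MemLp (fun x => f x * g x * h x) 2 μ := by
  have h1 : ENNReal.HolderTriple 6 6 3 := ⟨by
    rw [← ENNReal.toReal_eq_toReal_iff' (by simp) (by simp), ENNReal.toReal_add (by simp) (by simp)]
    simp; norm_num⟩
  have h2 : ENNReal.HolderTriple 3 6 2 := ⟨by
    rw [← ENNReal.toReal_eq_toReal_iff' (by simp) (by simp), ENNReal.toReal_add (by simp) (by simp)]
    simp; norm_num⟩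
  have e1 : MemLp (fun x => f x * g x) 3 μ := MemLp.mul (p := 6) (q := 6) hg hf
  exact MemLp.mul (p := 3) (q := 6) hh e1

theorem memLp_two_mul (hf : MemLp f 6 μ) (hg : MemLp g 6 μ) :
    MemLp (fun x => f x * g x) 2 μ := by
  simpa using memLp_two_mul_mul hf hg (memLp_const (1 : ℝ))

theorem memLp_two_of_six (hf : MemLp f 6 μ) : MemLp f 2 μ := hf.mono_exponent (by norm_num)

end products

/-! ### The energy along affine perturbations -/

/-- The energy of a tensor field with given weak derivatives. -/
theorem energy_eq_ofReal {Ω : Set E3} (hΩ : IsOpen Ω) {a b c C L : ℝ} (hL : 0 < L)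
    (hC : ∀ M : M3, IsQTensor M → 0 ≤ bulk a b c C M) {P : E3 → M3}
    {D : Fin 3 → Fin 3 → Fin 3 → E3 → ℝ}
    (hD : ∀ i j k, IsWeakPartial Ω k (fun x => P x i j) (D i j k))
    (hP : ∀ᵐ x ∂(volume.restrict Ω), IsQTensor (P x))
    (hb : IntegrableOn (fun x => bulk a b c C (P x)) Ω) :
    IntegrableOn (fun x => 1 / 2 * ∑ i, ∑ j, ∑ k, D i j k x ^ 2 + bulk a b c C (P x) / L) Ω ∧
    (∀ᵐ x ∂(volume.restrict Ω),
      0 ≤ 1 / 2 * ∑ i, ∑ j, ∑ k, D i j k x ^ 2 + bulk a b c C (P x) / L) ∧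
    energy Ω a b c C L P = ENNReal.ofReal
      (∫ x in Ω, (1 / 2 * ∑ i, ∑ j, ∑ k, D i j k x ^ 2 + bulk a b c C (P x) / L)) := by
  have hint : IntegrableOn
      (fun x => 1 / 2 * ∑ i, ∑ j, ∑ k, D i j k x ^ 2 + bulk a b c C (P x) / L) Ω := by
    refine Integrable.add (Integrable.const_mul ?_ _) (hb.div_const L)
    exact integrable_finsetSum _ fun i _ => integrable_finsetSum _ fun j _ =>
      integrable_finsetSum _ fun k _ => (hD i j k).1.integrable_sq
  have hpos : ∀ᵐ x ∂(volume.restrict Ω),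
      0 ≤ 1 / 2 * ∑ i, ∑ j, ∑ k, D i j k x ^ 2 + bulk a b c C (P x) / L := by
    filter_upwards [hP] with x hx
    have h1 := hC _ hx
    have h2 : 0 ≤ ∑ i, ∑ j, ∑ k, D i j k x ^ 2 := Finset.sum_nonneg fun i _ =>
      Finset.sum_nonneg fun j _ => Finset.sum_nonneg fun k _ => sq_nonneg _
    positivity
  refine ⟨hint, hpos, ?_⟩
  rw [ofReal_integral_eq_lintegral_ofReal hint hpos, energy]
  refine lintegral_congr_ae ?_
  have hall : ∀ᵐ x ∂(volume.restrict Ω), ∀ i j k,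
      weakPartial Ω k (fun y => P y i j) x = D i j k x :=
    ae_all_iff.2 fun i => ae_all_iff.2 fun j => ae_all_iff.2 fun k =>
      (hD i j k).weakPartial_ae_eq hΩ
  filter_upwards [hall] with x hx
  simp only [hx]

/-- The differential of the bulk energy density at `M` in the direction `H`. -/
noncomputable def bulkDeriv (a b c : ℝ) (M H : M3) : ℝ :=
  -a ^ 2 * (M * H).trace - b ^ 2 * (M * M * H).trace + c ^ 2 * (M * M).trace * (M * H).trace

/-- The second-order coefficient of the bulk energy density. -/
noncomputable def bulkCoeffTwo (a b c : ℝ) (M H : M3) : ℝ :=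
  -(a ^ 2 / 2) * (H * H).trace - b ^ 2 * (M * H * H).trace
    + c ^ 2 / 4 * (4 * (M * H).trace ^ 2 + 2 * (M * M).trace * (H * H).trace)

/-- The third-order coefficient of the bulk energy density. -/
noncomputable def bulkCoeffThree (b c : ℝ) (M H : M3) : ℝ :=
  -(b ^ 2 / 3) * (H * H * H).trace + c ^ 2 * (M * H).trace * (H * H).trace

/-- The bulk energy is a quartic polynomial, so the expansion is exact. The first variation then
needs only integrability of the coefficients and no differentiation under the integral. -/
theorem bulk_add_smul (a b c C τ : ℝ) (M H : M3) :
    bulk a b c C (M + τ • H) = bulk a b c C M + τ * bulkDeriv a b c M H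
      + τ ^ 2 * bulkCoeffTwo a b c M H + τ ^ 3 * bulkCoeffThree b c M H
      + τ ^ 4 * (c ^ 2 / 4 * (H * H).trace ^ 2) := by
  have h2 : ((M + τ • H) * (M + τ • H)).trace
      = (M * M).trace + 2 * τ * (M * H).trace + τ ^ 2 * (H * H).trace := by
    simp only [Matrix.trace, Matrix.diag, Matrix.mul_apply, Fin.sum_univ_three, Matrix.add_apply,
      Matrix.smul_apply, smul_eq_mul]
    ring
  have h3 : ((M + τ • H) * (M + τ • H) * (M + τ • H)).trace = (M * M * M).trace
      + 3 * τ * (M * M * H).trace + 3 * τ ^ 2 * (M * H * H).trace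
      + τ ^ 3 * (H * H * H).trace := by
    simp only [Matrix.trace, Matrix.diag, Matrix.mul_apply, Fin.sum_univ_three, Matrix.add_apply,
      Matrix.smul_apply, smul_eq_mul]
    ring
  unfold bulk bulkDeriv bulkCoeffTwo bulkCoeffThree
  rw [h2, h3]
  ring

section integrability

variable {α : Type*} [MeasurableSpace α] {μ : Measure α} [IsFiniteMeasure μ] {Q : α → M3}

theorem memLp_trace_mul (hQ : ∀ i j, MemLp (fun x => Q x i j) 6 μ) (H : M3) :
    MemLp (fun x => (Q x * H).trace) 6 μ := by
  simp only [Matrix.trace, Matrix.diag, Matrix.mul_apply]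
  exact memLp_finsetSum _ fun i _ => memLp_finsetSum _ fun j _ => (hQ i j).mul_const _

theorem memLp_trace_mul_self (hQ : ∀ i j, MemLp (fun x => Q x i j) 6 μ) :
    MemLp (fun x => (Q x * Q x).trace) 2 μ := by
  simp only [Matrix.trace, Matrix.diag, Matrix.mul_apply]
  exact memLp_finsetSum _ fun i _ => memLp_finsetSum _ fun j _ => memLp_two_mul (hQ i j) (hQ j i)

theorem memLp_trace_mul_self_mul (hQ : ∀ i j, MemLp (fun x => Q x i j) 6 μ) {f : α → ℝ}
    (hf : MemLp f 6 μ) : MemLp (fun x => (Q x * Q x).trace * f x) 2 μ := by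
  simp only [Matrix.trace, Matrix.diag, Matrix.mul_apply, Finset.sum_mul]
  exact memLp_finsetSum _ fun i _ => memLp_finsetSum _ fun j _ =>
    memLp_two_mul_mul (hQ i j) (hQ j i) hf

theorem memLp_trace_sq_mul (hQ : ∀ i j, MemLp (fun x => Q x i j) 6 μ) (H : M3) :
    MemLp (fun x => (Q x * Q x * H).trace) 2 μ := by
  simp only [Matrix.trace, Matrix.diag, Matrix.mul_apply]
  exact memLp_finsetSum _ fun i _ => memLp_finsetSum _ fun j _ =>
    (memLp_finsetSum _ fun k _ => memLp_two_mul (hQ i k) (hQ k j)).mul_const _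

theorem memLp_trace_cube (hQ : ∀ i j, MemLp (fun x => Q x i j) 6 μ) :
    MemLp (fun x => (Q x * Q x * Q x).trace) 2 μ := by
  simp only [Matrix.trace, Matrix.diag, Matrix.mul_apply, Finset.sum_mul]
  exact memLp_finsetSum _ fun i _ => memLp_finsetSum _ fun j _ =>
    memLp_finsetSum _ fun k _ => memLp_two_mul_mul (hQ i k) (hQ k j) (hQ j i)

theorem memLp_bulkDeriv (hQ : ∀ i j, MemLp (fun x => Q x i j) 6 μ) (a b c : ℝ) (H : M3) :
    MemLp (fun x => bulkDeriv a b c (Q x) H) 2 μ := by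
  unfold bulkDeriv
  refine (((memLp_two_of_six (memLp_trace_mul hQ H)).const_mul _).sub
    ((memLp_trace_sq_mul hQ H).const_mul _)).add ?_
  simp only [mul_assoc]
  simpa only [mul_assoc] using (memLp_trace_mul_self_mul hQ (memLp_trace_mul hQ H)).const_mul (c ^ 2)

theorem integrable_bulk (hQ : ∀ i j, MemLp (fun x => Q x i j) 6 μ) (a b c C : ℝ) :
    Integrable (fun x => bulk a b c C (Q x)) μ := by
  unfold bulk
  refine (((Integrable.const_mul ?_ _).sub (Integrable.const_mul ?_ _)).add
    (Integrable.const_mul ?_ _)).add (integrable_const C)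
  · exact (memLp_trace_mul_self hQ).integrable (by norm_num)
  · exact (memLp_trace_cube hQ).integrable (by norm_num)
  · exact (memLp_trace_mul_self hQ).integrable_sq

theorem integrable_bulkCoeffTwo (hQ : ∀ i j, MemLp (fun x => Q x i j) 6 μ) (a b c : ℝ) (H : M3) :
    Integrable (fun x => bulkCoeffTwo a b c (Q x) H) μ := by
  unfold bulkCoeffTwo
  refine ((integrable_const _).sub (Integrable.const_mul ?_ _)).add
    (Integrable.const_mul ((Integrable.const_mul ?_ _).add
      ((Integrable.const_mul ?_ _).mul_const _)) _)
  · simp only [Matrix.mul_assoc]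
    exact (memLp_trace_mul hQ (H * H)).integrable (by norm_num)
  · exact (memLp_two_of_six (memLp_trace_mul hQ H)).integrable_sq
  · exact (memLp_trace_mul_self hQ).integrable (by norm_num)

theorem integrable_bulkCoeffThree (hQ : ∀ i j, MemLp (fun x => Q x i j) 6 μ) (b c : ℝ) (H : M3) :
    Integrable (fun x => bulkCoeffThree b c (Q x) H) μ := by
  unfold bulkCoeffThree
  exact (integrable_const _).add
    ((((memLp_trace_mul hQ H).integrable (by norm_num)).const_mul _).mul_const _)

end integrability

/-- The polynomial has a minimum at `0`, and `e1` is its derivative there. -/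
theorem eq_zero_of_forall_quartic_nonneg {e1 e2 e3 e4 : ℝ}
    (h : ∀ t : ℝ, 0 ≤ t * e1 + t ^ 2 * e2 + t ^ 3 * e3 + t ^ 4 * e4) : e1 = 0 := by
  have hd : HasDerivAt (fun t : ℝ => t * e1 + t ^ 2 * e2 + t ^ 3 * e3 + t ^ 4 * e4) e1 0 := by
    have := ((((hasDerivAt_id (0 : ℝ)).mul_const e1).add
      ((hasDerivAt_pow 2 (0 : ℝ)).mul_const e2)).add
      ((hasDerivAt_pow 3 (0 : ℝ)).mul_const e3)).add ((hasDerivAt_pow 4 (0 : ℝ)).mul_const e4)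
    refine this.congr_deriv ?_
    simp
  have hmin : IsLocalMin (fun t : ℝ => t * e1 + t ^ 2 * e2 + t ^ 3 * e3 + t ^ 4 * e4) 0 :=
    Eventually.of_forall fun t => by simpa using h t
  exact hmin.hasDerivAt_eq_zero hd

theorem IsQTensor.add_smul {M H : M3} (hM : IsQTensor M) (hH : IsQTensor H) (τ : ℝ) :
    IsQTensor (M + τ • H) := by
  refine ⟨?_, ?_⟩
  · rw [Matrix.transpose_add, Matrix.transpose_smul, hM.1, hH.1]
  · rw [Matrix.trace_add, Matrix.trace_smul, hM.2, hH.2]; simp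

/-- The Euler-Lagrange equation in weak form. -/
theorem IsGlobalMinimizer.isWeakLapl {Ω : Set E3} (hΩ : IsOpen Ω) (hfin : volume Ω ≠ ⊤)
    {a b c C L : ℝ} (hL : 0 < L) (hC : ∀ M : M3, IsQTensor M → 0 ≤ bulk a b c C M)
    {nb : E3 → E3} {Q : E3 → M3} (hQ : IsGlobalMinimizer Ω a b c C L nb Q)
    (hQ6 : ∀ i j, MemLp (fun x => Q x i j) 6 (volume.restrict Ω)) {H : M3} (hH : IsQTensor H) :
    IsWeakLapl Ω (fun x => ∑ i, ∑ j, H i j * Q x i j)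
      (fun x => bulkDeriv a b c (Q x) H / L) := by
  intro φ hφ
  set μ := volume.restrict Ω with hμ
  have : IsFiniteMeasure μ := ⟨by simpa [hμ] using hfin.lt_top⟩
  obtain ⟨⟨hQW, hQT, hQ0⟩, hmin⟩ := hQ
  set D : Fin 3 → Fin 3 → Fin 3 → E3 → ℝ := fun i j k => weakPartial Ω k fun x => Q x i j with hD
  have hDw : ∀ i j k, IsWeakPartial Ω k (fun x => Q x i j) (D i j k) := fun i j k =>
    (hQW i j).isWeakPartial k
  obtain ⟨B, hB0, hB⟩ := hφ.exists_bound
  obtain ⟨i0, -, en0⟩ := energy_eq_ofReal hΩ hL hC hDw hQT (integrable_bulk hQ6 a b c C)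
  have hφm : ∀ n : ℕ, AEStronglyMeasurable (fun x => φ x ^ n) μ := fun n =>
    (hφ.continuous.pow n).aestronglyMeasurable
  have hφb : ∀ n : ℕ, ∀ᵐ x ∂μ, ‖φ x ^ n‖ ≤ B ^ n := fun n => Eventually.of_forall fun x => by
    rw [norm_pow]; exact pow_le_pow_left₀ (norm_nonneg _) (hB x) n
  -- `d1` to `d4` are the coefficients of `t, …, t⁴` in the energy density of `Q + t φ H`. The
  -- Euler-Lagrange equation is `∫ d1 = 0`.
  set d1 : E3 → ℝ := fun x => (∑ i, ∑ j, ∑ k, H i j * (D i j k x * pd k φ x))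
    + bulkDeriv a b c (Q x) H * φ x / L with hd1
  set d2 : E3 → ℝ := fun x => 1 / 2 * (∑ i, ∑ j, ∑ k, H i j ^ 2 * (pd k φ x ^ 2))
    + bulkCoeffTwo a b c (Q x) H * φ x ^ 2 / L with hd2
  set d3 : E3 → ℝ := fun x => bulkCoeffThree b c (Q x) H * φ x ^ 3 / L with hd3
  set d4 : E3 → ℝ := fun x => (c ^ 2 / 4 * (H * H).trace ^ 2) * φ x ^ 4 / L with hd4
  have iD : ∀ i j k, Integrable (fun x => D i j k x * pd k φ x) μ := fun i j k =>
    IsWeakPartial.mul_integrable (hDw i j k).1 (hφ.pd k)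
  have ib : Integrable (fun x => bulkDeriv a b c (Q x) H * φ x) μ :=
    IsWeakPartial.mul_integrable (memLp_bulkDeriv hQ6 a b c H) hφ
  have i1 : Integrable d1 μ := by
    refine Integrable.add ?_ (ib.div_const L)
    exact integrable_finsetSum _ fun i _ => integrable_finsetSum _ fun j _ =>
      integrable_finsetSum _ fun k _ => (iD i j k).const_mul _
  have i2 : Integrable d2 μ := by
    refine Integrable.add (Integrable.const_mul ?_ _) (Integrable.div_const ?_ L)
    · exact integrable_finsetSum _ fun i _ => integrable_finsetSum _ fun j _ =>
        integrable_finsetSum _ fun k _ => (((hφ.pd k).memLp 2 μ).integrable_sq).const_mul _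
    · exact (integrable_bulkCoeffTwo hQ6 a b c H).mul_bdd (hφm 2) (hφb 2)
  have i3 : Integrable d3 μ :=
    ((integrable_bulkCoeffThree hQ6 b c H).mul_bdd (hφm 3) (hφb 3)).div_const L
  have i4 : Integrable d4 μ :=
    ((integrable_const _).mul_bdd (hφm 4) (hφb 4)).div_const L
  have key : ∀ t : ℝ, 0 ≤ t * (∫ x, d1 x ∂μ) + t ^ 2 * (∫ x, d2 x ∂μ) + t ^ 3 * (∫ x, d3 x ∂μ)
      + t ^ 4 * ∫ x, d4 x ∂μ := by
    intro t
    -- The direction `H` is a Q-tensor, so the competitor keeps the constraint; `φ` has compact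
    -- support, so it keeps the trace.
    set P : E3 → M3 := fun x => Q x + (t * φ x) • H with hP
    have hPe : ∀ i j, (fun x => P x i j) = fun x => Q x i j + (t * H i j) * φ x := fun i j => by
      ext x
      simp only [hP, Matrix.add_apply, Matrix.smul_apply, smul_eq_mul]
      ring
    have hPw : ∀ i j k, IsWeakPartial Ω k (fun x => P x i j)
        (fun x => D i j k x + (t * H i j) * pd k φ x) := fun i j k => by
      rw [hPe]
      exact (hDw i j k).add (hQW i j).1 ((hφ.const_mul _).memLp 2 _)
        ((hφ.isWeakPartial hΩ k).const_mul _)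
    have hPT : ∀ᵐ x ∂μ, IsQTensor (P x) := by
      filter_upwards [hQT] with x hx using hx.add_smul hH _
    have hPadm : Admissible Ω a b c nb P := by
      refine ⟨fun i j => ⟨?_, fun k => ⟨_, hPw i j k⟩⟩, hPT, fun i j => ?_⟩
      · rw [hPe]
        exact (hQW i j).1.add ((hφ.const_mul _).memLp 2 _)
      · have := (hQ0 i j).add_test hΩ (hφ.const_mul (t * H i j))
        refine this.congr hΩ (Eventually.of_forall fun x => ?_)
        have := congrFun (hPe i j) x
        simp only at this ⊢
        rw [this]; ring
    have hPb : ∀ x, bulk a b c C (P x) = bulk a b c C (Q x) + (t * φ x) * bulkDeriv a b c (Q x) H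
        + (t * φ x) ^ 2 * bulkCoeffTwo a b c (Q x) H + (t * φ x) ^ 3 * bulkCoeffThree b c (Q x) H
        + (t * φ x) ^ 4 * (c ^ 2 / 4 * (H * H).trace ^ 2) := fun x => bulk_add_smul _ _ _ _ _ _ _
    have hPb' : Integrable (fun x => bulk a b c C (P x)) μ := by
      refine integrable_bulk (fun i j => ?_) a b c C
      rw [hPe]
      exact (hQ6 i j).add ((hφ.const_mul _).memLp 6 _)
    obtain ⟨-, pos1, en1⟩ := energy_eq_ofReal hΩ hL hC hPw hPT hPb'
    have hle := hmin P hPadm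
    rw [en0, en1] at hle
    have hle2 := (ENNReal.ofReal_le_ofReal_iff (integral_nonneg_of_ae pos1)).1 hle
    have hexp : (fun x => 1 / 2 * ∑ i, ∑ j, ∑ k, (D i j k x + (t * H i j) * pd k φ x) ^ 2
        + bulk a b c C (P x) / L) = fun x => (1 / 2 * ∑ i, ∑ j, ∑ k, D i j k x ^ 2
        + bulk a b c C (Q x) / L) + (t * d1 x + t ^ 2 * d2 x + t ^ 3 * d3 x + t ^ 4 * d4 x) := by
      ext x
      have hs : ∑ i, ∑ j, ∑ k, (D i j k x + (t * H i j) * pd k φ x) ^ 2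
          = ∑ i, ∑ j, ∑ k, D i j k x ^ 2 + 2 * t * ∑ i, ∑ j, ∑ k, H i j * (D i j k x * pd k φ x)
            + t ^ 2 * ∑ i, ∑ j, ∑ k, H i j ^ 2 * (pd k φ x ^ 2) := by
        simp only [Finset.mul_sum, ← Finset.sum_add_distrib]
        refine Finset.sum_congr rfl fun i _ => Finset.sum_congr rfl fun j _ =>
          Finset.sum_congr rfl fun k _ => ?_
        ring
      rw [hs, hPb x]
      simp only [hd1, hd2, hd3, hd4]
      ring
    have i34 : Integrable (fun x => t ^ 3 * d3 x) μ := i3.const_mul _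
    have j12 : Integrable (fun x => t * d1 x + t ^ 2 * d2 x) μ :=
      (i1.const_mul _).add (i2.const_mul _)
    have j123 : Integrable (fun x => t * d1 x + t ^ 2 * d2 x + t ^ 3 * d3 x) μ := j12.add i34
    have j1234 : Integrable (fun x => t * d1 x + t ^ 2 * d2 x + t ^ 3 * d3 x + t ^ 4 * d4 x) μ :=
      j123.add (i4.const_mul _)
    rw [hexp, integral_add i0 j1234, integral_add j123 (i4.const_mul _), integral_add j12 i34,
      integral_add (i1.const_mul _) (i2.const_mul _), integral_const_mul, integral_const_mul,
      integral_const_mul, integral_const_mul] at hle2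
    linarith
  have hzero := eq_zero_of_forall_quartic_nonneg key
  have e1 : ∫ x, d1 x ∂μ = (∑ i, ∑ j, ∑ k, H i j * ∫ x, D i j k x * pd k φ x ∂μ)
      + (∫ x, bulkDeriv a b c (Q x) H * φ x ∂μ) / L := by
    rw [hd1, integral_add (integrable_finsetSum _ fun i _ => integrable_finsetSum _ fun j _ =>
      integrable_finsetSum _ fun k _ => (iD i j k).const_mul _) (ib.div_const L),
      integral_div, integral_finsetSum _ fun i _ => integrable_finsetSum _ fun j _ =>
      integrable_finsetSum _ fun k _ => (iD i j k).const_mul _]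
    congr 1
    refine Finset.sum_congr rfl fun i _ => ?_
    rw [integral_finsetSum _ fun j _ =>
      integrable_finsetSum _ fun k _ => (iD i j k).const_mul _]
    refine Finset.sum_congr rfl fun j _ => ?_
    rw [integral_finsetSum _ fun k _ => (iD i j k).const_mul _]
    refine Finset.sum_congr rfl fun k _ => ?_
    rw [integral_const_mul]
  -- The remaining derivative is moved to the test function, so the equation takes its
  -- distributional form.
  have e2 : ∀ i j k, ∫ x, D i j k x * pd k φ x ∂μ = - ∫ x, Q x i j * pd k (pd k φ) x ∂μ :=
    fun i j k => by rw [(hDw i j k).2 _ (hφ.pd k), neg_neg]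
  have iq : ∀ i j k, Integrable (fun x => Q x i j * pd k (pd k φ) x) μ := fun i j k =>
    IsWeakPartial.mul_integrable (hQW i j).1 ((hφ.pd k).pd k)
  have e3 : ∫ x in Ω, (∑ i, ∑ j, H i j * Q x i j) * lapl φ x
      = ∑ i, ∑ j, ∑ k, H i j * ∫ x, Q x i j * pd k (pd k φ) x ∂μ := by
    have : (fun x => (∑ i, ∑ j, H i j * Q x i j) * lapl φ x)
        = fun x => ∑ i, ∑ j, ∑ k, H i j * (Q x i j * pd k (pd k φ) x) := by
      ext x
      simp only [lapl, Finset.sum_mul]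
      refine Finset.sum_congr rfl fun i _ => Finset.sum_congr rfl fun j _ => ?_
      rw [Finset.mul_sum]
      exact Finset.sum_congr rfl fun k _ => by ring
    rw [this, integral_finsetSum _ fun i _ => integrable_finsetSum _ fun j _ =>
      integrable_finsetSum _ fun k _ => (iq i j k).const_mul _]
    refine Finset.sum_congr rfl fun i _ => ?_
    rw [integral_finsetSum _ fun j _ =>
      integrable_finsetSum _ fun k _ => (iq i j k).const_mul _]
    refine Finset.sum_congr rfl fun j _ => ?_
    rw [integral_finsetSum _ fun k _ => (iq i j k).const_mul _]
    refine Finset.sum_congr rfl fun k _ => ?_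
    rw [integral_const_mul]
  have e4 : ∫ x in Ω, bulkDeriv a b c (Q x) H / L * φ x
      = (∫ x, bulkDeriv a b c (Q x) H * φ x ∂μ) / L := by
    rw [← integral_div]
    exact integral_congr_ae (Eventually.of_forall fun x => by ring)
  rw [e1] at hzero
  simp only [e2, mul_neg, Finset.sum_neg_distrib] at hzero
  rw [e3, e4]
  linarith

/-! ### Algebra of uniaxial tensors -/

theorem forall_fin_three {p : Fin 3 → Prop} : (∀ i, p i) ↔ p 0 ∧ p 1 ∧ p 2 :=
  ⟨fun h => ⟨h 0, h 1, h 2⟩, fun h i => by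
    obtain ⟨h0, h1, h2⟩ := h
    fin_cases i <;> assumption⟩

theorem fin_three_ne : (0 : Fin 3) ≠ 1 ∧ (0 : Fin 3) ≠ 2 ∧ (1 : Fin 3) ≠ 2 ∧ (1 : Fin 3) ≠ 0 ∧
    (2 : Fin 3) ≠ 0 ∧ (2 : Fin 3) ≠ 1 := by decide

theorem sum_sq_eq_one {n : E3} (hn : ‖n‖ = 1) : n 0 ^ 2 + n 1 ^ 2 + n 2 ^ 2 = 1 := by
  have h := EuclideanSpace.real_norm_sq_eq n
  rw [hn, Fin.sum_univ_three] at h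
  linarith

theorem isQTensor_uniaxial (s : ℝ) {n : E3} (hn : ‖n‖ = 1) : IsQTensor (uniaxial s n) := by
  refine ⟨?_, ?_⟩
  · ext i j
    simp only [Matrix.transpose_apply, uniaxial, eq_comm (a := j)]
    ring
  · have h := sum_sq_eq_one hn
    simp only [Matrix.trace, Matrix.diag, uniaxial, Fin.sum_univ_three]
    norm_num
    linear_combination s * h

/-- The eigenvalues are `2 s / 3` and `-s / 3`, so the tensor is annihilated by a quadratic
polynomial. This reduces all traces and the bulk force to functions of `s`. -/
theorem uniaxial_mul_self (s : ℝ) {n : E3} (hn : ‖n‖ = 1) :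
    uniaxial s n * uniaxial s n = (s / 3) • uniaxial s n + (2 / 9 * s ^ 2) • (1 : M3) := by
  have h := sum_sq_eq_one hn
  obtain ⟨e1, e2, e3, e4, e5, e6⟩ := fin_three_ne
  ext i j
  revert i j
  simp only [Matrix.mul_apply, Fin.sum_univ_three, uniaxial, Matrix.add_apply, Matrix.smul_apply,
    smul_eq_mul, Matrix.one_apply, forall_fin_three, if_true, if_neg e1, if_neg e2, if_neg e3,
    if_neg e4, if_neg e5, if_neg e6]
  refine ⟨⟨?_, ?_, ?_⟩, ⟨?_, ?_, ?_⟩, ⟨?_, ?_, ?_⟩⟩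
  · linear_combination s ^ 2 * n 0 * n 0 * h
  · linear_combination s ^ 2 * n 0 * n 1 * h
  · linear_combination s ^ 2 * n 0 * n 2 * h
  · linear_combination s ^ 2 * n 1 * n 0 * h
  · linear_combination s ^ 2 * n 1 * n 1 * h
  · linear_combination s ^ 2 * n 1 * n 2 * h
  · linear_combination s ^ 2 * n 2 * n 0 * h
  · linear_combination s ^ 2 * n 2 * n 1 * h
  · linear_combination s ^ 2 * n 2 * n 2 * h

theorem trace_uniaxial_sq (s : ℝ) {n : E3} (hn : ‖n‖ = 1) :
    (uniaxial s n * uniaxial s n).trace = 2 / 3 * s ^ 2 := by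
  rw [uniaxial_mul_self s hn, Matrix.trace_add, Matrix.trace_smul, Matrix.trace_smul,
    (isQTensor_uniaxial s hn).2, Matrix.trace_one]
  simp
  ring

theorem trace_uniaxial_cube (s : ℝ) {n : E3} (hn : ‖n‖ = 1) :
    (uniaxial s n * uniaxial s n * uniaxial s n).trace = 2 / 9 * s ^ 3 := by
  have h := trace_uniaxial_sq s hn
  rw [uniaxial_mul_self s hn, Matrix.add_mul, Matrix.smul_mul, Matrix.smul_mul, Matrix.one_mul,
    Matrix.trace_add, Matrix.trace_smul, Matrix.trace_smul, h, (isQTensor_uniaxial s hn).2]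
  simp
  ring

theorem sum_sq_eq_trace {M : M3} (hM : IsQTensor M) : ∑ i, ∑ j, M i j ^ 2 = (M * M).trace := by
  simp only [Matrix.trace, Matrix.diag, Matrix.mul_apply]
  refine Finset.sum_congr rfl fun i _ => Finset.sum_congr rfl fun j _ => ?_
  have : M j i = M i j := congrFun (congrFun hM.1 i) j
  rw [this, sq]

theorem sPlus_pos {a b c : ℝ} (hb : 0 < b) (hc : 0 < c) : 0 < sPlus a b c := by
  unfold sPlus
  have : 0 ≤ √(b ^ 4 + 24 * a ^ 2 * c ^ 2) := Real.sqrt_nonneg _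
  positivity

/-! ### Smoothness of matrix-valued maps -/

section smooth

variable {n : ℕ∞ω} {U : Set E3} {A B : E3 → M3}

theorem contDiffOn_matrix_mul (hA : ∀ i j, ContDiffOn ℝ n (fun x => A x i j) U)
    (hB : ∀ i j, ContDiffOn ℝ n (fun x => B x i j) U) (i j : Fin 3) :
    ContDiffOn ℝ n (fun x => (A x * B x) i j) U := by
  simp only [Matrix.mul_apply]
  exact ContDiffOn.sum fun k _ => (hA i k).mul (hB k j)

theorem contDiffOn_trace (hA : ∀ i j, ContDiffOn ℝ n (fun x => A x i j) U) :
    ContDiffOn ℝ n (fun x => (A x).trace) U := by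
  simp only [Matrix.trace, Matrix.diag]
  exact ContDiffOn.sum fun k _ => hA k k

theorem contDiffOn_bulkDeriv (hA : ∀ i j, ContDiffOn ℝ n (fun x => A x i j) U) (a b c : ℝ) (H : M3) :
    ContDiffOn ℝ n (fun x => bulkDeriv a b c (A x) H) U := by
  have hH : ∀ i j, ContDiffOn ℝ n (fun _ : E3 => H i j) U := fun _ _ => contDiffOn_const
  have h1 := contDiffOn_trace (contDiffOn_matrix_mul hA hH)
  have h2 := contDiffOn_trace (contDiffOn_matrix_mul (contDiffOn_matrix_mul hA hA) hH)
  have h3 := contDiffOn_trace (contDiffOn_matrix_mul hA hA)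
  exact ((contDiffOn_const.mul h1).sub (contDiffOn_const.mul h2)).add
    ((contDiffOn_const.mul h3).mul h1)

end smooth

/-- The symmetric traceless part of a matrix unit. -/
noncomputable def qUnit (i j : Fin 3) : M3 := fun p q =>
  ((if i = p then 1 else 0) * (if j = q then 1 else 0)
    + (if i = q then 1 else 0) * (if j = p then 1 else 0)) / 2
    - (if i = j then 1 else 0) * (if p = q then 1 else 0) / 3

theorem isQTensor_qUnit (i j : Fin 3) : IsQTensor (qUnit i j) := by
  refine ⟨?_, ?_⟩
  · ext p q
    simp only [Matrix.transpose_apply, qUnit, eq_comm (a := q) (b := p)]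
    ring
  · obtain ⟨e1, e2, e3, e4, e5, e6⟩ := fin_three_ne
    revert i j
    simp only [Matrix.trace, Matrix.diag, qUnit, Fin.sum_univ_three, forall_fin_three, if_true,
      if_neg e1, if_neg e2, if_neg e3, if_neg e4, if_neg e5, if_neg e6]
    norm_num

/-- On Q-tensors `qUnit i j` represents the `(i, j)` entry. As a direction of variation it gives the
equation entry by entry, with the multiplier for the trace constraint already built in. -/
theorem sum_qUnit_mul {M : M3} (hM : IsQTensor M) (i j : Fin 3) :
    ∑ p, ∑ q, qUnit i j p q * M p q = M i j := by
  have hs : ∀ p q, M q p = M p q := fun p q => congrFun (congrFun hM.1 p) q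
  have ht : M 0 0 + M 1 1 + M 2 2 = 0 := by
    have := hM.2
    rwa [Matrix.trace, Fin.sum_univ_three] at this
  have h01 := hs 0 1
  have h02 := hs 0 2
  have h12 := hs 1 2
  obtain ⟨e1, e2, e3, e4, e5, e6⟩ := fin_three_ne
  revert i j
  simp only [qUnit, Fin.sum_univ_three, forall_fin_three, if_true, if_neg e1, if_neg e2,
    if_neg e3, if_neg e4, if_neg e5, if_neg e6]
  refine ⟨⟨?_, ?_, ?_⟩, ⟨?_, ?_, ?_⟩, ⟨?_, ?_, ?_⟩⟩ <;> linarith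

/-! ### Regularity of minimizers -/

theorem abs_uniaxial_le (s : ℝ) {n : E3} (hn : ‖n‖ = 1) (i j : Fin 3) :
    |uniaxial s n i j| ≤ 2 * |s| := by
  have h : ∀ k, |n k| ≤ 1 := fun k => by
    have := PiLp.norm_apply_le n k
    rwa [hn, Real.norm_eq_abs] at this
  have h1 : |n i * n j| ≤ 1 := by
    rw [abs_mul]; exact mul_le_one₀ (h i) (abs_nonneg _) (h j)
  have h2 : |n i * n j - if i = j then 1 / 3 else 0| ≤ 2 := by
    split_ifs <;> rw [abs_le] at * <;> constructor <;> linarith [h1.1, h1.2]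
  rw [uniaxial, abs_mul, mul_comm]
  exact mul_le_mul_of_nonneg_right h2 (abs_nonneg _)

theorem Admissible.memW12_boundary {Ω : Set E3} {a b c : ℝ} {nb : E3 → E3} {Q : E3 → M3}
    (hQ : Admissible Ω a b c nb Q) (i j : Fin 3) :
    MemW12 Ω (fun x => uniaxial (sPlus a b c) (nb x) i j) :=
  ((hQ.1 i j).sub (hQ.2.2 i j).1).congr (Eventually.of_forall fun x => by simp)

/-- The Sobolev embedding applies to the difference from the boundary datum, and the datum is
bounded; no boundary regularity enters. -/
theorem Admissible.memLp_six {Ω : Set E3} (hfin : volume Ω ≠ ⊤) {a b c : ℝ} {nb : E3 → E3}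
    (hnb : MemW12Sphere Ω nb) {Q : E3 → M3} (hQ : Admissible Ω a b c nb Q) (i j : Fin 3) :
    MemLp (fun x => Q x i j) 6 (volume.restrict Ω) := by
  have : IsFiniteMeasure (volume.restrict Ω) := ⟨by simpa using hfin.lt_top⟩
  have h1 : MemLp (fun x => uniaxial (sPlus a b c) (nb x) i j) 6 (volume.restrict Ω) := by
    refine MemLp.of_bound (hQ.memW12_boundary i j).1.1 (2 * |sPlus a b c|) ?_
    filter_upwards [hnb.2] with x hx using abs_uniaxial_le _ hx i j
  have := (hQ.2.2 i j).memLp_six.add h1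
  refine this.ae_eq (Eventually.of_forall fun x => ?_)
  simp

/-- A minimizer has a smooth representative, which solves the Euler-Lagrange equations. -/
theorem IsGlobalMinimizer.exists_smooth_rep {Ω : Set E3} (hΩ : IsOpen Ω) (hfin : volume Ω ≠ ⊤)
    {a b c C L : ℝ} (hL : 0 < L) (hC : ∀ M : M3, IsQTensor M → 0 ≤ bulk a b c C M)
    {nb : E3 → E3} (hnb : MemW12Sphere Ω nb) {Q : E3 → M3}
    (hQ : IsGlobalMinimizer Ω a b c C L nb Q) :
    ∃ R : E3 → M3, (∀ i j, ContDiffOn ℝ ∞ (fun x => R x i j) Ω) ∧ Q =ᵐ[volume.restrict Ω] R ∧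
      (∀ x ∈ Ω, IsQTensor (R x)) ∧
      ∀ i j, ∀ x ∈ Ω, lapl (fun y => R y i j) x = bulkDeriv a b c (R x) (qUnit i j) / L := by
  have : IsFiniteMeasure (volume.restrict Ω) := ⟨by simpa using hfin.lt_top⟩
  have hQ6 := hQ.1.memLp_six hfin hnb
  have hweak : ∀ i j, IsWeakLapl Ω (fun x => Q x i j)
      (fun x => bulkDeriv a b c (Q x) (qUnit i j) / L) := fun i j => by
    refine (hQ.isWeakLapl hΩ hfin hL hC hQ6 (isQTensor_qUnit i j)).congr ?_ EventuallyEq.rfl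
    filter_upwards [hQ.1.2.1] with x hx using sum_qUnit_mul hx i j
  have hex : ∀ i j, ∃ F : E3 → ℝ, ContDiffOn ℝ 0 F Ω ∧
      (fun x => Q x i j) =ᵐ[volume.restrict Ω] F := fun i j => by
    refine exists_contDiffOn_rep_of_local hΩ fun x₀ hx₀ => ?_
    have hm : MemLp (fun x => bulkDeriv a b c (Q x) (qUnit i j) / L) 2 (volume.restrict Ω) := by
      simp only [div_eq_mul_inv]
      exact (memLp_bulkDeriv hQ6 a b c _).mul_const _
    obtain ⟨δ, hδ, hs, v, hv, hae⟩ := exists_continuousOn_rep hΩ hfin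
      ((hQ6 i j).integrable (by norm_num)) hm (hweak i j) hx₀
    exact ⟨δ, hδ, hs, v, contDiffOn_zero.2 hv, hae⟩
  choose F hF hFae using hex
  let R : E3 → M3 := fun x i j => F i j x
  have hR0 : ∀ i j, ContDiffOn ℝ 0 (fun x => R x i j) Ω := hF
  have hQR : Q =ᵐ[volume.restrict Ω] R := by
    have : ∀ᵐ x ∂(volume.restrict Ω), ∀ i j, Q x i j = F i j x :=
      ae_all_iff.2 fun i => ae_all_iff.2 fun j => hFae i j
    filter_upwards [this] with x hx
    ext i j
    exact hx i j
  have hweakR : ∀ i j, IsWeakLapl Ω (fun x => R x i j)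
      (fun x => bulkDeriv a b c (R x) (qUnit i j) / L) := fun i j =>
    (hweak i j).congr (hFae i j) (by filter_upwards [hQR] with x hx; rw [hx])
  have hG : ∀ {n : ℕ∞ω}, (∀ i j, ContDiffOn ℝ n (fun x => R x i j) Ω) → ∀ i j,
      ContDiffOn ℝ n (fun x => bulkDeriv a b c (R x) (qUnit i j) / L) Ω := fun h i j =>
    (contDiffOn_bulkDeriv h a b c _).div_const L
  -- The bootstrap: the right-hand side is polynomial in `R`, so it is as smooth as `R`, and `R`
  -- gains a derivative from it.
  have hRn : ∀ n : ℕ, ∀ i j, ContDiffOn ℝ n (fun x => R x i j) Ω := by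
    intro n
    induction n with
    | zero => exact_mod_cast hR0
    | succ n ih =>
      intro i j
      push_cast
      exact contDiffOn_succ_of_isWeakLapl hΩ n (hR0 i j).continuousOn (hG ih i j) (hweakR i j)
  have hRs : ∀ i j, ContDiffOn ℝ ∞ (fun x => R x i j) Ω := fun i j =>
    contDiffOn_infty.2 fun n => hRn n i j
  refine ⟨R, hRs, hQR, ?_, fun i j x hx => ?_⟩
  · have hT : ∀ᵐ x ∂(volume.restrict Ω), IsQTensor (R x) := by
      filter_upwards [hQ.1.2.1, hQR] with x h1 h2
      rwa [← h2]
    intro x hx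
    refine ⟨?_, ?_⟩
    · ext i j
      refine Measure.eqOn_open_of_ae_eq (μ := (volume : Measure E3)) (f := fun x => R x j i) (g := fun x => R x i j) ?_ hΩ
        (hR0 j i).continuousOn (hR0 i j).continuousOn hx
      filter_upwards [hT] with y hy using congrFun (congrFun hy.1 i) j
    · refine Measure.eqOn_open_of_ae_eq (μ := (volume : Measure E3)) (f := fun x => (R x).trace) (g := fun x => 0) ?_ hΩ
        (contDiffOn_trace hR0).continuousOn continuousOn_const hx
      filter_upwards [hT] with y hy using hy.2
  · exact (hweakR i j).lapl_eq hΩ (hRn 2 i j) (hG hR0 i j).continuousOn hx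

/-! ### Weak derivatives of functions multiplied by a sign -/

theorem tendsto_arctan_sign (t : ℝ) :
    Tendsto (fun n : ℕ => 2 / Real.pi * Real.arctan (n * t)) atTop (𝓝 (Real.sign t)) := by
  have hpi : 2 / Real.pi * (Real.pi / 2) = 1 := by field_simp
  have hpos : ∀ t : ℝ, 0 < t →
      Tendsto (fun n : ℕ => 2 / Real.pi * Real.arctan (n * t)) atTop (𝓝 1) := fun t ht => by
    have h1 : Tendsto (fun n : ℕ => (n : ℝ) * t) atTop atTop :=
      tendsto_natCast_atTop_atTop.atTop_mul_const ht
    have h2 := ((Real.tendsto_arctan_atTop.mono_right nhdsWithin_le_nhds).comp h1).const_mul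
      (2 / Real.pi)
    rwa [hpi] at h2
  rcases lt_trichotomy t 0 with h | h | h
  · rw [Real.sign_of_neg h]
    have := (hpos (-t) (by linarith)).neg
    refine this.congr fun n => ?_
    rw [mul_neg, Real.arctan_neg]; ring
  · subst h; simp
  · rw [Real.sign_of_pos h]; exact hpos t h

theorem pd_arctan_mul {τ : E3 → ℝ} {x : E3} (hτ : DifferentiableAt ℝ τ x) (n : ℝ) (k : Fin 3) :
    pd k (fun y => 2 / Real.pi * Real.arctan (n * τ y)) x
      = 2 / Real.pi * (n / (1 + (n * τ x) ^ 2)) * pd k τ x := by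
  have hF : HasDerivAt (fun t => 2 / Real.pi * Real.arctan (n * t))
      (2 / Real.pi * (n / (1 + (n * τ x) ^ 2))) (τ x) := by
    have := (((hasDerivAt_id (τ x)).const_mul n).arctan).const_mul (2 / Real.pi)
    refine this.congr_deriv ?_
    simp; ring
  rw [pd_comp (F := fun t => 2 / Real.pi * Real.arctan (n * t)) hF.differentiableAt hτ, hF.deriv]

theorem abs_arctan_le (t : ℝ) : |2 / Real.pi * Real.arctan t| ≤ 1 := by
  have h1 : |Real.arctan t| ≤ Real.pi / 2 :=
    abs_le.2 ⟨(Real.neg_pi_div_two_lt_arctan t).le, (Real.arctan_lt_pi_div_two t).le⟩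
  have h0 : 0 < 2 / Real.pi := by positivity
  rw [abs_mul, abs_of_pos h0]
  calc _ ≤ 2 / Real.pi * (Real.pi / 2) := by gcongr
    _ = 1 := by field_simp

/-- The sign is approximated by `2/π arctan (n τ)`. The product rule produces an extra term with `w
∂ₖτ` and a factor `n / (1 + (n τ)²)`. The hypothesis `|w ∂ₖτ| ≤ G |τ|` dominates that term by `G`
and makes it tend to zero everywhere, so no singular part appears on `{τ = 0}`. -/
theorem isWeakPartial_sign_mul {Ω : Set E3} (hΩ : IsOpen Ω) {τ w G : E3 → ℝ} {k : Fin 3}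
    (hτ : ContDiffOn ℝ 1 τ Ω) (hw : ContDiffOn ℝ 1 w Ω) (hG : ContinuousOn G Ω)
    (h : ∀ x ∈ Ω, |w x * pd k τ x| ≤ G x * |τ x|) (hG0 : ∀ x ∈ Ω, 0 ≤ G x)
    (hL2 : MemLp (pd k w) 2 (volume.restrict Ω)) :
    IsWeakPartial Ω k (fun x => Real.sign (τ x) * w x) (fun x => Real.sign (τ x) * pd k w x) := by
  have hdw : ContinuousOn (pd k w) Ω := (contDiffOn_pd (m := 0) hΩ hw (by simp)).continuousOn
  have hdτ : ContinuousOn (pd k τ) Ω := (contDiffOn_pd (m := 0) hΩ hτ (by simp)).continuousOn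
  have hdiff : ∀ {f : E3 → ℝ}, ContDiffOn ℝ 1 f Ω → ∀ x ∈ Ω, DifferentiableAt ℝ f x :=
    fun hf x hx => (hf.contDiffAt (hΩ.mem_nhds hx)).differentiableAt (by simp)
  let σ : ℕ → E3 → ℝ := fun n x => 2 / Real.pi * Real.arctan (n * τ x)
  have hσ : ∀ n, ContDiffOn ℝ 1 (σ n) Ω := fun n =>
    contDiffOn_const.mul (Real.contDiff_arctan.comp_contDiffOn (contDiffOn_const.mul hτ))
  have hσlim : ∀ x, Tendsto (fun n => σ n x) atTop (𝓝 (Real.sign (τ x))) := fun x =>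
    tendsto_arctan_sign (τ x)
  have hmeas : AEStronglyMeasurable (fun x => Real.sign (τ x)) (volume.restrict Ω) :=
    aestronglyMeasurable_of_tendsto_ae atTop
      (fun n => (hσ n).continuousOn.aestronglyMeasurable hΩ.measurableSet)
      (Eventually.of_forall hσlim)
  have hsign : ∀ t : ℝ, |Real.sign t| ≤ 1 := fun t => by
    rcases Real.sign_apply_eq t with h | h | h <;> rw [h] <;> norm_num
  refine ⟨hL2.mono (hmeas.mul hL2.1) (Eventually.of_forall fun x => ?_), fun φ hφ => ?_⟩
  · rw [norm_mul]
    exact mul_le_of_le_one_left (norm_nonneg _) (hsign _)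
  let A : ℕ → E3 → ℝ := fun n x => (n : ℝ) / (1 + (n * τ x) ^ 2) * (w x * pd k τ x)
  have hden : ∀ (n : ℕ) x, 0 < 1 + ((n : ℝ) * τ x) ^ 2 := fun n x => by positivity
  -- This bound gives the decay where `τ ≠ 0`; the next one, `hAb`, is the domination uniform in
  -- `n`.
  have hAle : ∀ n, ∀ x ∈ Ω, |A n x| * (n * |τ x|) ≤ G x := fun n x hx => by
    have h1 := h x hx
    have h2 := hden n x
    have h3 : (n * |τ x|) * (n * |τ x|) ≤ 1 + ((n : ℝ) * τ x) ^ 2 := by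
      have : ((n : ℝ) * |τ x|) * (n * |τ x|) = (n * τ x) ^ 2 := by
        rw [mul_pow, ← sq_abs (τ x)]; ring
      linarith
    simp only [A]
    rw [abs_mul, abs_of_nonneg (by positivity), div_mul_eq_mul_div, div_mul_eq_mul_div,
      div_le_iff₀ h2]
    calc _ ≤ (n : ℝ) * (G x * |τ x|) * (n * |τ x|) := by gcongr
      _ = G x * ((n * |τ x|) * (n * |τ x|)) := by ring
      _ ≤ _ := mul_le_mul_of_nonneg_left h3 (hG0 x hx)
  have hAb : ∀ n, ∀ x ∈ Ω, |A n x| ≤ G x := fun n x hx => by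
    have h1 := h x hx
    have h2 := hden n x
    have h3 : (n : ℝ) * |τ x| ≤ 1 + ((n : ℝ) * τ x) ^ 2 := by
      have : ((n : ℝ) * τ x) ^ 2 = (n * |τ x|) ^ 2 := by rw [mul_pow, mul_pow, sq_abs]
      rw [this]
      nlinarith [sq_nonneg ((n : ℝ) * |τ x| - 1), abs_nonneg (τ x)]
    simp only [A]
    rw [abs_mul, abs_of_nonneg (by positivity), div_mul_eq_mul_div, div_le_iff₀ h2]
    calc _ ≤ (n : ℝ) * (G x * |τ x|) := by gcongr
      _ = G x * (n * |τ x|) := by ring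
      _ ≤ _ := mul_le_mul_of_nonneg_left h3 (hG0 x hx)
  have hAlim : ∀ x ∈ Ω, Tendsto (fun n => A n x) atTop (𝓝 0) := fun x hx => by
    by_cases h0 : τ x = 0
    · have : w x * pd k τ x = 0 := by
        have := h x hx
        rw [h0, abs_zero, mul_zero] at this
        exact abs_eq_zero.1 (le_antisymm this (abs_nonneg _))
      simp only [A, this, mul_zero]
      exact tendsto_const_nhds
    · have h1 : Tendsto (fun n : ℕ => (n : ℝ) * |τ x|) atTop atTop :=
        tendsto_natCast_atTop_atTop.atTop_mul_const (abs_pos.2 h0)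
      refine squeeze_zero_norm' ?_ (h1.const_div_atTop (G x))
      filter_upwards [h1.eventually_gt_atTop 0] with n hn
      rw [le_div_iff₀ hn]
      exact hAle n x hx
  have hpd : ∀ n, ∀ x ∈ Ω, pd k (fun y => σ n y * w y) x
      = 2 / Real.pi * A n x + σ n x * pd k w x := fun n x hx => by
    rw [pd_mul (hdiff (hσ n) x hx) (hdiff hw x hx), pd_arctan_mul (hdiff hτ x hx)]
    simp only [A]; ring
  have hid : ∀ n, ∫ x in Ω, (σ n x * w x) * pd k φ x
      = - ∫ x in Ω, (2 / Real.pi * A n x + σ n x * pd k w x) * φ x := fun n => by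
    rw [integral_mul_pd hΩ ((hσ n).mul hw) hφ k]
    congr 1
    refine setIntegral_congr_fun hΩ.measurableSet fun x hx => ?_
    simp only [hpd n x hx]
  have hrestr : ∀ {p : E3 → Prop}, (∀ x ∈ Ω, p x) → ∀ᵐ x ∂(volume.restrict Ω), p x := fun hp =>
    (ae_restrict_iff' hΩ.measurableSet).2 (Eventually.of_forall hp)
  have hms : ∀ {f : E3 → ℝ}, ContinuousOn f Ω → AEStronglyMeasurable f (volume.restrict Ω) :=
    fun hf => hf.aestronglyMeasurable hΩ.measurableSet
  have hAc : ∀ n, ContinuousOn (A n) Ω := fun n =>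
    (ContinuousOn.div continuousOn_const
      (continuousOn_const.add ((continuousOn_const.mul hτ.continuousOn).pow 2))
      fun x _ => (hden n x).ne').mul (hw.continuousOn.mul hdτ)
  have l1 : Tendsto (fun n => ∫ x in Ω, (σ n x * w x) * pd k φ x) atTop
      (𝓝 (∫ x in Ω, (Real.sign (τ x) * w x) * pd k φ x)) := by
    refine tendsto_integral_of_dominated_convergence (fun x => |w x * pd k φ x|)
      (fun n => hms (((hσ n).continuousOn.mul hw.continuousOn).mul
        (hφ.pd k).continuous.continuousOn))
      ((hφ.pd k).integrable_mul_of_continuousOn hΩ hw.continuousOn).abs.integrableOn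
      (fun n => Eventually.of_forall fun x => ?_) (Eventually.of_forall fun x => ?_)
    · rw [Real.norm_eq_abs, mul_assoc, abs_mul]
      exact mul_le_of_le_one_left (abs_nonneg _) (abs_arctan_le _)
    · exact ((hσlim x).mul_const _).mul_const _
  have l2 : Tendsto (fun n => ∫ x in Ω, (2 / Real.pi * A n x + σ n x * pd k w x) * φ x) atTop
      (𝓝 (∫ x in Ω, (Real.sign (τ x) * pd k w x) * φ x)) := by
    refine tendsto_integral_of_dominated_convergence (fun x => |(G x + |pd k w x|) * φ x|)
      (fun n => hms (((continuousOn_const.mul (hAc n)).add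
        ((hσ n).continuousOn.mul hdw)).mul hφ.continuous.continuousOn))
      (hφ.integrable_mul_of_continuousOn hΩ (hG.add hdw.abs)).abs.integrableOn
      (fun n => hrestr fun x hx => ?_) (hrestr fun x hx => ?_)
    · have h2 : (2 / Real.pi : ℝ) ≤ 1 := by
        rw [div_le_one Real.pi_pos]; linarith [Real.pi_gt_three]
      rw [Real.norm_eq_abs, abs_mul, abs_mul]
      refine mul_le_mul_of_nonneg_right ?_ (abs_nonneg _)
      refine (abs_add_le _ _).trans (le_trans (add_le_add ?_ ?_) (le_abs_self _))
      · rw [abs_mul, abs_of_pos (by positivity)]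
        exact (mul_le_of_le_one_left (abs_nonneg _) h2).trans (hAb n x hx)
      · rw [abs_mul]
        exact mul_le_of_le_one_left (abs_nonneg _) (abs_arctan_le _)
    · have := (((hAlim x hx).const_mul (2 / Real.pi)).add
        ((hσlim x).mul_const (pd k w x))).mul_const (φ x)
      simpa using this
  have l2' := l2.neg
  refine tendsto_nhds_unique l1 (l2'.congr fun n => (hid n).symm)

/-! ### Quotients of quadratic maps by the norm -/

section quadratic

variable {E : Type*} [NormedAddCommGroup E]

/-- The quotient of a map with quadratic growth by the norm grows linearly. The Lipschitz bound
follows by dividing both values by the larger of the two norms first, at a cost of `2 K`, and then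
correcting the denominator, at a cost of `K`. -/
theorem lipschitzWith_div_norm {q : E → ℝ} {K : NNReal}
    (h : ∀ v w, |q v - q w| ≤ K * (‖v‖ + ‖w‖) * ‖v - w‖) (h0 : q 0 = 0) :
    LipschitzWith (3 * K) fun v => q v / ‖v‖ := by
  have hq : ∀ v, |q v| ≤ K * ‖v‖ * ‖v‖ := fun v => by simpa [h0] using h v 0
  have key : ∀ v w : E, ‖w‖ ≤ ‖v‖ → |q v / ‖v‖ - q w / ‖w‖| ≤ 3 * K * ‖v - w‖ := by
    intro v w hvw
    by_cases hv : ‖v‖ = 0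
    · have hw : ‖w‖ = 0 := le_antisymm (hvw.trans hv.le) (norm_nonneg _)
      rw [hv, hw]; simp; positivity
    have hv' : 0 < ‖v‖ := lt_of_le_of_ne (norm_nonneg _) (Ne.symm hv)
    have e2 : |q w / ‖v‖ - q w / ‖w‖| ≤ K * ‖v - w‖ := by
      by_cases hw : ‖w‖ = 0
      · have : q w = 0 := by
          have := hq w
          rw [hw, mul_zero] at this
          exact abs_eq_zero.1 (le_antisymm this (abs_nonneg _))
        rw [this]; simp; positivity
      have hw' : 0 < ‖w‖ := lt_of_le_of_ne (norm_nonneg _) (Ne.symm hw)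
      have : q w / ‖v‖ - q w / ‖w‖ = q w * (‖w‖ - ‖v‖) / (‖v‖ * ‖w‖) := by field_simp
      rw [this, abs_div, abs_mul, abs_of_pos (mul_pos hv' hw'), div_le_iff₀ (mul_pos hv' hw')]
      have h3 : |‖w‖ - ‖v‖| ≤ ‖v - w‖ := by
        rw [norm_sub_rev]; exact abs_norm_sub_norm_le _ _
      calc |q w| * |‖w‖ - ‖v‖| ≤ (K * ‖w‖ * ‖w‖) * ‖v - w‖ := by gcongr; exact hq w
        _ ≤ (K * ‖v‖ * ‖w‖) * ‖v - w‖ := by gcongr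
        _ = _ := by ring
    have e1 : |q v / ‖v‖ - q w / ‖v‖| ≤ 2 * K * ‖v - w‖ := by
      rw [← sub_div, abs_div, abs_of_pos hv', div_le_iff₀ hv']
      calc _ ≤ K * (‖v‖ + ‖w‖) * ‖v - w‖ := h v w
        _ ≤ K * (‖v‖ + ‖v‖) * ‖v - w‖ := by gcongr
        _ = _ := by ring
    calc _ ≤ |q v / ‖v‖ - q w / ‖v‖| + |q w / ‖v‖ - q w / ‖w‖| := abs_sub_le _ _ _
      _ ≤ _ := by linarith
  refine LipschitzWith.of_dist_le_mul fun v w => ?_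
  rw [Real.dist_eq, dist_eq_norm]
  push_cast
  rcases le_total ‖w‖ ‖v‖ with hvw | hvw
  · exact key v w hvw
  · rw [abs_sub_comm, norm_sub_rev]; exact key w v hvw

end quadratic

theorem abs_mul_sub_mul_le {ι : Type*} [Fintype ι] (v w : EuclideanSpace ℝ ι) (p q : ι) :
    |v p * v q - w p * w q| ≤ (‖v‖ + ‖w‖) * ‖v - w‖ := by
  have hc : ∀ (z : EuclideanSpace ℝ ι) r, |z r| ≤ ‖z‖ := fun z r => by
    simpa using PiLp.norm_apply_le z r
  have e : v p * v q - w p * w q = v p * (v - w) q + (v - w) p * w q := by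
    simp only [PiLp.sub_apply]; ring
  rw [e]
  refine (abs_add_le _ _).trans ?_
  rw [abs_mul, abs_mul]
  have h1 := mul_le_mul (hc v p) (hc (v - w) q) (abs_nonneg _) (norm_nonneg _)
  have h2 := mul_le_mul (hc (v - w) p) (hc w q) (abs_nonneg _) (norm_nonneg _)
  linarith

/-- A Lipschitz map that restricts to `s (n ⊗ n - I / 3) ↦ |s| (n ⊗ n - I / 3)`. -/
noncomputable def absMap (i j : Fin 3) (v : EuclideanSpace ℝ (Fin 3 × Fin 3)) : ℝ :=
  √(2 / 3) * ((3 * ∑ k, v (i, k) * v (k, j) - (if i = j then 1 else 0) * ∑ p, v p * v p) / ‖v‖)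

theorem exists_lipschitzWith_absMap (i j : Fin 3) : ∃ K, LipschitzWith K (absMap i j) := by
  -- The constant `18` counts the products in the quadratic map: `3 * 3` from the matrix square and
  -- `9` from the squared norm.
  have h : LipschitzWith (3 * 18) fun v : EuclideanSpace ℝ (Fin 3 × Fin 3) =>
      (3 * ∑ k, v (i, k) * v (k, j) - (if i = j then 1 else 0) * ∑ p, v p * v p) / ‖v‖ := by
    refine lipschitzWith_div_norm (q := fun v : EuclideanSpace ℝ (Fin 3 × Fin 3) =>
      3 * ∑ k, v (i, k) * v (k, j) - (if i = j then 1 else 0) * ∑ p, v p * v p)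
      (fun v w => ?_) (by simp)
    set T := (‖v‖ + ‖w‖) * ‖v - w‖ with hT
    have e1 : |∑ k, v (i, k) * v (k, j) - ∑ k, w (i, k) * w (k, j)| ≤ 3 * T := by
      rw [← Finset.sum_sub_distrib]
      refine (Finset.abs_sum_le_sum_abs _ _).trans ?_
      refine (Finset.sum_le_card_nsmul _ _ T fun k _ => abs_mul_sub_mul_le v w _ _).trans ?_
      simp
    have e2 : |∑ p, v p * v p - ∑ p, w p * w p| ≤ 9 * T := by
      rw [← Finset.sum_sub_distrib]
      refine (Finset.abs_sum_le_sum_abs _ _).trans ?_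
      refine (Finset.sum_le_card_nsmul _ _ T fun k _ => abs_mul_sub_mul_le v w _ _).trans ?_
      simp
    have hT0 : 0 ≤ T := by positivity
    have e3 : (((18 : NNReal) : ℝ)) * (‖v‖ + ‖w‖) * ‖v - w‖ = 18 * T := by
      rw [hT]; push_cast; ring
    rw [e3]
    rw [abs_le] at *
    split_ifs <;> constructor <;> linarith [e1.1, e1.2, e2.1, e2.2]
  refine ⟨_, LipschitzWith.of_dist_le_mul (K := (√(2 / 3)).toNNReal * (3 * 18))
    fun v w => ?_⟩
  have := h.dist_le_mul v w
  rw [Real.dist_eq] at this ⊢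
  unfold absMap
  rw [← mul_sub, abs_mul, abs_of_nonneg (Real.sqrt_nonneg _), NNReal.coe_mul,
    Real.coe_toNNReal _ (Real.sqrt_nonneg _), mul_assoc]
  exact mul_le_mul_of_nonneg_left this (Real.sqrt_nonneg _)

/-- The entries of a matrix as a vector. -/
noncomputable abbrev entries (M : M3) : EuclideanSpace ℝ (Fin 3 × Fin 3) :=
  WithLp.toLp 2 fun p => M p.1 p.2

theorem norm_entries_sq {M : M3} (hM : IsQTensor M) : ‖entries M‖ ^ 2 = (M * M).trace := by
  rw [EuclideanSpace.real_norm_sq_eq, ← sum_sq_eq_trace hM, Fintype.sum_prod_type]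

theorem norm_entries_uniaxial (s : ℝ) {n : E3} (hn : ‖n‖ = 1) :
    √(3 / 2) * ‖entries (uniaxial s n)‖ = |s| := by
  have h := norm_entries_sq (isQTensor_uniaxial s hn)
  rw [trace_uniaxial_sq s hn] at h
  rw [← Real.sqrt_sq (norm_nonneg (entries _)), h, ← Real.sqrt_mul (by norm_num),
    ← Real.sqrt_sq_eq_abs]
  congr 1; ring

/-- For uniaxial `Q` one has `3 Q² - tr (Q²) I = s Q` and `|Q| = √(2/3) |s|`, so the quotient is
`sign s` times `Q`. -/
theorem absMap_uniaxial (s : ℝ) {n : E3} (hn : ‖n‖ = 1) (i j : Fin 3) :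
    absMap i j (entries (uniaxial s n)) = uniaxial |s| n i j := by
  have hT := isQTensor_uniaxial s hn
  have h := norm_entries_uniaxial s hn
  have h1 : ∑ k, uniaxial s n i k * uniaxial s n k j = (uniaxial s n * uniaxial s n) i j := rfl
  have h2 : ∑ p : Fin 3 × Fin 3, uniaxial s n p.1 p.2 * uniaxial s n p.1 p.2 = 2 / 3 * s ^ 2 := by
    rw [← trace_uniaxial_sq s hn, ← sum_sq_eq_trace hT, Fintype.sum_prod_type]
    simp only [sq]
  have h3 : √(2 / 3 : ℝ) * √(3 / 2) = 1 := by
    rw [← Real.sqrt_mul (by norm_num)]; norm_num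
  have h4 : √(2 / 3 : ℝ) * |s| = ‖entries (uniaxial s n)‖ := by
    rw [← h, ← mul_assoc, h3, one_mul]
  unfold absMap
  by_cases hs : s = 0
  · subst hs
    have : ‖entries (uniaxial 0 n)‖ = 0 := by rw [← h4]; simp
    rw [this]; simp [uniaxial]
  have hs' : 0 < |s| := abs_pos.2 hs
  have h5 : 0 < √(2 / 3 : ℝ) := Real.sqrt_pos.2 (by norm_num)
  have h6 : √(2 / 3 : ℝ) * (((3 * ∑ k, uniaxial s n i k * uniaxial s n k j)
      - (if i = j then 1 else 0) * ∑ p : Fin 3 × Fin 3, uniaxial s n p.1 p.2 * uniaxial s n p.1 p.2)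
        / (√(2 / 3) * |s|)) = uniaxial |s| n i j := by
    rw [h1, h2, uniaxial_mul_self s hn]
    simp only [Matrix.add_apply, Matrix.smul_apply, smul_eq_mul, Matrix.one_apply]
    rw [mul_div_assoc', mul_div_mul_left _ _ h5.ne', div_eq_iff hs'.ne']
    simp only [uniaxial]
    have h7 : |s| * |s| = s * s := abs_mul_abs_self s
    split_ifs
    · linear_combination (-(n i * n j) + 1 / 3) * h7
    · linear_combination -(n i * n j) * h7
  rw [h4] at h6
  exact h6

/-! ### Nonnegativity of the order parameter -/

theorem IsWeakPartial.of_contDiffOn {Ω : Set E3} (hΩ : IsOpen Ω) {k : Fin 3} {u v w : E3 → ℝ}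
    (h : IsWeakPartial Ω k u v) (hu : u =ᵐ[volume.restrict Ω] w) (hw : ContDiffOn ℝ 1 w Ω) :
    IsWeakPartial Ω k w (pd k w) := by
  have h1 := h.congr hu EventuallyEq.rfl
  refine h1.congr EventuallyEq.rfl ?_
  have hc : ContinuousOn (pd k w) Ω := (contDiffOn_pd (m := 0) hΩ hw (by simp)).continuousOn
  refine ae_eq_of_forall_integral_eq hΩ (locallyIntegrableOn_of_memLp h.1)
    (hc.locallyIntegrableOn hΩ.measurableSet) fun φ hφ => ?_
  have h2 := h1.2 φ hφ
  have h3 := integral_mul_pd hΩ hw hφ k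
  linarith

/-- The derivative of `tr R³` is quadratic in `R`. Multiplied by an entry of `R` it is cubic, hence
comparable with `tr R³` for uniaxial `R`; this feeds `isWeakPartial_sign_mul`. -/
theorem abs_pd_trace_cube_le {R : E3 → M3} {x : E3} {m : ℝ}
    (hR : ∀ i j, DifferentiableAt ℝ (fun y => R y i j) x) (hm : ∀ i j, |R x i j| ≤ m) (k : Fin 3) :
    |pd k (fun y => (R y * R y * R y).trace) x|
      ≤ 81 * (∑ i, ∑ j, |pd k (fun y => R y i j) x|) * m ^ 2 := by
  have hm0 : 0 ≤ m := (abs_nonneg _).trans (hm 0 0)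
  set N := ∑ i, ∑ j, |pd k (fun y => R y i j) x| with hN
  have hle : ∀ i j, |pd k (fun y => R y i j) x| ≤ N := fun i j => by
    refine (Finset.single_le_sum (f := fun j => |pd k (fun y => R y i j) x|)
      (fun _ _ => abs_nonneg _) (Finset.mem_univ j)).trans ?_
    exact Finset.single_le_sum (f := fun i => ∑ j, |pd k (fun y => R y i j) x|)
      (fun _ _ => Finset.sum_nonneg fun _ _ => abs_nonneg _) (Finset.mem_univ i)
  have hN0 : 0 ≤ N := (abs_nonneg _).trans (hle 0 0)
  have e : (fun y => (R y * R y * R y).trace)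
      = fun y => ∑ p, ∑ r, ∑ q, R y p q * R y q r * R y r p := by
    ext y
    simp only [Matrix.trace, Matrix.diag, Matrix.mul_apply, Finset.sum_mul]
  have ht : ∀ p r q, |pd k (fun y => R y p q * R y q r * R y r p) x| ≤ 3 * N * m ^ 2 := by
    intro p r q
    rw [pd_mul ((hR p q).fun_mul (hR q r)) (hR r p), pd_mul (hR p q) (hR q r)]
    have h1 : |pd k (fun y => R y p q) x * R x q r * R x r p| ≤ N * m * m := by
      rw [abs_mul, abs_mul]
      gcongr
      exacts [hle _ _, hm _ _, hm _ _]
    have h2 : |R x p q * pd k (fun y => R y q r) x * R x r p| ≤ m * N * m := by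
      rw [abs_mul, abs_mul]
      gcongr
      exacts [hm _ _, hle _ _, hm _ _]
    have h3 : |R x p q * R x q r * pd k (fun y => R y r p) x| ≤ m * m * N := by
      rw [abs_mul, abs_mul]
      gcongr
      exacts [hm _ _, hm _ _, hle _ _]
    rw [add_mul]
    refine (abs_add_le _ _).trans ((add_le_add (abs_add_le _ _) le_rfl).trans ?_)
    nlinarith
  have hd : ∀ p r q, DifferentiableAt ℝ (fun y => R y p q * R y q r * R y r p) x := fun p r q =>
    ((hR p q).mul (hR q r)).mul (hR r p)
  have hd1 : ∀ p r, DifferentiableAt ℝ (fun y => ∑ q, R y p q * R y q r * R y r p) x := fun p r =>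
    DifferentiableAt.fun_sum fun q _ => hd p r q
  rw [e, pd_sum fun p _ => DifferentiableAt.fun_sum fun r _ => hd1 p r]
  have h3 : ∀ f : Fin 3 → ℝ, ∀ B, (∀ i, |f i| ≤ B) → |∑ i, f i| ≤ 3 * B := fun f B hf => by
    refine (Finset.abs_sum_le_sum_abs _ _).trans ?_
    refine (Finset.sum_le_card_nsmul _ _ B fun i _ => hf i).trans ?_
    simp
  calc _ ≤ 3 * (3 * (3 * (3 * N * m ^ 2))) := by
        refine h3 _ _ fun p => ?_
        rw [pd_sum fun r _ => hd1 p r]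
        refine h3 _ _ fun r => ?_
        rw [pd_sum fun q _ => hd p r q]
        exact h3 _ _ fun q => ht p r q
    _ = _ := by ring

theorem abs_le_sqrt_trace {M : M3} (hM : IsQTensor M) (i j : Fin 3) :
    |M i j| ≤ √((M * M).trace) := by
  rw [← norm_entries_sq hM, Real.sqrt_sq (norm_nonneg _)]
  simpa using PiLp.norm_apply_le (entries M) (i, j)

theorem sign_mul_uniaxial (s : ℝ) (n : E3) (i j : Fin 3) :
    Real.sign s * uniaxial s n i j = uniaxial |s| n i j := by
  have h : Real.sign s * s = |s| := by
    rcases lt_trichotomy s 0 with h | h | h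
    · rw [Real.sign_of_neg h, abs_of_neg h]; ring
    · subst h; simp
    · rw [Real.sign_of_pos h, abs_of_pos h]; ring
  simp only [uniaxial, ← mul_assoc, h]

theorem sign_cube (s : ℝ) : Real.sign (2 / 9 * s ^ 3) = Real.sign s := by
  rcases lt_trichotomy s 0 with h | h | h
  · rw [Real.sign_of_neg h, Real.sign_of_neg]
    have := Odd.pow_neg (n := 3) (by decide) h
    linarith
  · subst h; simp
  · rw [Real.sign_of_pos h, Real.sign_of_pos (by positivity)]

/-- Comparison with `|s| (n ⊗ n - I / 3)`. Only the cubic term of the bulk energy sees the sign of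
`s`, and as `b > 0` it strictly prefers `s > 0`, while the gradient term does not increase. -/
theorem IsGlobalMinimizer.ae_nonneg {Ω : Set E3} (hΩ : IsOpen Ω) (hfin : volume Ω ≠ ⊤)
    {a b c C L : ℝ} (hb : 0 < b) (hc : 0 < c) (hL : 0 < L)
    (hC : ∀ M : M3, IsQTensor M → 0 ≤ bulk a b c C M)
    {nb : E3 → E3} (hnb : MemW12Sphere Ω nb) {Q R : E3 → M3}
    (hQ : IsGlobalMinimizer Ω a b c C L nb Q) {s₀ : E3 → ℝ} {n₀ : E3 → E3}
    (hrep : IsUniaxialRep Ω Q s₀ n₀) (hR : ∀ i j, ContDiffOn ℝ 1 (fun x => R x i j) Ω)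
    (hQR : Q =ᵐ[volume.restrict Ω] R) (hRT : ∀ x ∈ Ω, IsQTensor (R x)) :
    ∀ᵐ x ∂(volume.restrict Ω), 0 ≤ s₀ x := by
  set μ := volume.restrict Ω with hμ
  have : IsFiniteMeasure μ := ⟨by simpa [hμ] using hfin.lt_top⟩
  have hs : 0 < sPlus a b c := sPlus_pos hb hc
  set τ : E3 → ℝ := fun x => (R x * R x * R x).trace with hτ
  have hτ1 : ContDiffOn ℝ 1 τ Ω :=
    contDiffOn_trace (contDiffOn_matrix_mul (contDiffOn_matrix_mul hR hR) hR)
  have hT1 : ContDiffOn ℝ 1 (fun x => (R x * R x).trace) Ω :=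
    contDiffOn_trace (contDiffOn_matrix_mul hR hR)
  have hpt : ∀ᵐ x ∂μ, ‖n₀ x‖ = 1 ∧ R x = uniaxial (s₀ x) (n₀ x) := by
    filter_upwards [hrep.1.2, hrep.2, hQR] with x h1 h2 h3
    exact ⟨h1, h3 ▸ h2⟩
  -- Characterizes uniaxiality. It holds almost everywhere by the representation and everywhere by
  -- continuity of `R`.
  have hcubic : ∀ x ∈ Ω, (R x * R x).trace ^ 3 = 6 * τ x ^ 2 := by
    refine Measure.eqOn_open_of_ae_eq (μ := (volume : Measure E3)) ?_ hΩ
      (hT1.continuousOn.pow 3) (continuousOn_const.mul (hτ1.continuousOn.pow 2))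
    filter_upwards [hpt] with x hx
    simp only [hτ]
    rw [hx.2, trace_uniaxial_sq _ hx.1, trace_uniaxial_cube _ hx.1]
    ring
  have hpartR : ∀ i j k, IsWeakPartial Ω k (fun x => R x i j) (pd k fun x => R x i j) :=
    fun i j k => ((hQ.1.1 i j).isWeakPartial k).of_contDiffOn hΩ
      (by filter_upwards [hQR] with x hx; rw [hx]) (hR i j)
  have hpartQ : ∀ i j k, IsWeakPartial Ω k (fun x => Q x i j) (pd k fun x => R x i j) :=
    fun i j k => (hpartR i j k).congr (by filter_upwards [hQR] with x hx; rw [hx]) EventuallyEq.rfl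
  -- The sign of `s` is read off from `tr R³ = 2/9 s³`, which is smooth, whereas `s₀` has no
  -- regularity yet.
  set P : E3 → M3 := fun x i j => Real.sign (τ x) * R x i j with hP
  have hPu : ∀ᵐ x ∂μ, ‖n₀ x‖ = 1 ∧ R x = uniaxial (s₀ x) (n₀ x) ∧
      P x = uniaxial |s₀ x| (n₀ x) ∧ Real.sign (τ x) = Real.sign (s₀ x) := by
    filter_upwards [hpt] with x hx
    have h1 : Real.sign (τ x) = Real.sign (s₀ x) := by
      simp only [hτ]
      rw [hx.2, trace_uniaxial_cube _ hx.1, sign_cube]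
    refine ⟨hx.1, hx.2, ?_, h1⟩
    ext i j
    simp only [hP]
    rw [h1, hx.2, sign_mul_uniaxial]
  have hpartP : ∀ i j k, IsWeakPartial Ω k (fun x => P x i j)
      (fun x => Real.sign (τ x) * pd k (fun y => R y i j) x) := fun i j k => by
    refine isWeakPartial_sign_mul hΩ
      (G := fun x => √6 * (81 * ∑ p, ∑ q, |pd k (fun y => R y p q) x|)) hτ1 (hR i j) ?_ ?_ ?_
      (hpartR i j k).1
    · refine continuousOn_const.mul (continuousOn_const.mul ?_)
      exact continuousOn_finsetSum _ fun p _ => continuousOn_finsetSum _ fun q _ =>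
        (contDiffOn_pd (m := 0) hΩ (hR p q) (by simp)).continuousOn.abs
    · intro x hx
      have hd : ∀ i j, DifferentiableAt ℝ (fun y => R y i j) x := fun i j =>
        ((hR i j).contDiffAt (hΩ.mem_nhds hx)).differentiableAt (by simp)
      have h1 := abs_pd_trace_cube_le hd (abs_le_sqrt_trace (hRT x hx)) k
      have h2 := abs_le_sqrt_trace (hRT x hx) i j
      set N := ∑ p, ∑ q, |pd k (fun y => R y p q) x|
      set m := √((R x * R x).trace) with hm
      have hm0 : 0 ≤ m := Real.sqrt_nonneg _
      have hT0 : 0 ≤ (R x * R x).trace := by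
        rw [← sum_sq_eq_trace (hRT x hx)]
        exact Finset.sum_nonneg fun _ _ => Finset.sum_nonneg fun _ _ => sq_nonneg _
      have h3 : m ^ 3 = √6 * |τ x| := by
        have h4 : (m ^ 3) ^ 2 = (√6 * |τ x|) ^ 2 := by
          rw [mul_pow, Real.sq_sqrt (by norm_num), sq_abs, ← hcubic x hx, ← Real.sq_sqrt hT0,
            ← hm, ← pow_mul, ← pow_mul]
        exact (pow_left_inj₀ (by positivity) (by positivity) two_ne_zero).1 h4
      have hN0 : 0 ≤ N := Finset.sum_nonneg fun _ _ => Finset.sum_nonneg fun _ _ => abs_nonneg _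
      rw [abs_mul]
      calc _ ≤ m * (81 * N * m ^ 2) := mul_le_mul h2 h1 (abs_nonneg _) hm0
        _ = 81 * N * m ^ 3 := by ring
        _ = _ := by rw [h3]; ring
    · intro x _
      have : 0 ≤ ∑ p, ∑ q, |pd k (fun y => R y p q) x| :=
        Finset.sum_nonneg fun _ _ => Finset.sum_nonneg fun _ _ => abs_nonneg _
      positivity
  have hPT : ∀ᵐ x ∂μ, IsQTensor (P x) := by
    filter_upwards [hPu] with x hx
    rw [hx.2.2.1]
    exact isQTensor_uniaxial _ hx.1
  have hR6 : ∀ i j, MemLp (fun x => R x i j) 6 μ := fun i j =>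
    (hQ.1.memLp_six hfin hnb i j).ae_eq (by filter_upwards [hQR] with x hx; rw [hx])
  have hsign : ∀ t : ℝ, |Real.sign t| ≤ 1 := fun t => by
    rcases Real.sign_apply_eq t with h | h | h <;> rw [h] <;> norm_num
  have hPadm : Admissible Ω a b c nb P := by
    have hz : ∀ i j, MemW12Zero Ω (fun x => P x i j - uniaxial (sPlus a b c) (nb x) i j) := by
      intro i j
      -- `absMap` sends `Q` to `P` and fixes the boundary datum, because `s₊ > 0`. So `P` inherits
      -- the trace.
      obtain ⟨K, hK⟩ := exists_lipschitzWith_absMap i j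
      have := memW12Zero_lipschitz_comp hΩ hfin (ι := Fin 3 × Fin 3)
        (U := fun p x => Q x p.1 p.2) (V := fun p x => uniaxial (sPlus a b c) (nb x) p.1 p.2)
        (B := 2 * |sPlus a b c|) (by positivity) (fun p => hQ.1.1 _ _)
        (fun p => hQ.1.memW12_boundary _ _)
        (fun p => by filter_upwards [hnb.2] with x hx using abs_uniaxial_le _ hx _ _)
        (fun p => hQ.1.2.2 _ _) hK
      refine this.congr hΩ ?_
      filter_upwards [hPu, hnb.2, hQR] with x hx hn hq
      have e1 := absMap_uniaxial (s₀ x) hx.1 i j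
      have e2 := absMap_uniaxial (sPlus a b c) hn i j
      rw [abs_of_pos hs] at e2
      rw [← hx.2.1, ← hq, ← hx.2.2.1] at e1
      simp only [entries] at e1 e2
      rw [e1, e2]
    refine ⟨fun i j => ?_, hPT, hz⟩
    exact ((hz i j).1.add (hQ.1.memW12_boundary i j)).congr
      (Eventually.of_forall fun x => by simp)
  have hP6 : ∀ i j, MemLp (fun x => P x i j) 6 μ := hPadm.memLp_six hfin hnb
  obtain ⟨i0, -, e0⟩ := energy_eq_ofReal hΩ hL hC hpartQ hQ.1.2.1
    (integrable_bulk (hQ.1.memLp_six hfin hnb) a b c C)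
  obtain ⟨i1, p1, e1⟩ := energy_eq_ofReal hΩ hL hC hpartP hPT (integrable_bulk hP6 a b c C)
  have hle := hQ.2 P hPadm
  rw [e0, e1] at hle
  have hle2 := (ENNReal.ofReal_le_ofReal_iff (integral_nonneg_of_ae p1)).1 hle
  set d : E3 → ℝ := fun x =>
    (1 / 2 * ∑ i, ∑ j, ∑ k, pd k (fun y => R y i j) x ^ 2 + bulk a b c C (Q x) / L)
    - (1 / 2 * ∑ i, ∑ j, ∑ k, (Real.sign (τ x) * pd k (fun y => R y i j) x) ^ 2
      + bulk a b c C (P x) / L) with hd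
  have hdint : ∫ x in Ω, d x ≤ 0 := by
    rw [hd, integral_sub i0 i1]
    linarith
  have hdle : ∀ᵐ x ∂μ, 2 * b ^ 2 / 27 * (|s₀ x| ^ 3 - s₀ x ^ 3) / L ≤ d x := by
    filter_upwards [hPu, hQR] with x hx hq
    have h1 : ∑ i, ∑ j, ∑ k, (Real.sign (τ x) * pd k (fun y => R y i j) x) ^ 2
        ≤ ∑ i, ∑ j, ∑ k, pd k (fun y => R y i j) x ^ 2 := by
      refine Finset.sum_le_sum fun i _ => Finset.sum_le_sum fun j _ =>
        Finset.sum_le_sum fun k _ => ?_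
      rw [mul_pow]
      refine mul_le_of_le_one_left (sq_nonneg _) ?_
      rw [← sq_abs]
      exact pow_le_one₀ (abs_nonneg _) (hsign _)
    have h2 : bulk a b c C (Q x) - bulk a b c C (P x)
        = 2 * b ^ 2 / 27 * (|s₀ x| ^ 3 - s₀ x ^ 3) := by
      rw [hq, hx.2.2.1, hx.2.1]
      unfold bulk
      rw [trace_uniaxial_sq _ hx.1, trace_uniaxial_sq _ hx.1, trace_uniaxial_cube _ hx.1,
        trace_uniaxial_cube _ hx.1, sq_abs]
      ring
    simp only [hd]
    rw [← h2, sub_div]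
    linarith
  have hcube : ∀ t : ℝ, 0 ≤ |t| ^ 3 - t ^ 3 := fun t => by
    have : t ^ 3 ≤ |t| ^ 3 := by rw [← abs_pow]; exact le_abs_self _
    linarith
  have hdpos : 0 ≤ᵐ[μ] d := by
    filter_upwards [hdle] with x hx
    refine le_trans ?_ hx
    have := hcube (s₀ x)
    simp only [Pi.zero_apply]
    positivity
  -- The gain in energy density is nonnegative pointwise and has integral at most zero by
  -- minimality, so it vanishes almost everywhere.
  have hd0 := (integral_eq_zero_iff_of_nonneg_ae hdpos (i0.sub i1)).1
    (le_antisymm hdint (integral_nonneg_of_ae hdpos))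
  filter_upwards [hdle, hd0] with x h1 h2
  rw [h2, Pi.zero_apply] at h1
  have h3 : |s₀ x| ^ 3 - s₀ x ^ 3 ≤ 0 := by
    by_contra hcon
    have : 0 < 2 * b ^ 2 / 27 * (|s₀ x| ^ 3 - s₀ x ^ 3) / L := by
      have := not_le.1 hcon
      positivity
    linarith
  by_contra hneg
  have hneg := not_le.1 hneg
  rw [abs_of_neg hneg] at h3
  have := Odd.pow_neg (n := 3) (by decide) hneg
  have h4 : (-s₀ x) ^ 3 = -(s₀ x ^ 3) := by ring
  rw [h4] at h3
  linarith

/-! ### Weakly differentiable functions with values `±1` -/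

theorem exists_closedBall_subset_of_isTestFunction {U : Set E3} (hU : IsOpen U) {φ : E3 → ℝ}
    (hφ : IsTestFunction U φ) :
    ∀ᶠ n : ℕ in atTop, ∀ x ∈ tsupport φ, Metric.closedBall x (1 / (n + 1 : ℝ)) ⊆ U := by
  obtain ⟨r, hr, hrU⟩ := hφ.2.1.exists_cthickening_subset_open hU hφ.2.2
  filter_upwards [(tendsto_one_div_add_atTop_nhds_zero_nat (𝕜 := ℝ)).eventually_lt_const hr]
    with n hn x hx
  exact ((Metric.closedBall_subset_closedBall hn.le).trans
    (Metric.closedBall_subset_cthickening hx r)).trans hrU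

/-- The weak gradient of `u` is zero. With mollifications `S n` of `u`, the functions `3 S - S³`
tend to `2 u`, while their gradients are `3 (1 - S²) ∇S`. There `∇S` is bounded in `L²` near the
support of `φ`, and `1 - S²` tends to zero boundedly. -/
theorem integral_mul_pd_eq_zero_of_sq_eq_one {U : Set E3} (hU : IsOpen U) (hfin : volume U ≠ ⊤)
    {u w : E3 → ℝ} (hum : AEStronglyMeasurable u (volume.restrict U))
    (hu : ∀ᵐ x ∂(volume.restrict U), u x ^ 2 = 1) {k : Fin 3} (h : IsWeakPartial U k u w)
    {φ : E3 → ℝ} (hφ : IsTestFunction U φ) : ∫ x in U, u x * pd k φ x = 0 := by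
  have : IsFiniteMeasure (volume.restrict U) := ⟨by simpa using hfin.lt_top⟩
  have hu1 : ∀ᵐ x ∂(volume.restrict U), |u x| ≤ 1 := by
    filter_upwards [hu] with x hx
    exact abs_le_one_iff_mul_self_le_one.2 (by nlinarith)
  have hu2 : MemLp u 2 (volume.restrict U) := MemLp.of_bound hum 1 hu1
  have hui : IntegrableOn u U := hu2.integrable (by norm_num)
  have hwi : IntegrableOn w U := h.1.integrable (by norm_num)
  let S : ℕ → E3 → ℝ := fun n => smear U u (moll n)
  have hSc : ∀ n, ContDiff ℝ ∞ (S n) := fun n =>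
    contDiff_smear hU.measurableSet hui (contDiff_moll n) (hasCompactSupport_moll n)
  have hSb : ∀ n x, |S n x| ≤ 1 := fun n x => abs_smear_moll_le zero_le_one hu1 n x
  have hSlim := ae_tendsto_smear_moll hU.measurableSet hui
  let W : ℕ → E3 → ℝ := fun n => smear U w (moll n)
  have hWc : ∀ n, Continuous (W n) := fun n =>
    continuous_smear hU.measurableSet hwi (contDiff_moll n) (hasCompactSupport_moll n)
  have hWle : ∀ n, eLpNorm (W n) 2 (volume.restrict U) ≤ eLpNorm w 2 (volume.restrict U) :=
    fun n => (eLpNorm_mono_measure _ Measure.restrict_le_self).trans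
      (eLpNorm_smear_le hU.measurableSet hwi h.1 (contDiff_moll n) (hasCompactSupport_moll n)
        (moll_nonneg n) (integral_moll n))
  have hW2 : ∀ n, MemLp (W n) 2 (volume.restrict U) := fun n =>
    ⟨(hWc n).aestronglyMeasurable, (hWle n).trans_lt h.1.2⟩
  obtain ⟨B, hB0, hB⟩ := hφ.exists_bound
  -- the cubic `3 t - t ^ 3` is stationary at `±1`
  let F : ℕ → E3 → ℝ := fun n x => 3 * S n x - S n x ^ 3
  let a : ℕ → E3 → ℝ := fun n x => 3 * (1 - S n x ^ 2) * φ x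
  have hFc : ∀ n, ContDiff ℝ ∞ (F n) := fun n =>
    (contDiff_const.mul (hSc n)).sub ((hSc n).pow 3)
  have hac : ∀ n, Continuous (a n) := fun n =>
    (continuous_const.mul (continuous_const.sub ((hSc n).continuous.pow 2))).mul hφ.continuous
  have hab : ∀ n x, |a n x| ≤ 3 * B := fun n x => by
    have h1 := hSb n x
    have h2 : S n x ^ 2 ≤ 1 := (sq_le_one_iff_abs_le_one _).2 h1
    simp only [a]
    rw [abs_mul, abs_mul, abs_of_pos (by norm_num : (0 : ℝ) < 3),
      abs_of_nonneg (by linarith : 0 ≤ 1 - S n x ^ 2)]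
    have := hB x
    nlinarith [abs_nonneg (φ x), sq_nonneg (S n x)]
  have hFb : ∀ n x, |F n x| ≤ 4 := fun n x => by
    have h1 := hSb n x
    refine (abs_sub _ _).trans ?_
    rw [abs_mul, abs_of_pos (by norm_num : (0 : ℝ) < 3), abs_pow]
    have := pow_le_one₀ (n := 3) (abs_nonneg _) h1
    linarith
  have ha0 : Tendsto (fun n => eLpNorm (a n) 2 (volume.restrict U)) atTop (𝓝 0) := by
    have := tendsto_eLpNorm_two_of_bounded (μ := volume.restrict U) (F := a) (f := fun _ => 0)
      (B := 3 * B) (fun n => (hac n).aestronglyMeasurable) aestronglyMeasurable_const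
      (fun n => Eventually.of_forall (hab n)) (Eventually.of_forall fun x => by simp; positivity) ?_
    · simpa using this
    · filter_upwards [hSlim, hu] with x h1 h2
      have h3 : Tendsto (fun n => a n x) atTop (𝓝 (3 * (1 - u x ^ 2) * φ x)) :=
        ((tendsto_const_nhds.sub (h1.pow 2)).const_mul 3).mul_const _
      simpa [h2] using h3
  have hF0 : Tendsto (fun n => eLpNorm (fun x => F n x - 2 * u x) 2 (volume.restrict U)) atTop
      (𝓝 0) := by
    refine tendsto_eLpNorm_two_of_bounded (B := 4)
      (fun n => (hFc n).continuous.aestronglyMeasurable) (hum.const_mul 2)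
      (fun n => Eventually.of_forall (hFb n)) ?_ ?_
    · filter_upwards [hu1] with x hx
      rw [abs_mul, abs_of_pos (by norm_num : (0 : ℝ) < 2)]
      linarith
    · filter_upwards [hSlim, hu] with x h1 h2
      have h3 : Tendsto (fun n => F n x) atTop (𝓝 (3 * u x - u x ^ 3)) :=
        (h1.const_mul 3).sub (h1.pow 3)
      have h4 : 3 * u x - u x ^ 3 = 2 * u x := by linear_combination -u x * h2
      rwa [h4] at h3
  have l1 : Tendsto (fun n => ∫ x in U, F n x * pd k φ x) atTop
      (𝓝 (∫ x in U, 2 * u x * pd k φ x)) :=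
    tendsto_integral_mul_of_tendsto
      (fun n => MemLp.of_bound (hFc n).continuous.aestronglyMeasurable 4
        (Eventually.of_forall (hFb n)))
      (hu2.const_mul 2) ((hφ.pd k).memLp 2 _) hF0
  have l2 : Tendsto (fun n => ∫ x in U, F n x * pd k φ x) atTop (𝓝 0) := by
    have hz : Tendsto (fun n => eLpNorm (a n) 2 (volume.restrict U)
        * eLpNorm w 2 (volume.restrict U)) atTop (𝓝 0) := by
      have := ENNReal.Tendsto.mul_const ha0 (Or.inr h.1.2.ne)
      simpa using this
    -- Cauchy-Schwarz pairs the vanishing factor `a n` with the bounded factor `W n`.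
    have habs : Tendsto (fun n => ENNReal.ofReal |∫ x in U, F n x * pd k φ x|) atTop (𝓝 0) := by
      refine tendsto_of_tendsto_of_tendsto_of_le_of_le' tendsto_const_nhds hz
        (Eventually.of_forall fun n => bot_le) ?_
      filter_upwards [exists_closedBall_subset_of_isTestFunction hU hφ] with n hn
      have e : ∫ x in U, F n x * pd k φ x = - ∫ x in U, a n x * W n x := by
        rw [integral_mul_pd hU ((hFc n).contDiffOn.of_le (by simp)) hφ k]
        congr 1
        refine integral_congr_ae (Eventually.of_forall fun x => ?_)
        by_cases hx : x ∈ tsupport φ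
        · have hd : DifferentiableAt ℝ (S n) x := (hSc n).differentiable (by simp) x
          have h1 : pd k (S n) x = W n x := pd_smear_weak hU hui h (contDiff_moll n)
            (hasCompactSupport_moll n) (support_moll n) (hn x hx)
          have hG : HasDerivAt (fun t : ℝ => 3 * t - t ^ 3) (3 - 3 * S n x ^ 2) (S n x) := by
            have := ((hasDerivAt_id (S n x)).const_mul 3).sub (hasDerivAt_pow 3 (S n x))
            refine this.congr_deriv ?_
            norm_num
          have h2 : pd k (F n) x = (3 - 3 * S n x ^ 2) * W n x := by
            rw [← h1, ← hG.deriv]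
            exact pd_comp (F := fun t : ℝ => 3 * t - t ^ 3) hG.differentiableAt hd
          simp only [a]
          rw [h2]
          ring
        · have := image_eq_zero_of_notMem_tsupport hx
          simp [a, this]
      rw [e, abs_neg]
      exact (abs_integral_mul_le (MemLp.of_bound (hac n).aestronglyMeasurable (3 * B)
        (Eventually.of_forall (hab n))) (hW2 n)).trans (mul_le_mul_right (hWle n) _)
    have := (ENNReal.tendsto_toReal ENNReal.zero_ne_top).comp habs
    rw [tendsto_zero_iff_abs_tendsto_zero]
    refine this.congr fun n => ?_
    simp [ENNReal.toReal_ofReal (abs_nonneg _)]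
  have := tendsto_nhds_unique l1 l2
  simp only [mul_assoc, integral_const_mul] at this
  linarith

/-- Weakly differentiable functions with values `±1` are locally smooth. -/
theorem exists_contDiffOn_rep_of_sq_eq_one {U : Set E3} (hU : IsOpen U) (hfin : volume U ≠ ⊤)
    {u : E3 → ℝ} (hu : ∀ᵐ x ∂(volume.restrict U), u x ^ 2 = 1) (h : MemW12 U u)
    {x₀ : E3} (hx₀ : x₀ ∈ U) :
    ∃ δ > 0, Metric.ball x₀ δ ⊆ U ∧ ∃ v, ContDiffOn ℝ 2 v (Metric.ball x₀ δ) ∧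
      u =ᵐ[volume.restrict (Metric.ball x₀ δ)] v := by
  have : IsFiniteMeasure (volume.restrict U) := ⟨by simpa using hfin.lt_top⟩
  -- With zero weak gradient `u` is harmonic in the sense of distributions, and the regularity
  -- theory for the Poisson equation provides the smooth representative.
  have hl : IsWeakLapl U u (fun _ => 0) := fun φ hφ => by
    have i : ∀ k, Integrable (fun x => u x * pd k (pd k φ) x) (volume.restrict U) := fun k =>
      IsWeakPartial.mul_integrable h.1 ((hφ.pd k).pd k)
    simp only [lapl, Finset.mul_sum, zero_mul, integral_zero]
    rw [integral_finsetSum _ fun k _ => i k]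
    exact Finset.sum_eq_zero fun k _ => integral_mul_pd_eq_zero_of_sq_eq_one hU hfin h.1.1 hu
      (h.isWeakPartial k) (hφ.pd k)
  obtain ⟨δ, hδ, hs, v, hv, hae⟩ := exists_continuousOn_rep hU hfin (h.1.integrable (by norm_num))
    (memLp_const 0) hl hx₀
  refine ⟨δ, hδ, hs, v, ?_, hae⟩
  have := contDiffOn_succ_of_isWeakLapl Metric.isOpen_ball 1 hv contDiffOn_const
    ((hl.mono hs).congr hae EventuallyEq.rfl)
  exact this.of_le (by norm_num)

/-- Products of bounded `C¹` functions with bounded derivatives and `W^{1,2}` functions. -/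
theorem MemW12.mul_contDiffOn {U : Set E3} (hU : IsOpen U) {u g : E3 → ℝ} (hu : MemW12 U u)
    (hg : ContDiffOn ℝ ∞ g U) {B : ℝ} (hgB : ∀ x ∈ U, |g x| ≤ B)
    (hgB' : ∀ k, ∀ x ∈ U, |pd k g x| ≤ B) : MemW12 U (fun x => g x * u x) := by
  have hrestr : ∀ {p : E3 → Prop}, (∀ x ∈ U, p x) → ∀ᵐ x ∂(volume.restrict U), p x := fun hp =>
    (ae_restrict_iff' hU.measurableSet).2 (Eventually.of_forall hp)
  have hmul : ∀ {f w : E3 → ℝ}, ContinuousOn f U → (∀ x ∈ U, |f x| ≤ B) →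
      MemLp w 2 (volume.restrict U) → MemLp (fun x => f x * w x) 2 (volume.restrict U) := by
    intro f w hf hb hw
    refine (hw.const_mul B).mono ((hf.aestronglyMeasurable hU.measurableSet).mul hw.1)
      (hrestr fun x hx => ?_)
    rw [norm_mul, norm_mul]
    exact mul_le_mul_of_nonneg_right ((hb x hx).trans (le_abs_self B)) (norm_nonneg _)
  have hdg : ∀ k, ContinuousOn (pd k g) U := fun k =>
    (contDiffOn_pd (m := 0) hU hg (by simp)).continuousOn
  refine ⟨hmul hg.continuousOn hgB hu.1, fun k => ?_⟩
  obtain ⟨v, hv⟩ := hu.2 k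
  have m1 := hmul hg.continuousOn hgB hv.1
  have m2 := hmul (hdg k) (hgB' k) hu.1
  refine ⟨fun x => g x * v x + pd k g x * u x, m1.add m2, fun φ hφ => ?_⟩
  have h1 := hv.2 _ (hφ.mul_contDiffOn hU hg)
  have e : ∫ x in U, u x * pd k (fun y => g y * φ y) x
      = ∫ x in U, (pd k g x * u x * φ x + g x * u x * pd k φ x) := by
    refine setIntegral_congr_fun hU.measurableSet fun x hx => ?_
    have hgd : DifferentiableAt ℝ g x :=
      (hg.contDiffAt (hU.mem_nhds hx)).differentiableAt (by simp)
    rw [pd_mul hgd (hφ.differentiableAt x)]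
    ring
  rw [e, integral_add (IsWeakPartial.mul_integrable m2 hφ)
    (IsWeakPartial.mul_integrable (hmul hg.continuousOn hgB hu.1) (hφ.pd k))] at h1
  have e2 : ∫ x in U, (g x * v x + pd k g x * u x) * φ x
      = (∫ x in U, v x * (g x * φ x)) + ∫ x in U, pd k g x * u x * φ x := by
    have i1 : Integrable (fun x => v x * (g x * φ x)) (volume.restrict U) :=
      (IsWeakPartial.mul_integrable m1 hφ).congr (Eventually.of_forall fun x => by ring)
    rw [← integral_add i1 (IsWeakPartial.mul_integrable m2 hφ)]
    exact integral_congr_ae (Eventually.of_forall fun x => by ring)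
  rw [e2]
  linarith

/-! ### Regularity of the order parameter and of the director -/

/-- The order parameter of a uniaxial tensor with nonnegative order parameter. -/
noncomputable def order (M : M3) : ℝ := √(3 / 2 * (M * M).trace)

theorem order_uniaxial {s : ℝ} (hs : 0 ≤ s) {n : E3} (hn : ‖n‖ = 1) : order (uniaxial s n) = s := by
  rw [order, trace_uniaxial_sq s hn, ← mul_assoc]
  norm_num
  exact Real.sqrt_sq hs

theorem continuousOn_order {U : Set E3} {R : E3 → M3}
    (hR : ∀ i j, ContinuousOn (fun x => R x i j) U) : ContinuousOn (fun x => order (R x)) U := by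
  have h0 : ∀ i j, ContDiffOn ℝ 0 (fun x => R x i j) U := fun i j => contDiffOn_zero.2 (hR i j)
  exact (continuousOn_const.mul
    (contDiffOn_trace (contDiffOn_matrix_mul h0 h0)).continuousOn).sqrt

theorem contDiffOn_order {n : ℕ∞ω} {U : Set E3} {R : E3 → M3}
    (hR : ∀ i j, ContDiffOn ℝ n (fun x => R x i j) U) (h0 : ∀ x ∈ U, order (R x) ≠ 0) :
    ContDiffOn ℝ n (fun x => order (R x)) U := by
  refine (contDiffOn_const.mul (contDiffOn_trace (contDiffOn_matrix_mul hR hR))).sqrt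
    fun x hx h => h0 x hx ?_
  rw [order, h, Real.sqrt_zero]

theorem isOpen_anisotropicSet {Ω : Set E3} (hΩ : IsOpen Ω) {s : E3 → ℝ} (hs : ContinuousOn s Ω) :
    IsOpen (anisotropicSet Ω s) :=
  hs.isOpen_inter_preimage hΩ isOpen_ne

/-- The smooth tensor `P = n₀ ⊗ n₀` fixes `n₀` up to sign. As `tr P = 1`, some `P j j` is positive
near `x₀`. There `σ = n₀ⱼ / √(P j j)` is a `W^{1,2}` function with values `±1`, hence smooth after
modification, and `n₀ᵢ = σ P i j / √(P j j)`. This is where weak differentiability of the director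
is essential. -/
theorem exists_local_director {A : Set E3} (hA : IsOpen A) {P : E3 → M3} {n₀ : E3 → E3}
    (hP : ∀ i j, ContDiffOn ℝ ∞ (fun x => P x i j) A) (htr : ∀ x ∈ A, (P x).trace = 1)
    (hn₀ : ∀ j, MemW12 A fun x => n₀ x j)
    (hPn : ∀ᵐ x ∂(volume.restrict A), ∀ i j, P x i j = n₀ x i * n₀ x j) {x₀ : E3} (hx₀ : x₀ ∈ A) :
    ∃ δ > 0, Metric.ball x₀ δ ⊆ A ∧ ∃ v : E3 → E3, ContDiffOn ℝ 2 v (Metric.ball x₀ δ) ∧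
      n₀ =ᵐ[volume.restrict (Metric.ball x₀ δ)] v := by
  obtain ⟨j, hj⟩ : ∃ j, 0 < P x₀ j j := by
    by_contra hcon
    push Not at hcon
    have h1 := htr x₀ hx₀
    rw [Matrix.trace] at h1
    have : ∑ i, (P x₀).diag i ≤ 0 := Finset.sum_nonpos fun i _ => hcon i
    linarith
  have hpos : ∀ᶠ x in 𝓝 x₀, 0 < P x j j ∧ x ∈ A :=
    (((hP j j).continuousOn.continuousAt (hA.mem_nhds hx₀)).eventually_const_lt hj).and
      (hA.mem_nhds hx₀)
  obtain ⟨ε, hε, hεs⟩ := Metric.eventually_nhds_iff_ball.1 hpos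
  set B := Metric.ball x₀ ε
  have hBA : B ⊆ A := fun x hx => (hεs x hx).2
  have hg : ContDiffOn ℝ ∞ (fun x => (√(P x j j))⁻¹) B := by
    refine ContDiffOn.inv (((hP j j).mono hBA).sqrt fun x hx => (hεs x hx).1.ne') fun x hx => ?_
    exact (Real.sqrt_pos.2 (hεs x hx).1).ne'
  set g : E3 → ℝ := fun x => (√(P x j j))⁻¹
  -- On the compact smaller ball the factor `g` and its derivatives are bounded, so multiplication
  -- by `g` preserves `W^{1,2}`.
  have hcb : Metric.closedBall x₀ (ε / 2) ⊆ B := Metric.closedBall_subset_ball (by linarith)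
  have hsub : Metric.ball x₀ (ε / 2) ⊆ B := Metric.ball_subset_closedBall.trans hcb
  have hbound : ∀ f : E3 → ℝ, ContinuousOn f B → ∃ C, ∀ x ∈ Metric.ball x₀ (ε / 2), |f x| ≤ C := by
    intro f hf
    obtain ⟨C, hC⟩ := (isCompact_closedBall x₀ (ε / 2)).exists_bound_of_continuousOn (hf.mono hcb)
    exact ⟨C, fun x hx => hC x (Metric.ball_subset_closedBall hx)⟩
  obtain ⟨C0, hC0⟩ := hbound g hg.continuousOn
  choose C1 hC1 using fun k => hbound (pd k g)
    (contDiffOn_pd (m := 0) Metric.isOpen_ball hg (by simp)).continuousOn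
  have hb : ∃ C, C0 ≤ C ∧ ∀ k, C1 k ≤ C :=
    ⟨max C0 (∑ k, |C1 k|), le_max_left _ _, fun k => le_trans (le_trans (le_abs_self _)
      (Finset.single_le_sum (f := fun k => |C1 k|) (fun _ _ => abs_nonneg _) (Finset.mem_univ k)))
      (le_max_right _ _)⟩
  obtain ⟨C, hCC0, hCC1⟩ := hb
  have hmono : ∀ {u : E3 → ℝ}, MemW12 A u → MemW12 (Metric.ball x₀ (ε / 2)) u := fun hu =>
    ⟨hu.1.mono_measure (Measure.restrict_mono_set _ (hsub.trans hBA)),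
      fun k => ⟨_, (hu.isWeakPartial k).mono (hsub.trans hBA)⟩⟩
  have hσ : MemW12 (Metric.ball x₀ (ε / 2)) (fun x => g x * n₀ x j) :=
    (hmono (hn₀ j)).mul_contDiffOn Metric.isOpen_ball (hg.mono hsub)
      (fun x hx => (hC0 x hx).trans hCC0) fun k x hx => (hC1 k x hx).trans (hCC1 k)
  have hPn' : ∀ {V : Set E3}, V ⊆ A → ∀ᵐ x ∂(volume.restrict V),
      ∀ i j, P x i j = n₀ x i * n₀ x j := fun hV => ae_restrict_of_ae_restrict_of_subset hV hPn
  have hmem : ∀ V : Set E3, IsOpen V → ∀ᵐ x ∂(volume.restrict V), x ∈ V := fun V hV =>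
    ae_restrict_mem hV.measurableSet
  have hgsq : ∀ x ∈ B, g x ^ 2 * P x j j = 1 := fun x hx => by
    simp only [g]
    rw [inv_pow, Real.sq_sqrt (hεs x hx).1.le, inv_mul_cancel₀ (hεs x hx).1.ne']
  have hσ1 : ∀ᵐ x ∂(volume.restrict (Metric.ball x₀ (ε / 2))), (g x * n₀ x j) ^ 2 = 1 := by
    filter_upwards [hPn' (hsub.trans hBA), hmem _ Metric.isOpen_ball] with x h1 h2
    rw [mul_pow, sq (n₀ x j), ← h1 j j, hgsq x (hsub h2)]
  obtain ⟨δ, hδ, hs, v, hv, hae⟩ := exists_contDiffOn_rep_of_sq_eq_one Metric.isOpen_ball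
    Metric.isBounded_ball.measure_lt_top.ne hσ1 hσ (Metric.mem_ball_self (half_pos hε))
  have hsB : Metric.ball x₀ δ ⊆ B := hs.trans hsub
  refine ⟨δ, hδ, hsB.trans hBA, fun x => WithLp.toLp 2 fun i => v x * (P x i j * g x), ?_, ?_⟩
  · rw [contDiffOn_euclidean]
    intro i
    exact hv.mul ((((hP i j).mono (hsB.trans hBA)).mul (hg.mono hsB)).of_le
      (WithTop.coe_le_coe.2 (le_top : (2 : ℕ∞) ≤ ⊤)))
  · filter_upwards [hPn' (hsB.trans hBA), hmem _ Metric.isOpen_ball, hae] with x h1 h2 h3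
    ext i
    simp only []
    have h4 := hgsq x (hsB h2)
    rw [← h3, h1 i j]
    rw [h1 j j] at h4
    linear_combination -(n₀ x i) * h4

/-- The local `C²` representatives represent the same function `n₀`, so they glue without any sign
ambiguity or topological condition on the anisotropic set. -/
theorem exists_director {Ω : Set E3} (hΩ : IsOpen Ω) {R : E3 → M3}
    (hR : ∀ i j, ContDiffOn ℝ ∞ (fun x => R x i j) Ω) (hRT : ∀ x ∈ Ω, IsQTensor (R x))
    {s₀ : E3 → ℝ} {n₀ : E3 → E3} (hrep : IsUniaxialRep Ω R s₀ n₀)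
    (hs₀ : ∀ᵐ x ∂(volume.restrict Ω), 0 ≤ s₀ x) :
    ∃ n : E3 → E3, n =ᵐ[volume.restrict Ω] n₀ ∧ (∀ x, ‖n x‖ = 1) ∧
      ContDiffOn ℝ 2 n (anisotropicSet Ω fun x => order (R x)) ∧
      ∀ x ∈ anisotropicSet Ω (fun x => order (R x)), R x = uniaxial (order (R x)) (n x) := by
  classical
  set s : E3 → ℝ := fun x => order (R x) with hs
  set A := anisotropicSet Ω s with hAdef
  have hsc : ContinuousOn s Ω := continuousOn_order fun i j => (hR i j).continuousOn
  have hA : IsOpen A := isOpen_anisotropicSet hΩ hsc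
  have hAΩ : A ⊆ Ω := fun x hx => hx.1
  have hs0 : ∀ x ∈ A, s x ≠ 0 := fun x hx => hx.2
  have hRA : ∀ i j, ContDiffOn ℝ ∞ (fun x => R x i j) A := fun i j => (hR i j).mono hAΩ
  have hsA : ContDiffOn ℝ ∞ s A := contDiffOn_order hRA hs0
  have hpt : ∀ᵐ x ∂(volume.restrict A), ‖n₀ x‖ = 1 ∧ R x = uniaxial (s x) (n₀ x) := by
    refine ae_restrict_of_ae_restrict_of_subset hAΩ ?_
    filter_upwards [hrep.1.2, hrep.2, hs₀] with x h1 h2 h3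
    refine ⟨h1, ?_⟩
    simp only [hs]
    rw [h2, order_uniaxial h3 h1]
  let P : E3 → M3 := fun x i j => (s x)⁻¹ * R x i j + if i = j then 1 / 3 else 0
  have hP : ∀ i j, ContDiffOn ℝ ∞ (fun x => P x i j) A := fun i j =>
    ((hsA.inv hs0).mul (hRA i j)).add contDiffOn_const
  have htr : ∀ x ∈ A, (P x).trace = 1 := fun x hx => by
    have := (hRT x hx.1).2
    simp only [Matrix.trace, Matrix.diag, P, Finset.sum_add_distrib, ← Finset.mul_sum] at this ⊢
    rw [this]; simp
  have hPn : ∀ᵐ x ∂(volume.restrict A), ∀ i j, P x i j = n₀ x i * n₀ x j := by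
    filter_upwards [hpt, ae_restrict_mem hA.measurableSet] with x hx hxA i j
    simp only [P]
    rw [hx.2, uniaxial, ← mul_assoc, inv_mul_cancel₀ (hs0 x hxA)]
    ring
  have hn₀ : ∀ j, MemW12 A fun x => n₀ x j := fun j =>
    ⟨(hrep.1.1 j).1.mono_measure (Measure.restrict_mono_set _ hAΩ),
      fun k => ⟨_, ((hrep.1.1 j).isWeakPartial k).mono hAΩ⟩⟩
  obtain ⟨N, hN, hNae⟩ := exists_contDiffOn_rep_of_local hA fun x₀ hx₀ =>
    exists_local_director hA hP htr hn₀ hPn hx₀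
  have hN1 : ∀ x ∈ A, ‖N x‖ = 1 := by
    refine Measure.eqOn_open_of_ae_eq (μ := (volume : Measure E3)) ?_ hA hN.continuousOn.norm
      continuousOn_const
    filter_upwards [hpt, hNae] with x h1 h2
    rw [← h2, h1.1]
  -- Off the anisotropic set nothing determines the director. It keeps the given value, repaired by
  -- a fixed unit vector on a null set of `Ω` and outside `Ω`.
  let n : E3 → E3 := fun x => if x ∈ A then N x else if ‖n₀ x‖ = 1 then n₀ x else ek 0
  have hnA : ∀ x ∈ A, n x = N x := fun x hx => if_pos hx
  refine ⟨n, ?_, ?_, hN.congr hnA, ?_⟩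
  · have h1 : ∀ᵐ x ∂(volume.restrict Ω), x ∈ A → n₀ x = N x := by
      have h2 := (ae_restrict_iff' hA.measurableSet).1 hNae
      exact ae_restrict_of_ae h2
    filter_upwards [h1, hrep.1.2] with x h1 h2
    by_cases hx : x ∈ A
    · rw [hnA x hx, h1 hx]
    · simp [n, hx, h2]
  · intro x
    by_cases hx : x ∈ A
    · rw [hnA x hx, hN1 x hx]
    · simp only [n, if_neg hx]
      split_ifs with h
      · exact h
      · simp [ek]
  · intro x hx
    ext i j
    refine Measure.eqOn_open_of_ae_eq (μ := (volume : Measure E3)) (f := fun x => R x i j)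
      (g := fun x => uniaxial (s x) (n x) i j) ?_ hA (hRA i j).continuousOn ?_ hx
    · filter_upwards [hpt, hNae, ae_restrict_mem hA.measurableSet] with y h1 h2 h3
      rw [hnA y h3, ← h2, ← h1.2]
    · have hc : ContinuousOn n A := (hN.congr hnA).continuousOn
      have hci : ∀ i, ContinuousOn (fun x => n x i) A := fun i =>
        (EuclideanSpace.proj i : E3 →L[ℝ] ℝ).continuous.comp_continuousOn hc
      exact hsA.continuousOn.mul (((hci i).mul (hci j)).sub continuousOn_const)

/-! ### The equations for the order parameter and the director -/

section calculus

variable {U : Set E3} {f g : E3 → ℝ} {x : E3}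

theorem differentiableAt_of_contDiffOn {n : ℕ∞ω} (hU : IsOpen U) (hf : ContDiffOn ℝ n f U)
    (hn : n ≠ 0) (hx : x ∈ U) : DifferentiableAt ℝ f x :=
  (hf.contDiffAt (hU.mem_nhds hx)).differentiableAt hn

theorem contDiffOn_pd_two (hU : IsOpen U) (hf : ContDiffOn ℝ 2 f U) (k : Fin 3) :
    ContDiffOn ℝ 1 (pd k f) U :=
  contDiffOn_pd hU hf (by norm_num)

theorem pd_pd_mul (hU : IsOpen U) (hf : ContDiffOn ℝ 2 f U) (hg : ContDiffOn ℝ 2 g U)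
    (hx : x ∈ U) (k : Fin 3) :
    pd k (pd k fun y => f y * g y) x
      = pd k (pd k f) x * g x + 2 * (pd k f x * pd k g x) + f x * pd k (pd k g) x := by
  have df : ∀ y ∈ U, DifferentiableAt ℝ f y := fun y hy =>
    differentiableAt_of_contDiffOn hU hf (by simp) hy
  have dg : ∀ y ∈ U, DifferentiableAt ℝ g y := fun y hy =>
    differentiableAt_of_contDiffOn hU hg (by simp) hy
  have df1 := differentiableAt_of_contDiffOn hU (contDiffOn_pd_two hU hf k) (by simp) hx
  have dg1 := differentiableAt_of_contDiffOn hU (contDiffOn_pd_two hU hg k) (by simp) hx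
  rw [pd_congr_on hU (fun y hy => pd_mul (df y hy) (dg y hy)) hx,
    pd_add (df1.fun_mul (dg x hx)) ((df x hx).fun_mul dg1), pd_mul df1 (dg x hx),
    pd_mul (df x hx) dg1]
  ring

theorem lapl_mul (hU : IsOpen U) (hf : ContDiffOn ℝ 2 f U) (hg : ContDiffOn ℝ 2 g U)
    (hx : x ∈ U) :
    lapl (fun y => f y * g y) x
      = lapl f x * g x + 2 * ∑ k, pd k f x * pd k g x + f x * lapl g x := by
  simp only [lapl, pd_pd_mul hU hf hg hx, Finset.sum_add_distrib, Finset.sum_mul, Finset.mul_sum]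

theorem pd_sub_const (k : Fin 3) (f : E3 → ℝ) (c : ℝ) : pd k (fun y => f y - c) = pd k f := by
  ext y
  simp [pd, fderiv_sub_const]

theorem lapl_sub_const (f : E3 → ℝ) (c : ℝ) (x : E3) : lapl (fun y => f y - c) x = lapl f x := by
  simp only [lapl, pd_sub_const]

theorem lapl_congr_on (hU : IsOpen U) (h : ∀ y ∈ U, f y = g y) (hx : x ∈ U) :
    lapl f x = lapl g x :=
  Finset.sum_congr rfl fun _ _ => pd_congr_on hU (fun _ hy => pd_congr_on hU h hy) hx

theorem lapl_sum {ι : Type*} {s : Finset ι} {f : ι → E3 → ℝ} (hU : IsOpen U)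
    (hf : ∀ i, ContDiffOn ℝ 2 (f i) U) (hx : x ∈ U) :
    lapl (fun y => ∑ i ∈ s, f i y) x = ∑ i ∈ s, lapl (f i) x := by
  simp only [lapl]
  rw [Finset.sum_comm]
  refine Finset.sum_congr rfl fun k _ => ?_
  rw [pd_congr_on hU (fun y hy => pd_sum fun i _ =>
    differentiableAt_of_contDiffOn hU (hf i) (by simp) hy) hx]
  exact pd_sum fun i _ =>
    differentiableAt_of_contDiffOn hU (contDiffOn_pd_two hU (hf i) k) (by simp) hx

theorem pd_sin (hf : DifferentiableAt ℝ f x) (k : Fin 3) :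
    pd k (fun y => Real.sin (f y)) x = Real.cos (f x) * pd k f x := by
  rw [pd_comp Real.differentiableAt_sin hf, Real.deriv_sin]

theorem pd_cos (hf : DifferentiableAt ℝ f x) (k : Fin 3) :
    pd k (fun y => Real.cos (f y)) x = -Real.sin (f x) * pd k f x := by
  rw [pd_comp Real.differentiableAt_cos hf, Real.deriv_cos]

theorem lapl_sin (hU : IsOpen U) (hf : ContDiffOn ℝ 2 f U) (hx : x ∈ U) :
    lapl (fun y => Real.sin (f y)) x
      = Real.cos (f x) * lapl f x - Real.sin (f x) * ∑ k, pd k f x ^ 2 := by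
  have df : ∀ y ∈ U, DifferentiableAt ℝ f y := fun y hy =>
    differentiableAt_of_contDiffOn hU hf (by simp) hy
  simp only [lapl, Finset.mul_sum, ← Finset.sum_sub_distrib]
  refine Finset.sum_congr rfl fun k _ => ?_
  rw [pd_congr_on hU (fun y hy => pd_sin (df y hy) k) hx, pd_mul (df x hx).cos
    (differentiableAt_of_contDiffOn hU (contDiffOn_pd_two hU hf k) (by simp) hx), pd_cos (df x hx)]
  ring

theorem lapl_cos (hU : IsOpen U) (hf : ContDiffOn ℝ 2 f U) (hx : x ∈ U) :
    lapl (fun y => Real.cos (f y)) x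
      = -Real.sin (f x) * lapl f x - Real.cos (f x) * ∑ k, pd k f x ^ 2 := by
  have df : ∀ y ∈ U, DifferentiableAt ℝ f y := fun y hy =>
    differentiableAt_of_contDiffOn hU hf (by simp) hy
  simp only [lapl, Finset.mul_sum, ← Finset.sum_sub_distrib]
  refine Finset.sum_congr rfl fun k _ => ?_
  rw [pd_congr_on hU (fun y hy => pd_cos (df y hy) k) hx, pd_mul (df x hx).sin.fun_neg
    (differentiableAt_of_contDiffOn hU (contDiffOn_pd_two hU hf k) (by simp) hx), pd_neg,
    pd_sin (df x hx)]
  ring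

theorem divGrad_eq {w : E3 → ℝ} (hU : IsOpen U) (hw : ContDiffOn ℝ 2 w U) (hf : ContDiffOn ℝ 2 f U)
    (hx : x ∈ U) : divGrad w f x = (∑ k, pd k w x * pd k f x) + w x * lapl f x := by
  simp only [divGrad, lapl, Finset.mul_sum, ← Finset.sum_add_distrib]
  refine Finset.sum_congr rfl fun k _ => ?_
  exact pd_mul (differentiableAt_of_contDiffOn hU hw (by simp) hx)
    (differentiableAt_of_contDiffOn hU (contDiffOn_pd_two hU hf k) (by simp) hx)

end calculus

/-- The square of a uniaxial tensor is a multiple of the tensor plus a multiple of the identity, and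
`qUnit i j` is traceless. So the bulk force is parallel to the tensor itself. -/
theorem bulkDeriv_uniaxial (a b c s : ℝ) {n : E3} (hn : ‖n‖ = 1) (i j : Fin 3) :
    bulkDeriv a b c (uniaxial s n) (qUnit i j)
      = (-a ^ 2 - b ^ 2 * s / 3 + 2 / 3 * c ^ 2 * s ^ 2) * uniaxial s n i j := by
  have hT := isQTensor_uniaxial s hn
  have h1 : (uniaxial s n * qUnit i j).trace = uniaxial s n i j := by
    rw [← sum_qUnit_mul hT i j, Matrix.trace_mul_comm]
    simp only [Matrix.trace, Matrix.diag, Matrix.mul_apply]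
    refine Finset.sum_congr rfl fun p _ => Finset.sum_congr rfl fun q _ => ?_
    rw [show uniaxial s n q p = uniaxial s n p q from congrFun (congrFun hT.1 p) q]
  have h2 : (uniaxial s n * uniaxial s n * qUnit i j).trace = s / 3 * uniaxial s n i j := by
    rw [uniaxial_mul_self s hn, Matrix.add_mul, Matrix.smul_mul, Matrix.smul_mul, Matrix.one_mul,
      Matrix.trace_add, Matrix.trace_smul, Matrix.trace_smul, h1, (isQTensor_qUnit i j).2]
    simp
  rw [bulkDeriv, h1, h2, trace_uniaxial_sq s hn]
  ring

/-- Contraction of the tensor equation with the director. -/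
theorem contract_director {s S l : ℝ} {n N σ : Fin 3 → ℝ} {D : Fin 3 → Fin 3 → ℝ}
    (hs : s ≠ 0)
    (h : ∀ i j, S * (n i * n j - if i = j then 1 / 3 else 0)
      + 2 * ∑ k, σ k * (D i k * n j + n i * D j k)
      + s * (N i * n j + 2 * ∑ k, D i k * D j k + n i * N j)
      = l * (s * (n i * n j - if i = j then 1 / 3 else 0)))
    (h1 : ∑ i, n i * n i = 1) (h2 : ∀ k, ∑ i, n i * D i k = 0)
    (h3 : ∑ i, n i * N i = -∑ i, ∑ k, D i k ^ 2) :
    S - 3 * s * ∑ i, ∑ k, D i k ^ 2 = l * s ∧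
      ∀ i, N i + (∑ i, ∑ k, D i k ^ 2) * n i + 2 * ∑ k, σ k / s * D i k = 0 := by
  obtain ⟨e1, e2, e3, e4, e5, e6⟩ := fin_three_ne
  set G := ∑ i, ∑ k, D i k ^ 2
  -- Contraction of `h` with `n j`. The terms containing `∑ n j * D j k` vanish, and `∑ n j * N j =
  -- -G`.
  have key : ∀ i, 2 / 3 * S * n i + s * N i - s * G * n i + 2 * ∑ k, σ k * D i k
      = 2 / 3 * l * s * n i := by
    have h20 := h2 0
    have h21 := h2 1
    have h22 := h2 2
    clear_value G
    simp only [Fin.sum_univ_three] at h1 h20 h21 h22 h3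
    have hexp : ∀ i, S * (n i * (n 0 * n 0 + n 1 * n 1 + n 2 * n 2) - n i / 3)
        + s * (N i * (n 0 * n 0 + n 1 * n 1 + n 2 * n 2)
          + n i * (n 0 * N 0 + n 1 * N 1 + n 2 * N 2))
        + 2 * (σ 0 * (D i 0 * (n 0 * n 0 + n 1 * n 1 + n 2 * n 2)
              + n i * (n 0 * D 0 0 + n 1 * D 1 0 + n 2 * D 2 0))
          + σ 1 * (D i 1 * (n 0 * n 0 + n 1 * n 1 + n 2 * n 2)
              + n i * (n 0 * D 0 1 + n 1 * D 1 1 + n 2 * D 2 1))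
          + σ 2 * (D i 2 * (n 0 * n 0 + n 1 * n 1 + n 2 * n 2)
              + n i * (n 0 * D 0 2 + n 1 * D 1 2 + n 2 * D 2 2)))
        + 2 * s * (D i 0 * (n 0 * D 0 0 + n 1 * D 1 0 + n 2 * D 2 0)
          + D i 1 * (n 0 * D 0 1 + n 1 * D 1 1 + n 2 * D 2 1)
          + D i 2 * (n 0 * D 0 2 + n 1 * D 1 2 + n 2 * D 2 2))
        = l * s * (n i * (n 0 * n 0 + n 1 * n 1 + n 2 * n 2) - n i / 3) := by
      simp only [Fin.sum_univ_three, forall_fin_three, if_true, if_neg e1, if_neg e2, if_neg e3,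
        if_neg e4, if_neg e5, if_neg e6] at h ⊢
      obtain ⟨⟨a0, a1, a2⟩, ⟨b0, b1, b2⟩, ⟨c0, c1, c2⟩⟩ := h
      refine ⟨?_, ?_, ?_⟩
      · linear_combination n 0 * a0 + n 1 * a1 + n 2 * a2
      · linear_combination n 0 * b0 + n 1 * b1 + n 2 * b2
      · linear_combination n 0 * c0 + n 1 * c1 + n 2 * c2
    intro i
    have hi := hexp i
    rw [h1, h20, h21, h22, h3] at hi
    rw [Fin.sum_univ_three]
    linear_combination hi
  -- A second contraction, with `n i`, isolates the scalar equation: one `s G` comes from `n · N`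
  -- and one is already present in `key`. Eliminating `S` from `key` then gives the director
  -- equation.
  have hS : S - 3 * s * G = l * s := by
    have hσ : ∑ i, n i * ∑ k, σ k * D i k = 0 := by
      have : ∑ i, n i * ∑ k, σ k * D i k = ∑ k, σ k * ∑ i, n i * D i k := by
        simp only [Finset.mul_sum]
        rw [Finset.sum_comm]
        exact Finset.sum_congr rfl fun _ _ => Finset.sum_congr rfl fun _ _ => by ring
      rw [this]
      exact Finset.sum_eq_zero fun k _ => by rw [h2 k, mul_zero]
    have hsum : ∑ i, n i * (2 / 3 * S * n i + s * N i - s * G * n i + 2 * ∑ k, σ k * D i k)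
        = ∑ i, n i * (2 / 3 * l * s * n i) :=
      Finset.sum_congr rfl fun i _ => by rw [key i]
    have hl : ∑ i, n i * (2 / 3 * S * n i + s * N i - s * G * n i + 2 * ∑ k, σ k * D i k)
        = (2 / 3 * S - s * G) * ∑ i, n i * n i + s * ∑ i, n i * N i
          + 2 * ∑ i, n i * ∑ k, σ k * D i k := by
      simp only [Finset.mul_sum (s := Finset.univ) (f := fun i => n i * n i),
        Finset.mul_sum (s := Finset.univ) (f := fun i => n i * N i),
        Finset.mul_sum (s := Finset.univ) (f := fun i => n i * ∑ k, σ k * D i k),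
        ← Finset.sum_add_distrib]
      exact Finset.sum_congr rfl fun i _ => by ring
    have hr : ∑ i, n i * (2 / 3 * l * s * n i) = 2 / 3 * l * s * ∑ i, n i * n i := by
      rw [Finset.mul_sum]
      exact Finset.sum_congr rfl fun i _ => by ring
    rw [hl, hr, h1, h3, hσ] at hsum
    linarith
  refine ⟨hS, fun i => ?_⟩
  have hd : ∑ k, σ k / s * D i k = (∑ k, σ k * D i k) / s := by
    rw [Finset.sum_div]
    exact Finset.sum_congr rfl fun k _ => by ring
  rw [hd]
  have hi := key i
  field_simp
  linear_combination hi - 2 / 3 * n i * hS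

section equations

variable {A : Set E3} {s : E3 → ℝ} {n : E3 → E3}

theorem contDiffOn_coord {m : ℕ∞ω} (hn : ContDiffOn ℝ m n A) (j : Fin 3) :
    ContDiffOn ℝ m (fun y => n y j) A :=
  (contDiffOn_euclidean.1 hn) j

/-- `|n|² = 1` together with its first derivatives and its Laplacian. -/
theorem unit_constraints (hA : IsOpen A) (hn : ContDiffOn ℝ 2 n A) (h1 : ∀ x ∈ A, ‖n x‖ = 1)
    {x : E3} (hx : x ∈ A) :
    (∑ i, n x i * n x i = 1) ∧ (∀ k, ∑ i, n x i * pd k (fun y => n y i) x = 0) ∧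
      ∑ i, n x i * lapl (fun y => n y i) x = -∑ i, ∑ k, pd k (fun y => n y i) x ^ 2 := by
  have hc := contDiffOn_coord hn
  have hd : ∀ i, DifferentiableAt ℝ (fun y => n y i) x := fun i =>
    differentiableAt_of_contDiffOn hA (hc i) (by simp) hx
  have hsum : ∀ y ∈ A, ∑ i, n y i * n y i = 1 := fun y hy => by
    have := EuclideanSpace.real_norm_sq_eq (n y)
    rw [h1 y hy] at this
    simp only [← sq]
    linarith
  refine ⟨hsum x hx, fun k => ?_, ?_⟩
  · have h2 := pd_congr_on (k := k) hA hsum hx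
    rw [pd_const, pd_sum fun i _ => (hd i).fun_mul (hd i)] at h2
    have : ∀ i, pd k (fun y => n y i * n y i) x = 2 * (n x i * pd k (fun y => n y i) x) :=
      fun i => by rw [pd_mul (hd i) (hd i)]; ring
    simp only [this, ← Finset.mul_sum] at h2
    linarith
  · have h2 := lapl_congr_on hA hsum hx
    rw [lapl_sum hA (fun i => (hc i).mul (hc i)) hx] at h2
    have h3 : lapl (fun _ => (1 : ℝ)) x = 0 := by
      have : ∀ k, pd k (fun _ : E3 => (1 : ℝ)) = fun _ => 0 := fun k => by ext y; simp
      simp [lapl, this]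
    have h4 : ∀ i, lapl (fun y => n y i * n y i) x = 2 * (n x i * lapl (fun y => n y i) x)
        + 2 * ∑ k, pd k (fun y => n y i) x ^ 2 := fun i => by
      rw [lapl_mul hA (hc i) (hc i) hx]
      simp only [sq]
      ring
    rw [h3] at h2
    simp only [h4, Finset.sum_add_distrib, ← Finset.mul_sum] at h2
    linarith

theorem order_director_equations (hA : IsOpen A) (hs : ContDiffOn ℝ 2 s A)
    (hn : ContDiffOn ℝ 2 n A) (h1 : ∀ x ∈ A, ‖n x‖ = 1) {a b c L : ℝ}
    (heq : ∀ i j, ∀ x ∈ A, lapl (fun y => uniaxial (s y) (n y) i j) x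
      = bulkDeriv a b c (uniaxial (s x) (n x)) (qUnit i j) / L)
    {x : E3} (hx : x ∈ A) (h0 : s x ≠ 0) :
    lapl s x - 3 * s x * vecGradSq n x
        = s x / (3 * L) * (2 * c ^ 2 * s x ^ 2 - b ^ 2 * s x - 3 * a ^ 2) ∧
      ∀ j, lapl (fun y => n y j) x + vecGradSq n x * n x j
        + 2 * ∑ k, pd k s x / s x * pd k (fun y => n y j) x = 0 := by
  have hc := contDiffOn_coord hn
  have hd : ∀ i, DifferentiableAt ℝ (fun y => n y i) x := fun i =>
    differentiableAt_of_contDiffOn hA (hc i) (by simp) hx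
  obtain ⟨c1, c2, c3⟩ := unit_constraints hA hn h1 hx
  have key := contract_director (S := lapl s x) (l := (-a ^ 2 - b ^ 2 * s x / 3
    + 2 / 3 * c ^ 2 * s x ^ 2) / L) (n := fun i => n x i) (N := fun i => lapl (fun y => n y i) x)
    (σ := fun k => pd k s x) (D := fun i k => pd k (fun y => n y i) x) h0 (fun i j => ?_) c1 c2 c3
  · refine ⟨key.1.trans ?_, key.2⟩
    simp only [div_eq_mul_inv, mul_inv]
    ring
  · have h2 := heq i j x hx
    rw [bulkDeriv_uniaxial a b c _ (h1 x hx)] at h2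
    unfold uniaxial at h2
    rw [lapl_mul hA hs (((hc i).mul (hc j)).sub contDiffOn_const) hx, lapl_sub_const,
      lapl_mul hA (hc i) (hc j) hx] at h2
    simp only [pd_sub_const, pd_mul (hd i) (hd j)] at h2
    rw [h2]
    ring

/-- The director equation is projected on the polar and azimuthal directions. Multiplication by `s²`
absorbs the term `2 ∇s / s` into a divergence. -/
theorem spherical_equations (hA : IsOpen A) (hs : ContDiffOn ℝ 2 s A) {θ φ : E3 → ℝ}
    (hθ : ContDiffOn ℝ 2 θ A) (hφ : ContDiffOn ℝ 2 φ A)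
    (hrep : ∀ y ∈ A, n y = sphericalVec (θ y) (φ y)) {x : E3} (hx : x ∈ A) (h0 : s x ≠ 0)
    (heq : ∀ j, lapl (fun y => n y j) x + vecGradSq n x * n x j
        + 2 * ∑ k, pd k s x / s x * pd k (fun y => n y j) x = 0) :
    divGrad (fun y => s y ^ 2) θ x
        = s x ^ 2 * Real.sin (θ x) * Real.cos (θ x) * gradSq φ x ∧
      divGrad (fun y => s y ^ 2 * Real.sin (θ y) ^ 2) φ x = 0 := by
  have dθ : DifferentiableAt ℝ θ x := differentiableAt_of_contDiffOn hA hθ (by simp) hx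
  have dφ : DifferentiableAt ℝ φ x := differentiableAt_of_contDiffOn hA hφ (by simp) hx
  have ds : DifferentiableAt ℝ s x := differentiableAt_of_contDiffOn hA hs (by simp) hx
  have hsin : ContDiffOn ℝ 2 (fun y => Real.sin (θ y)) A := hθ.sin
  have e0 : ∀ y ∈ A, n y 0 = Real.sin (θ y) * Real.cos (φ y) := fun y hy => by
    rw [hrep y hy]; simp [sphericalVec]
  have e1 : ∀ y ∈ A, n y 1 = Real.sin (θ y) * Real.sin (φ y) := fun y hy => by
    rw [hrep y hy]; simp [sphericalVec]
  have e2 : ∀ y ∈ A, n y 2 = Real.cos (θ y) := fun y hy => by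
    rw [hrep y hy]; simp [sphericalVec]
  have p0 : ∀ k, pd k (fun y => n y 0) x = Real.cos (θ x) * pd k θ x * Real.cos (φ x)
      + Real.sin (θ x) * (-Real.sin (φ x) * pd k φ x) := fun k => by
    rw [pd_congr_on hA e0 hx, pd_mul dθ.sin dφ.cos, pd_sin dθ, pd_cos dφ]
  have p1 : ∀ k, pd k (fun y => n y 1) x = Real.cos (θ x) * pd k θ x * Real.sin (φ x)
      + Real.sin (θ x) * (Real.cos (φ x) * pd k φ x) := fun k => by
    rw [pd_congr_on hA e1 hx, pd_mul dθ.sin dφ.sin, pd_sin dθ, pd_sin dφ]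
  have p2 : ∀ k, pd k (fun y => n y 2) x = -Real.sin (θ x) * pd k θ x := fun k => by
    rw [pd_congr_on hA e2 hx, pd_cos dθ]
  have q0 := (lapl_congr_on hA e0 hx).trans (lapl_mul hA hsin hφ.cos hx)
  have q1 := (lapl_congr_on hA e1 hx).trans (lapl_mul hA hsin hφ.sin hx)
  have q2 := (lapl_congr_on hA e2 hx).trans (lapl_cos hA hθ hx)
  rw [lapl_sin hA hθ hx, lapl_cos hA hφ hx] at q0
  rw [lapl_sin hA hθ hx, lapl_sin hA hφ hx] at q1
  have h0' := heq 0
  have h1' := heq 1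
  have h2' := heq 2
  rw [q0, e0 x hx] at h0'
  rw [q1, e1 x hx] at h1'
  rw [q2, e2 x hx] at h2'
  rw [divGrad_eq hA (hs.pow 2) hθ hx, divGrad_eq hA ((hs.pow 2).mul (hsin.pow 2)) hφ hx]
  have w1 : ∀ k, pd k (fun y => s y ^ 2) x = 2 * s x * pd k s x := fun k => by
    simp only [sq]; rw [pd_mul ds ds]; ring
  have w2 : ∀ k, pd k (fun y => s y ^ 2 * Real.sin (θ y) ^ 2) x
      = 2 * s x * pd k s x * Real.sin (θ x) ^ 2
        + s x ^ 2 * (2 * Real.sin (θ x) * (Real.cos (θ x) * pd k θ x)) := fun k => by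
    rw [pd_mul (ds.fun_pow 2) (dθ.sin.fun_pow 2), w1 k]
    simp only [sq (Real.sin _)]
    rw [pd_mul dθ.sin dθ.sin, pd_sin dθ]; ring
  have t1 := Real.sin_sq_add_cos_sq (θ x)
  have t2 := Real.sin_sq_add_cos_sq (φ x)
  have hG : vecGradSq n x = gradSq θ x + Real.sin (θ x) ^ 2 * gradSq φ x := by
    have hk : ∀ k, pd k (fun y => n y 0) x ^ 2 + pd k (fun y => n y 1) x ^ 2
        + pd k (fun y => n y 2) x ^ 2 = pd k θ x ^ 2 + Real.sin (θ x) ^ 2 * pd k φ x ^ 2 :=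
      fun k => by
        rw [p0, p1, p2]
        linear_combination (Real.cos (θ x) ^ 2 * pd k θ x ^ 2
          + Real.sin (θ x) ^ 2 * pd k φ x ^ 2) * t2 + pd k θ x ^ 2 * t1
    simp only [vecGradSq, gradSq, Fin.sum_univ_three]
    linear_combination hk 0 + hk 1 + hk 2
  rw [hG] at h0' h1' h2'
  simp only [w1, w2, p0, p1, p2, gradSq, Fin.sum_univ_three, pd_sin dθ, pd_sin dφ, pd_cos dφ]
    at h0' h1' h2' ⊢
  generalize lapl θ x = T at *
  generalize lapl φ x = F at *
  generalize Real.sin (θ x) = st at *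
  generalize Real.cos (θ x) = ct at *
  generalize Real.sin (φ x) = sf at *
  generalize Real.cos (φ x) = cf at *
  generalize s x = r at *
  generalize pd 0 s x = r0 at *
  generalize pd 1 s x = r1 at *
  generalize pd 2 s x = r2 at *
  generalize pd 0 θ x = a0 at *
  generalize pd 1 θ x = a1 at *
  generalize pd 2 θ x = a2 at *
  generalize pd 0 φ x = b0 at *
  generalize pd 1 φ x = b1 at *
  generalize pd 2 φ x = b2 at *
  -- Component along the horizontal vector `(cos φ, sin φ, 0)`; `hY` is the component along `(-sin
  -- φ, cos φ, 0)`.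
  have hX : ct * T - st * (a0 ^ 2 + a1 ^ 2 + a2 ^ 2) - st * (b0 ^ 2 + b1 ^ 2 + b2 ^ 2)
      + (a0 ^ 2 + a1 ^ 2 + a2 ^ 2 + st ^ 2 * (b0 ^ 2 + b1 ^ 2 + b2 ^ 2)) * st
      + 2 * ct * (r0 / r * a0 + r1 / r * a1 + r2 / r * a2) = 0 := by
    linear_combination cf * h0' + sf * h1' - (ct * T - st * (a0 ^ 2 + a1 ^ 2 + a2 ^ 2)
      - st * (b0 ^ 2 + b1 ^ 2 + b2 ^ 2)
      + (a0 ^ 2 + a1 ^ 2 + a2 ^ 2 + st ^ 2 * (b0 ^ 2 + b1 ^ 2 + b2 ^ 2)) * st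
      + 2 * ct * (r0 / r * a0 + r1 / r * a1 + r2 / r * a2)) * t2
  have hY : 2 * ct * (a0 * b0 + a1 * b1 + a2 * b2) + st * F
      + 2 * st * (r0 / r * b0 + r1 / r * b1 + r2 / r * b2) = 0 := by
    linear_combination cf * h1' - sf * h0' - (2 * ct * (a0 * b0 + a1 * b1 + a2 * b2) + st * F
      + 2 * st * (r0 / r * b0 + r1 / r * b1 + r2 / r * b2)) * t2
  -- Component along `∂n/∂θ`, combining `hX` with the vertical equation.
  have hZ : T + 2 * (r0 / r * a0 + r1 / r * a1 + r2 / r * a2)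
      - st * ct * (b0 ^ 2 + b1 ^ 2 + b2 ^ 2) = 0 := by
    linear_combination ct * hX - st * h2'
      - (T + 2 * (r0 / r * a0 + r1 / r * a1 + r2 / r * a2)) * t1
  have hr : ∀ z, r ^ 2 * (z / r) = r * z := fun z => by field_simp
  constructor
  · linear_combination r ^ 2 * hZ - 2 * a0 * hr r0 - 2 * a1 * hr r1 - 2 * a2 * hr r2
  -- The azimuthal equation is multiplied by `sin θ` rather than divided, so it holds at the poles
  -- too.
  · linear_combination r ^ 2 * st * hY
      - 2 * st ^ 2 * (b0 * hr r0 + b1 * hr r1 + b2 * hr r2)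

end equations

/-! ### Local spherical angles -/

/-- The polar angle is `arccos n₃`, smooth off the poles. The azimuth is measured from its value `α`
at `x`, so near `x` it stays in the range where `arcsin` is a smooth inverse. -/
theorem exists_spherical_angles {A : Set E3} (hA : IsOpen A) {n : E3 → E3}
    (hn : ContDiffOn ℝ 2 n A) (h1 : ∀ x ∈ A, ‖n x‖ = 1) {x : E3} (hx : x ∈ A) (hp : |n x 2| < 1) :
    ∃ (U : Set E3) (θ φ : E3 → ℝ), IsOpen U ∧ x ∈ U ∧ U ⊆ A ∧ ContDiffOn ℝ 2 θ U ∧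
      ContDiffOn ℝ 2 φ U ∧ ∀ y ∈ U, n y = sphericalVec (θ y) (φ y) := by
  have hc := contDiffOn_coord hn
  have hsq : ∀ y ∈ A, n y 0 ^ 2 + n y 1 ^ 2 = 1 - n y 2 ^ 2 := fun y hy => by
    linarith [sum_sq_eq_one (h1 y hy)]
  have hx2 : 0 < 1 - n x 2 ^ 2 := by
    have := (sq_lt_one_iff_abs_lt_one _).2 hp
    linarith
  obtain ⟨α, hα0, hα1⟩ : ∃ α : ℝ, n x 0 = √(1 - n x 2 ^ 2) * Real.cos α ∧
      n x 1 = √(1 - n x 2 ^ 2) * Real.sin α := by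
    let z : ℂ := ⟨n x 0, n x 1⟩
    have hz : ‖z‖ = √(1 - n x 2 ^ 2) := by
      rw [← hsq x hx, Complex.norm_def, Complex.normSq_apply]
      simp only [z, sq]
    refine ⟨Complex.arg z, ?_, ?_⟩
    · rw [← hz, Complex.norm_mul_cos_arg]
    · rw [← hz, Complex.norm_mul_sin_arg]
  -- `p` and `q` are the horizontal components of `n` in the frame rotated by `α`; at `x` the
  -- horizontal part lies on the positive `p` axis.
  let p : E3 → ℝ := fun y => n y 0 * Real.cos α + n y 1 * Real.sin α
  let q : E3 → ℝ := fun y => n y 1 * Real.cos α - n y 0 * Real.sin α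
  let ρ : E3 → ℝ := fun y => √(1 - n y 2 ^ 2)
  have hpc : ContDiffOn ℝ 2 p A := ((hc 0).mul contDiffOn_const).add ((hc 1).mul contDiffOn_const)
  have hqc : ContDiffOn ℝ 2 q A := ((hc 1).mul contDiffOn_const).sub ((hc 0).mul contDiffOn_const)
  have hα := Real.sin_sq_add_cos_sq α
  have hpq : ∀ y ∈ A, p y ^ 2 + q y ^ 2 = 1 - n y 2 ^ 2 := fun y hy => by
    rw [← hsq y hy]
    simp only [p, q]
    linear_combination (n y 0 ^ 2 + n y 1 ^ 2) * hα
  -- On `p > 0` the ratio `q / ρ` stays strictly between `-1` and `1`, and the cosine of its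
  -- `arcsin` is `p / ρ` with the right sign.
  let U : Set E3 := A ∩ p ⁻¹' Set.Ioi 0
  have hU : IsOpen U := hpc.continuousOn.isOpen_inter_preimage hA isOpen_Ioi
  have hUA : U ⊆ A := Set.inter_subset_left
  have hxU : x ∈ U := by
    refine ⟨hx, ?_⟩
    have : p x = √(1 - n x 2 ^ 2) := by
      simp only [p]
      rw [hα0, hα1]
      linear_combination √(1 - n x 2 ^ 2) * hα
    rw [Set.mem_preimage, this]
    exact Real.sqrt_pos.2 hx2
  have hpos : ∀ y ∈ U, 0 < 1 - n y 2 ^ 2 := fun y hy => by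
    rw [← hpq y hy.1]
    have : 0 < p y := hy.2
    positivity
  have hρ : ∀ y ∈ U, 0 < ρ y := fun y hy => Real.sqrt_pos.2 (hpos y hy)
  have hρ2 : ∀ y ∈ U, ρ y ^ 2 = 1 - n y 2 ^ 2 := fun y hy => Real.sq_sqrt (hpos y hy).le
  have hρc : ContDiffOn ℝ 2 ρ U :=
    (contDiffOn_const.sub (((hc 2).mono hUA).pow 2)).sqrt fun y hy => (hpos y hy).ne'
  have hq1 : ∀ y ∈ U, (q y / ρ y) ^ 2 + (p y / ρ y) ^ 2 = 1 := fun y hy => by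
    have := (hρ y hy).ne'
    rw [div_pow, div_pow, ← add_div, hρ2 y hy, ← hpq y hy.1, add_comm]
    refine div_self ?_
    rw [hpq y hy.1, ← hρ2 y hy]
    exact pow_ne_zero 2 this
  have hpρ : ∀ y ∈ U, 0 < p y / ρ y := fun y hy => div_pos hy.2 (hρ y hy)
  have habs : ∀ y ∈ U, |q y / ρ y| < 1 := fun y hy => by
    rw [← sq_lt_one_iff_abs_lt_one]
    have h2 := hq1 y hy
    have h3 := pow_pos (hpρ y hy) 2
    linarith
  refine ⟨U, fun y => Real.arccos (n y 2), fun y => α + Real.arcsin (q y / ρ y), hU, hxU, hUA,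
    ?_, ?_, fun y hy => ?_⟩
  · refine ContDiffOn.comp (g := Real.arccos) (t := {-1, 1}ᶜ) Real.contDiffOn_arccos
      ((hc 2).mono hUA) fun y hy => ?_
    have h2 := hpos y hy
    simp only [Set.mem_compl_iff, Set.mem_insert_iff, Set.mem_singleton_iff, not_or]
    constructor <;> intro h3 <;> rw [h3] at h2 <;> norm_num at h2
  · refine contDiffOn_const.add (ContDiffOn.comp (g := Real.arcsin) (t := {-1, 1}ᶜ)
      Real.contDiffOn_arcsin ((hqc.mono hUA).div hρc fun y hy => (hρ y hy).ne') fun y hy => ?_)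
    have h2 := habs y hy
    simp only [Set.mem_compl_iff, Set.mem_insert_iff, Set.mem_singleton_iff, not_or]
    constructor <;> intro h3 <;> rw [h3] at h2 <;> norm_num at h2
  · have h2 := hpos y hy
    have h3 := abs_le.1 (habs y hy).le
    have h4 : |n y 2| ≤ 1 := by
      rw [← sq_le_one_iff_abs_le_one]; linarith
    have hcos : Real.cos (Real.arcsin (q y / ρ y)) = p y / ρ y := by
      rw [Real.cos_arcsin, ← hq1 y hy, add_sub_cancel_left, Real.sqrt_sq (hpρ y hy).le]
    have hsin : Real.sin (Real.arcsin (q y / ρ y)) = q y / ρ y := Real.sin_arcsin h3.1 h3.2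
    have hst : Real.sin (Real.arccos (n y 2)) = ρ y := Real.sin_arccos _
    have hct : Real.cos (Real.arccos (n y 2)) = n y 2 :=
      Real.cos_arccos (abs_le.1 h4).1 (abs_le.1 h4).2
    have hρ0 := (hρ y hy).ne'
    have hz : ∀ z, ρ y * (z / ρ y) = z := fun z => by field_simp
    have hP : p y = n y 0 * Real.cos α + n y 1 * Real.sin α := rfl
    have hQ : q y = n y 1 * Real.cos α - n y 0 * Real.sin α := rfl
    ext i
    revert i
    rw [forall_fin_three]
    refine ⟨?_, ?_, ?_⟩
    · simp only [sphericalVec, Real.cos_add, hcos, hsin, hst]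
      show n y 0 = ρ y * (Real.cos α * (p y / ρ y) - Real.sin α * (q y / ρ y))
      linear_combination -(n y 0) * hα - Real.cos α * hz (p y) + Real.sin α * hz (q y)
        - Real.cos α * hP + Real.sin α * hQ
    · simp only [sphericalVec, Real.sin_add, hcos, hsin, hst]
      show n y 1 = ρ y * (Real.sin α * (p y / ρ y) + Real.cos α * (q y / ρ y))
      linear_combination -(n y 1) * hα - Real.sin α * hz (p y) - Real.cos α * hz (q y)
        - Real.sin α * hP - Real.cos α * hQ
    · simp only [sphericalVec, hct]
      rfl

/-- The order parameter attains its boundary values in the sense of traces. -/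
theorem Admissible.memW12Zero_order {Ω : Set E3} (hΩ : IsOpen Ω) (hfin : volume Ω ≠ ⊤)
    {a b c : ℝ} (hb : 0 < b) (hc : 0 < c) {nb : E3 → E3} (hnb : MemW12Sphere Ω nb) {Q : E3 → M3}
    (hQ : Admissible Ω a b c nb Q) {s : E3 → ℝ} {n : E3 → E3} (hrep : IsUniaxialRep Ω Q s n)
    (hs : ∀ᵐ x ∂(volume.restrict Ω), 0 ≤ s x) : MemW12Zero Ω (fun x => s x - sPlus a b c) := by
  -- For `s ≥ 0` the order parameter is `√(3/2) |Q|`, a Lipschitz function of `Q` that takes the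
  -- value `s₊` on the boundary datum.
  have hF : LipschitzWith (√(3 / 2)).toNNReal
      fun v : EuclideanSpace ℝ (Fin 3 × Fin 3) => √(3 / 2) * ‖v‖ := by
    refine LipschitzWith.of_dist_le_mul fun v w => ?_
    rw [Real.dist_eq, ← mul_sub, abs_mul, abs_of_nonneg (Real.sqrt_nonneg _),
      Real.coe_toNNReal _ (Real.sqrt_nonneg _), dist_eq_norm]
    exact mul_le_mul_of_nonneg_left (abs_norm_sub_norm_le _ _) (Real.sqrt_nonneg _)
  have := memW12Zero_lipschitz_comp hΩ hfin (ι := Fin 3 × Fin 3)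
    (U := fun p x => Q x p.1 p.2) (V := fun p x => uniaxial (sPlus a b c) (nb x) p.1 p.2)
    (B := 2 * |sPlus a b c|) (by positivity) (fun p => hQ.1 _ _)
    (fun p => hQ.memW12_boundary _ _)
    (fun p => by filter_upwards [hnb.2] with x hx using abs_uniaxial_le _ hx _ _)
    (fun p => hQ.2.2 _ _) hF
  refine this.congr hΩ ?_
  filter_upwards [hrep.1.2, hrep.2, hs, hnb.2] with x h1 h2 h3 h4
  have e1 := norm_entries_uniaxial (s x) h1
  have e2 := norm_entries_uniaxial (sPlus a b c) h4
  rw [abs_of_nonneg h3, ← h2] at e1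
  rw [abs_of_pos (sPlus_pos hb hc)] at e2
  simp only [entries] at e1 e2
  rw [e1, e2]

end LandauDeGennes

/-! ### The main theorem -/

theorem proposition1 (Ω : Set E3) (hΩ : IsNematicDomain Ω)
    (a b c C L : ℝ) (ha : 0 < a) (hb : 0 < b) (hc : 0 < c) (hL : 0 < L)
    (hC : ∀ M : M3, IsQTensor M → 0 ≤ bulk a b c C M)
    (nb : E3 → E3) (hnb : MemW12Sphere Ω nb)
    (Q : E3 → M3) (hQ : IsGlobalMinimizer Ω a b c C L nb Q)
    (s₀ : E3 → ℝ) (n₀ : E3 → E3) (hrep : IsUniaxialRep Ω Q s₀ n₀) :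
    ∃ (s : E3 → ℝ) (n : E3 → E3),
      -- `s, n` are representatives of the given `s₀, n₀`
      s =ᵐ[volume.restrict Ω] s₀ ∧ n =ᵐ[volume.restrict Ω] n₀ ∧
      IsUniaxialRep Ω Q s n ∧
      -- `s` is nonnegative on the closed domain, with boundary values `s₊`
      (∀ x ∈ closure Ω, 0 ≤ s x) ∧ MemW12Zero Ω (fun x => s x - sPlus a b c) ∧
      -- regularity, which makes the equations below classical
      ContinuousOn s Ω ∧ (∀ x ∈ Ω, ‖n x‖ = 1) ∧
      ContDiffOn ℝ 2 s (anisotropicSet Ω s) ∧ ContDiffOn ℝ 2 n (anisotropicSet Ω s) ∧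
      -- the equations for `s` and `n`
      (∀ x ∈ anisotropicSet Ω s,
        Δ s x - 3 * s x * vecGradSq n x
          = s x / (3 * L) * (2 * c ^ 2 * s x ^ 2 - b ^ 2 * s x - 3 * a ^ 2)) ∧
      (∀ x ∈ anisotropicSet Ω s, ∀ j : Fin 3,
        Δ (fun y => n y j) x + vecGradSq n x * n x j
          + 2 * ∑ k, pd k s x / s x * pd k (fun y => n y j) x = 0) ∧
      -- spherical angles exist locally off the poles
      (∀ x ∈ anisotropicSet Ω s, |n x 2| < 1 →
        ∃ (U : Set E3) (θ φ : E3 → ℝ), IsOpen U ∧ x ∈ U ∧ U ⊆ anisotropicSet Ω s ∧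
          ContDiffOn ℝ 2 θ U ∧ ContDiffOn ℝ 2 φ U ∧
          ∀ y ∈ U, n y = sphericalVec (θ y) (φ y)) ∧
      -- the equations for the spherical angles, for every choice of them
      (∀ (U : Set E3) (θ φ : E3 → ℝ), IsOpen U → U ⊆ anisotropicSet Ω s →
        ContDiffOn ℝ 2 θ U → ContDiffOn ℝ 2 φ U →
        (∀ y ∈ U, n y = sphericalVec (θ y) (φ y)) →
        ∀ x ∈ U,
          divGrad (fun y => s y ^ 2) θ x
            = s x ^ 2 * Real.sin (θ x) * Real.cos (θ x) * gradSq φ x ∧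
          divGrad (fun y => s y ^ 2 * Real.sin (θ y) ^ 2) φ x = 0) := by
  have hO := hΩ.isOpen
  have hfin : volume Ω ≠ ⊤ := hΩ.isBounded.measure_lt_top.ne
  obtain ⟨R, hR, hQR, hRT, hRl⟩ := hQ.exists_smooth_rep hO hfin hL hC hnb
  have hs₀ := hQ.ae_nonneg hO hfin hb hc hL hC hnb hrep
    (fun i j => (hR i j).of_le (by simp)) hQR hRT
  have hrepR : IsUniaxialRep Ω R s₀ n₀ :=
    ⟨hrep.1, by filter_upwards [hrep.2, hQR] with x h1 h2; rw [← h2, h1]⟩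
  obtain ⟨n, hnn₀, hn1, hn, hRn⟩ := exists_director hO hR hRT hrepR hs₀
  -- Being a square root, this representative is nonnegative at every point, including those of
  -- `∂Ω`; the trace statement ties it to `s₊` there.
  set s : E3 → ℝ := fun x => order (R x) with hs
  have hss₀ : s =ᵐ[volume.restrict Ω] s₀ := by
    filter_upwards [hrepR.1.2, hrepR.2, hs₀] with x h1 h2 h3
    simp only [hs]
    rw [h2, order_uniaxial h3 h1]
  have hrepn : IsUniaxialRep Ω Q s n := by
    refine ⟨⟨fun j => (hrep.1.1 j).congr ?_, Eventually.of_forall hn1⟩, ?_⟩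
    · filter_upwards [hnn₀] with x hx; rw [hx]
    · filter_upwards [hrep.2, hss₀, hnn₀] with x h1 h2 h3
      rw [h1, h2, h3]
  have hsc : ContinuousOn s Ω := continuousOn_order fun i j => (hR i j).continuousOn
  have hA : IsOpen (anisotropicSet Ω s) := isOpen_anisotropicSet hO hsc
  have hs2 : ContDiffOn ℝ 2 s (anisotropicSet Ω s) :=
    contDiffOn_order (fun i j => ((hR i j).mono fun x hx => hx.1).of_le
      (WithTop.coe_le_coe.2 (le_top : (2 : ℕ∞) ≤ ⊤))) fun x hx => hx.2
  -- The pointwise equation for `R` is rewritten for `s (n ⊗ n - I / 3)`, which agrees with `R` on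
  -- the whole open anisotropic set, so the Laplacians agree as well.
  have heq := fun x (hx : x ∈ anisotropicSet Ω s) =>
    order_director_equations (a := a) (b := b) (c := c) (L := L) hA hs2 hn (fun x _ => hn1 x)
      (fun i j y hy => by
        rw [← hRn y hy, ← hRl i j y hy.1]
        exact lapl_congr_on hA (fun z hz => by rw [hRn z hz]) hy) hx hx.2
  have hsn : ∀ᵐ x ∂(volume.restrict Ω), 0 ≤ s x := Eventually.of_forall fun x => Real.sqrt_nonneg _
  refine ⟨s, n, hss₀, hnn₀, hrepn, fun x _ => Real.sqrt_nonneg _,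
    hQ.1.memW12Zero_order hO hfin hb hc hnb hrepn hsn, hsc, fun x _ => hn1 x, hs2, hn,
    fun x hx => ?_, fun x hx j => ?_, fun x hx hp => ?_, fun U θ φ hU hUA hθ hφ hnU x hx => ?_⟩
  · rw [laplacian_eq_lapl (hs2.contDiffAt (hA.mem_nhds hx))]
    exact (heq x hx).1
  · rw [laplacian_eq_lapl ((contDiffOn_coord hn j).contDiffAt (hA.mem_nhds hx))]
    exact (heq x hx).2 j
  · exact exists_spherical_angles hA hn (fun x _ => hn1 x) hx hp
  · exact spherical_equations hU (hs2.mono hUA) hθ hφ hnU hx (hUA hx).2 (heq x (hUA hx)).2
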